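/- Setting. Let $A\in\mathbb R^{n\times n}$, $B^W\in\mathbb R^{n\times a}$, $B^P\in\mathbb R^{n\times b}$, $H\in\mathbb R^{m\times n}$, $B=[\,B^W\ B^P\,]$, let $Q_v\ge 0$, and let $0\le p<1$. Consider the noise-free system $$x_{k+1}=Ax_k+Bu_k+B^P\tilde u^P_k ,\qquad k\ge 0,$$ where $x_0$ is Gaussian with mean $\mu$ and covariance $\sigma\ge0$. The remote controller observes $y^W_k=\beta_kx_k$, where the $\beta_k\in\{0,1\}$ are i.i.d. with $P(\beta_k=1)=1-p$. The embedded controller observes in addition $y^P_k=Hx_k+v_k$, where $(v_k)$ is white Gaussian noise with mean $0$ and covariance $Q_v$; $x_0$, $(v_k)$, $(\beta_k)$ are independent. Put $\mathcal F^W_k=\sigma(y^W_0,\dots,y^W_k)$, $\mathcal F^P_k=\sigma(y^W_0,\dots,y^W_k,y^P_0,\dots,y^P_k)$, $\hat x^W_{k|k}=\mathbb E[x_k\mid\mathcal F^W_k]$ and $\hat x^P_{k|k}=\mathbb E[x_k\mid\mathcal F^P_k]$. Controls are admissible if they are square integrable, $u_k$ is $\mathcal F^W_k$-measurable, $\tilde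 u^P_k$ is $\mathcal F^P_k$-measurable and $\mathbb E[\tilde u^P_k\mid\mathcal F^W_k]=0$. The cost is $$J=\mathbb E\sum_{k=0}^\infty\big[x_k'Qx_k+u_k'Ru_k+\tilde u_k^{P\prime}R^P\tilde u^P_k\big],\qquad R=\mathrm{diag}(R^W,R^P).$$ The system is stabilizable in the mean-square sense if there are constant matrices $L^W,L^P$ such that with $u_k=L^W\hat x^W_{k|k}$ and $\tilde u^P_k=L^P(\hat x^P_{k|k}-\hat x^W_{k|k})$ one has $\mathbb E(x_k'x_k)\to0$ for every (Gaussian) initial state. Theorem. Assume $R^W>0$, $R^P>0$, $Q=D'D$ for some matrix $D$, $(A,Q^{1/2})$ observable and $(A,H)$ detectable. Then the system is stabilizable in the mean-square sense if and only if the coupled algebraic Riccati equations $$P^W=A'P^WA-M'\Gamma^{-1}M+Q,\qquad P^P=A'\Delta A-L'\Omega^{-1}L+Q,$$ with $\Gamma=B'P^WB+R$, $M=B'P^WA$, $\Omega=B^{P\prime}\Delta B^P+R^P$, $L=B^{P\prime}\Delta A$, $\Delta=(1-p)P^W+pP^P$, have solutions $P^W,P^P$ with $P^W>0$ and $\Delta>0$.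 In this case, for any such solutions, the controllers $$u_k=-\Gamma^{-1}M\hat x^W_{k|k},\qquad \tilde u^P_k=-\Omega^{-1}L(\hat x^P_{k|k}-\hat x^W_{k|k})$$ stabilize the system in the mean-square sense, are admissible, and minimize $J$ over all admissible controls, for every Gaussian initial state; the minimum $J^*$ is finite. Moreover, $$J^*=\mathbb E\big[x_0'P^W\hat x^W_{0|0}+x_0'P^P(\hat x^P_{0|0}-\hat x^W_{0|0})\big]+\sum_{i=0}^\infty\mathbb E\,\mathrm{tr}\big\{\Sigma_{i|i}\big[A'\Delta A+Q-p(A-G_{i+1}HA)'P^P(A-G_{i+1}HA)\big]-p\,Q_vG_{i+1}'P^PG_{i+1}\big\}$$ with a convergent series, where the Kalman filter covariances and gains along the reception sequence $(\beta_k)$ are given by $\Sigma_{0|-1}=\sigma$, $G_k=\Sigma_{k|k-1}H'(H\Sigma_{k|k-1}H'+Q_v)^{-1}$, $\Sigma_{k|k}=(1-\beta_k)\big[(I-G_kH)\Sigma_{k|k-1}(I-G_kH)'+G_kQ_vG_k'\big]$, $\Sigma_{k+1|k}=A\Sigma_{k|k}A'$. For this last formula the inverses are assumed to exist as long as no packet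 has been received (for instance $Q_v>0$); once a packet has been received, $\Sigma_{k|k-1}=0$ and $G_k=0$. -/

import Mathlib

open MeasureTheory ProbabilityTheory Filter Topology Matrix

noncomputable section

/-- Every complex eigenvalue of the real matrix `M` lies in the open unit disc. -/
def IsSchurStable {n : ℕ} (M : Matrix (Fin n) (Fin n) ℝ) : Prop :=
  ∀ z ∈ spectrum ℂ (M.map (algebraMap ℝ ℂ)), ‖z‖ < 1

/-- `(A, C)` is observable: the outputs `C A ^ k x`, `k = 0, 1, …`, determine `x`. -/
def IsObservablePair {n r : ℕ} (A : Matrix (Fin n) (Fin n) ℝ) (C : Matrix (Fin r) (Fin n) ℝ) :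
    Prop :=
  ∀ x : Fin n → ℝ, (∀ k : ℕ, (C * A ^ k) *ᵥ x = 0) → x = 0

/-- `(A, C)` is detectable: some output injection makes `A - K C` Schur stable. -/
def IsDetectablePair {n r : ℕ} (A : Matrix (Fin n) (Fin n) ℝ) (C : Matrix (Fin r) (Fin n) ℝ) :
    Prop :=
  ∃ K : Matrix (Fin n) (Fin r) ℝ, IsSchurStable (A - K * C)

/-- `X` is a Gaussian random vector with mean `mean` and (possibly singular) covariance `cov`:
every linear functional of `X` has the corresponding real Gaussian law. -/
def IsGaussianVector {Ω : Type} [MeasurableSpace Ω] {r : ℕ} (P : Measure Ω)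
    (X : Ω → Fin r → ℝ) (mean : Fin r → ℝ) (cov : Matrix (Fin r) (Fin r) ℝ) : Prop :=
  Measurable X ∧ cov.PosSemidef ∧
    ∀ c : Fin r → ℝ,
      P.map (fun ω => c ⬝ᵥ X ω) = gaussianReal (c ⬝ᵥ mean) (c ⬝ᵥ (cov *ᵥ c)).toNNReal

/-- The data of the networked control system: the plant `A`, `BW`, `BP`, the observation matrix `H`
and the observation noise covariance `Qv` of the embedded controller, the weights `Q`, `RW`, `RP`,
and the packet dropout probability `p`. -/
structure NCS (n m a b : ℕ) where
  A : Matrix (Fin n) (Fin n) ℝ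
  BW : Matrix (Fin n) (Fin a) ℝ
  BP : Matrix (Fin n) (Fin b) ℝ
  H : Matrix (Fin m) (Fin n) ℝ
  Qv : Matrix (Fin m) (Fin m) ℝ
  Q : Matrix (Fin n) (Fin n) ℝ
  RW : Matrix (Fin a) (Fin a) ℝ
  RP : Matrix (Fin b) (Fin b) ℝ
  p : ℝ

namespace NCS

variable {n m a b : ℕ}

/-- `B = [BW BP]`. -/
def B (S : NCS n m a b) : Matrix (Fin n) (Fin a ⊕ Fin b) ℝ :=
  Matrix.fromCols S.BW S.BP

/-- `R = diag(RW, RP)`. -/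
def R (S : NCS n m a b) : Matrix (Fin a ⊕ Fin b) (Fin a ⊕ Fin b) ℝ :=
  Matrix.fromBlocks S.RW 0 0 S.RP

/-! ### The coupled algebraic Riccati equations -/

def Delta (S : NCS n m a b) (PW PP : Matrix (Fin n) (Fin n) ℝ) : Matrix (Fin n) (Fin n) ℝ :=
  (1 - S.p) • PW + S.p • PP

def Gam (S : NCS n m a b) (PW : Matrix (Fin n) (Fin n) ℝ) :
    Matrix (Fin a ⊕ Fin b) (Fin a ⊕ Fin b) ℝ :=
  S.Bᵀ * PW * S.B + S.R

def M (S : NCS n m a b) (PW : Matrix (Fin n) (Fin n) ℝ) : Matrix (Fin a ⊕ Fin b) (Fin n) ℝ :=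
  S.Bᵀ * PW * S.A

def Om (S : NCS n m a b) (PW PP : Matrix (Fin n) (Fin n) ℝ) : Matrix (Fin b) (Fin b) ℝ :=
  S.BPᵀ * S.Delta PW PP * S.BP + S.RP

def L (S : NCS n m a b) (PW PP : Matrix (Fin n) (Fin n) ℝ) : Matrix (Fin b) (Fin n) ℝ :=
  S.BPᵀ * S.Delta PW PP * S.A

/-- `(PW, PP)` solves the coupled algebraic Riccati equations. -/
def IsRiccatiSolution (S : NCS n m a b) (PW PP : Matrix (Fin n) (Fin n) ℝ) : Prop :=
  PW = S.Aᵀ * PW * S.A - (S.M PW)ᵀ * (S.Gam PW)⁻¹ * S.M PW + S.Q ∧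
  PP = S.Aᵀ * S.Delta PW PP * S.A
        - (S.L PW PP)ᵀ * (S.Om PW PP)⁻¹ * S.L PW PP + S.Q

/-! ### The random inputs, the observations and the two estimators -/

/-- The random inputs of the system: a Gaussian initial state `x0`, Gaussian white observation noise
`v` and an i.i.d. Bernoulli reception process `β` (`β k = 1`, i.e. reception, with probability
`1 - p`), all independent. -/
structure IsInput (S : NCS n m a b) {Ω : Type} [MeasurableSpace Ω] (P : Measure Ω)
    (mean : Fin n → ℝ) (cov : Matrix (Fin n) (Fin n) ℝ)
    (x0 : Ω → Fin n → ℝ) (v : ℕ → Ω → Fin m → ℝ) (β : ℕ → Ω → ℝ) : Prop where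
  gaussian_x0 : IsGaussianVector P x0 mean cov
  gaussian_v : ∀ k, IsGaussianVector P (v k) 0 S.Qv
  measurable_β : ∀ k, Measurable (β k)
  β_zero_or_one : ∀ k ω, β k ω = 0 ∨ β k ω = 1
  β_prob : ∀ k, P {ω | β k ω = 1} = ENNReal.ofReal (1 - S.p)
  indep_v : iIndepFun v P
  indep_β : iIndepFun β P
  indep_v_β : IndepFun (fun ω k => v k ω) (fun ω k => β k ω) P
  indep_x0 : IndepFun x0 (fun ω => ((fun k => v k ω), (fun k => β k ω))) P

/-- The information of the remote controller at time `k`: the σ-algebra generated by the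
observations `β j • x j`, `j ≤ k`. -/
abbrev infoW {Ω : Type} (β : ℕ → Ω → ℝ) (x : ℕ → Ω → Fin n → ℝ) (k : ℕ) : MeasurableSpace Ω :=
  ⨆ j ≤ k, MeasurableSpace.comap (fun ω => β j ω • x j ω) inferInstance

/-- The information of the embedded controller at time `k`: the σ-algebra generated by the
observations `β j • x j` and `H x j + v j`, `j ≤ k`. -/
abbrev infoP (S : NCS n m a b) {Ω : Type} (v : ℕ → Ω → Fin m → ℝ) (β : ℕ → Ω → ℝ)
    (x : ℕ → Ω → Fin n → ℝ) (k : ℕ) : MeasurableSpace Ω :=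
  infoW β x k ⊔
    ⨆ j ≤ k, MeasurableSpace.comap (fun ω => S.H *ᵥ x j ω + v j ω) inferInstance

/-- The remote estimate: the conditional expectation of `x k` given the remote information. -/
def estW {Ω : Type} [MeasurableSpace Ω] (P : Measure Ω) (β : ℕ → Ω → ℝ)
    (x : ℕ → Ω → Fin n → ℝ) (k : ℕ) : Ω → Fin n → ℝ :=
  condExp (infoW β x k) P (x k)

/-- The embedded estimate: the conditional expectation of `x k` given the embedded information. -/
def estP (S : NCS n m a b) {Ω : Type} [MeasurableSpace Ω] (P : Measure Ω)
    (v : ℕ → Ω → Fin m → ℝ) (β : ℕ → Ω → ℝ) (x : ℕ → Ω → Fin n → ℝ) (k : ℕ) :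
    Ω → Fin n → ℝ :=
  condExp (S.infoP v β x k) P (x k)

/-! ### Trajectories, admissible controls and the cost -/

/-- `x` is the state of the noise-free system with initial state `x0` and controls `u`, `ut`. -/
def IsTrajectory (S : NCS n m a b) {Ω : Type} (x0 : Ω → Fin n → ℝ) (x : ℕ → Ω → Fin n → ℝ)
    (u : ℕ → Ω → (Fin a ⊕ Fin b) → ℝ) (ut : ℕ → Ω → Fin b → ℝ) : Prop :=
  x 0 = x0 ∧ ∀ k ω, x (k + 1) ω = S.A *ᵥ x k ω + S.B *ᵥ u k ω + S.BP *ᵥ ut k ω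

/-- Admissible controls: `u k` depends on the remote information, `ut k` on the embedded
information, and the conditional mean of `ut k` given the remote information vanishes. -/
structure IsAdmissible (S : NCS n m a b) {Ω : Type} [MeasurableSpace Ω] (P : Measure Ω)
    (x0 : Ω → Fin n → ℝ) (v : ℕ → Ω → Fin m → ℝ) (β : ℕ → Ω → ℝ)
    (x : ℕ → Ω → Fin n → ℝ) (u : ℕ → Ω → (Fin a ⊕ Fin b) → ℝ) (ut : ℕ → Ω → Fin b → ℝ) :
    Prop where
  traj : S.IsTrajectory x0 x u ut
  meas_u : ∀ k, Measurable[infoW β x k] (u k)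
  meas_ut : ∀ k, Measurable[S.infoP v β x k] (ut k)
  memLp_u : ∀ k, MemLp (u k) 2 P
  memLp_ut : ∀ k, MemLp (ut k) 2 P
  centered_ut : ∀ k, condExp (infoW β x k) P (ut k) =ᵐ[P] 0

/-- The closed loop under the linear feedback `u k = LW x̂W`, `ut k = LP (x̂P - x̂W)` with constant
gains. (The equations determine `x`, `u`, `ut` recursively and uniquely from `x0`, `v`, `β`.) -/
def IsFeedbackLoop (S : NCS n m a b) {Ω : Type} [MeasurableSpace Ω] (P : Measure Ω)
    (LW : Matrix (Fin a ⊕ Fin b) (Fin n) ℝ) (LP : Matrix (Fin b) (Fin n) ℝ)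
    (x0 : Ω → Fin n → ℝ) (v : ℕ → Ω → Fin m → ℝ) (β : ℕ → Ω → ℝ)
    (x : ℕ → Ω → Fin n → ℝ) (u : ℕ → Ω → (Fin a ⊕ Fin b) → ℝ) (ut : ℕ → Ω → Fin b → ℝ) : Prop :=
  S.IsTrajectory x0 x u ut ∧
  (∀ k ω, u k ω = LW *ᵥ estW P β x k ω) ∧
  (∀ k ω, ut k ω = LP *ᵥ (S.estP P v β x k ω - estW P β x k ω))

/-- `E (x_k' x_k) → 0`. -/
def MeanSquareConverges {Ω : Type} [MeasurableSpace Ω] (P : Measure Ω)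
    (x : ℕ → Ω → Fin n → ℝ) : Prop :=
  Tendsto (fun k => ∫⁻ ω, ENNReal.ofReal (x k ω ⬝ᵥ x k ω) ∂P) atTop (𝓝 0)

/-- The linear feedback with gains `LW`, `LP` makes the system mean-square stable: for every
(Gaussian) initial state, the state of the closed loop tends to zero in mean square. -/
def IsStabilizedBy (S : NCS n m a b) (LW : Matrix (Fin a ⊕ Fin b) (Fin n) ℝ)
    (LP : Matrix (Fin b) (Fin n) ℝ) : Prop :=
  ∀ (mean : Fin n → ℝ) (cov : Matrix (Fin n) (Fin n) ℝ), cov.PosSemidef →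
  ∀ (Ω : Type) [MeasurableSpace Ω] (P : Measure Ω) [IsProbabilityMeasure P]
    (x0 : Ω → Fin n → ℝ) (v : ℕ → Ω → Fin m → ℝ) (β : ℕ → Ω → ℝ),
    S.IsInput P mean cov x0 v β →
    ∃ x u ut, S.IsFeedbackLoop P LW LP x0 v β x u ut ∧ MeanSquareConverges P x

/-- The system is stabilizable in the mean-square sense. -/
def IsMeanSquareStabilizable (S : NCS n m a b) : Prop :=
  ∃ (LW : Matrix (Fin a ⊕ Fin b) (Fin n) ℝ) (LP : Matrix (Fin b) (Fin n) ℝ),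
    S.IsStabilizedBy LW LP

/-- The infinite-horizon cost `E ∑ (x'Qx + u'Ru + ut' RP ut)`, as an extended nonnegative real. -/
def cost (S : NCS n m a b) {Ω : Type} [MeasurableSpace Ω] (P : Measure Ω)
    (x : ℕ → Ω → Fin n → ℝ) (u : ℕ → Ω → (Fin a ⊕ Fin b) → ℝ) (ut : ℕ → Ω → Fin b → ℝ) :
    ENNReal :=
  ∫⁻ ω, ∑' k, ENNReal.ofReal
    (x k ω ⬝ᵥ (S.Q *ᵥ x k ω) + u k ω ⬝ᵥ (S.R *ᵥ u k ω) + ut k ω ⬝ᵥ (S.RP *ᵥ ut k ω)) ∂P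

/-! ### The Kalman filter of the embedded controller -/

/-- Covariance `H Σ H' + Qv` of the innovation, for the prediction error covariance `Sg`. -/
def innovCov (S : NCS n m a b) (Sg : Matrix (Fin n) (Fin n) ℝ) : Matrix (Fin m) (Fin m) ℝ :=
  S.H * Sg * S.Hᵀ + S.Qv

/-- Kalman gain `G = Σ H' (H Σ H' + Qv)⁻¹`. -/
def kalmanGain (S : NCS n m a b) (Sg : Matrix (Fin n) (Fin n) ℝ) : Matrix (Fin n) (Fin m) ℝ :=
  Sg * S.Hᵀ * (S.innovCov Sg)⁻¹

/-- Error covariance after the measurement update, `(I - G H) Σ (I - G H)' + G Qv G'`. -/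
def updCov (S : NCS n m a b) (Sg : Matrix (Fin n) (Fin n) ℝ) : Matrix (Fin n) (Fin n) ℝ :=
  (1 - S.kalmanGain Sg * S.H) * Sg * (1 - S.kalmanGain Sg * S.H)ᵀ
    + S.kalmanGain Sg * S.Qv * (S.kalmanGain Sg)ᵀ

/-- Prediction error covariance `Σ_{k|k-1}` along the reception sequence `r` (`r k = 1` for a
received packet, `r k = 0` for a lost one), started at `Σ_{0|-1} = cov`. A received packet makes
the error vanish. -/
def predCov (S : NCS n m a b) (cov : Matrix (Fin n) (Fin n) ℝ) (r : ℕ → ℝ) :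
    ℕ → Matrix (Fin n) (Fin n) ℝ
  | 0 => cov
  | k + 1 => S.A * ((1 - r k) • S.updCov (predCov S cov r k)) * S.Aᵀ

/-- Filtering error covariance `Σ_{k|k}` along the reception sequence `r`. -/
def filtCov (S : NCS n m a b) (cov : Matrix (Fin n) (Fin n) ℝ) (r : ℕ → ℝ) (k : ℕ) :
    Matrix (Fin n) (Fin n) ℝ :=
  (1 - r k) • S.updCov (S.predCov cov r k)

/-- The `i`-th term of the series in the optimal value, along the reception sequence `r`. Here
`G` is the gain `G_{i+1|i}`. -/
def valueTerm (S : NCS n m a b) (PW PP cov : Matrix (Fin n) (Fin n) ℝ) (r : ℕ → ℝ) (i : ℕ) : ℝ :=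
  let G := S.kalmanGain (S.predCov cov r (i + 1))
  Matrix.trace (S.filtCov cov r i *
      (S.Aᵀ * S.Delta PW PP * S.A + S.Q
        - S.p • ((S.A - G * S.H * S.A)ᵀ * PP * (S.A - G * S.H * S.A))))
    - S.p * Matrix.trace (S.Qv * Gᵀ * PP * G)

end NCS

end

set_option linter.unusedSectionVars false

/-! ### Quadratic forms, the Riccati operator and value iteration. -/

noncomputable section

namespace LQ

variable {ι κ l : Type*} [Fintype ι] [Fintype κ] [Fintype l]

/-! The state splits into three mutually orthogonal parts, x = `estA` + `gap` + `err`: the estimate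
from the remote information, what the embedded controller knows beyond it, and the error of the
embedded estimator. There is no dual effect: controls move the state by an amount the embedded
controller knows, so `err` is the error of the Kalman filter of the uncontrolled system, switched
off at the first reception. The filter error is jointly Gaussian with the measurements and
uncorrelated with them, hence independent of them; this is what makes it orthogonal to the whole
embedded information.

At a reception (probability 1 - p) the predicted gap merges into the remote estimate and is then
weighted by P^W; at a loss it stays a gap and is weighted by P^P. Its weight is therefore Δ =
(1-p)P^W + pP^P, and the two Riccati equations are the completions of the square in the remote part
and in the gap. The result is the identity `IsAdmissible.value_succ`: stage cost + V_{k+1} = V_k +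
`excess` + `estCost`, where V = E[`estA`' P^W `estA`] + E[`gap`' P^P `gap`], the excess is
nonnegative and vanishes for the claimed feedback, and `estCost` does not depend on the controls.
Detectability bounds the Kalman error and the absence of receptions has probability p^(k+1), so
`estCost` is summable. Finite cost and observability force the state, hence V, to zero. Telescoping
yields the lower bound V_0 + ∑ `estCost` for every admissible control, and equality together with
stability for the feedback.

The remote information is generated by β_k x_k alone, so a received zero looks like a loss. For the
lower bound the receptions are simply given to the remote controller (`infoA`). The embedded control
need not be centred for this larger information; its predictable part is moved into the joint
control, which changes neither the dynamics nor the cost. For the closed loop one shows that nothing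
was given away (`IsFeedbackLoop.knownAt`): before the first reception the state is Gaussian, so it
is either almost surely nonzero, and then the receptions are visible, or almost surely zero, and
then confusing the two cases is harmless.

Necessity rests on `exists_ric_eq`: value iteration from 0 converges to a Riccati solution as soon
as some sequence of inputs drives the identity matrix to zero. For P^W the sequence is the mean
dynamics of the stabilized loop. The equation for Δ is a Riccati equation for √p A with state weight
pQ + (1-p)P^W, and the sequence is p^(k/2) times the correlation of the loss-only state with the
initial state; it tends to zero because the event of no earlier reception has probability p^k. -/

theorem mulVec_dot (X : Matrix ι κ ℝ) (x : κ → ℝ) (y : ι → ℝ) :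
    (X *ᵥ x) ⬝ᵥ y = x ⬝ᵥ (Xᵀ *ᵥ y) := by
  rw [dotProduct_comm, dotProduct_mulVec, ← mulVec_transpose, dotProduct_comm]

theorem dot_mulVec_comm {S : Matrix ι ι ℝ} (hS : Sᵀ = S) (x y : ι → ℝ) :
    x ⬝ᵥ (S *ᵥ y) = y ⬝ᵥ (S *ᵥ x) := by
  rw [dotProduct_comm, mulVec_dot, hS]

theorem quad_nonneg {S : Matrix ι ι ℝ} (hS : S.PosSemidef) (x : ι → ℝ) : 0 ≤ x ⬝ᵥ (S *ᵥ x) := by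
  simpa using hS.dotProduct_mulVec_nonneg x

theorem quad_pos {S : Matrix ι ι ℝ} (hS : S.PosDef) {x : ι → ℝ} (hx : x ≠ 0) :
    0 < x ⬝ᵥ (S *ᵥ x) := by
  simpa using hS.dotProduct_mulVec_pos hx

theorem quad_zero {S : Matrix ι ι ℝ} (hS : S.PosSemidef) {x : ι → ℝ} (hx : x ⬝ᵥ (S *ᵥ x) = 0) :
    S *ᵥ x = 0 := by
  have := (hS.dotProduct_mulVec_zero_iff x).1
  simp only [star_trivial] at this
  exact this hx

theorem transpose_eq {S : Matrix ι ι ℝ} (hS : S.IsHermitian) : Sᵀ = S := by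
  simpa [conjTranspose_eq_transpose_of_trivial] using hS.eq

theorem isHermitian_iff {S : Matrix ι ι ℝ} : S.IsHermitian ↔ Sᵀ = S := by
  rw [IsHermitian, conjTranspose_eq_transpose_of_trivial]

theorem dot_self_nonneg (x : ι → ℝ) : 0 ≤ x ⬝ᵥ x :=
  Finset.sum_nonneg fun i _ => mul_self_nonneg _

theorem sq_le_dot_self (x : ι → ℝ) (i : ι) : x i ^ 2 ≤ x ⬝ᵥ x := by
  rw [sq]
  exact Finset.single_le_sum (f := fun i => x i * x i) (fun i _ => mul_self_nonneg _)
    (Finset.mem_univ i)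

/-- Sum of the absolute values of the entries. -/
def absSum (S : Matrix ι κ ℝ) : ℝ := ∑ i, ∑ j, |S i j|

theorem absSum_nonneg (S : Matrix ι κ ℝ) : 0 ≤ absSum S :=
  Finset.sum_nonneg fun _ _ => Finset.sum_nonneg fun _ _ => abs_nonneg _

theorem quad_le_absSum (S : Matrix ι ι ℝ) (x : ι → ℝ) :
    x ⬝ᵥ (S *ᵥ x) ≤ absSum S * (x ⬝ᵥ x) := by
  have h : x ⬝ᵥ (S *ᵥ x) = ∑ i, ∑ j, S i j * (x i * x j) := by
    simp only [dotProduct, mulVec, Finset.mul_sum]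
    exact Finset.sum_congr rfl fun i _ => Finset.sum_congr rfl fun j _ => by ring
  rw [h, absSum, Finset.sum_mul]
  refine Finset.sum_le_sum fun i _ => ?_
  rw [Finset.sum_mul]
  refine Finset.sum_le_sum fun j _ => ?_
  have h1 : |x i * x j| ≤ x ⬝ᵥ x := by
    rw [abs_mul]
    have := sq_le_dot_self x i
    have := sq_le_dot_self x j
    nlinarith [sq_nonneg (|x i| - |x j|), sq_abs (x i), sq_abs (x j)]
  calc S i j * (x i * x j) ≤ |S i j * (x i * x j)| := le_abs_self _
    _ = |S i j| * |x i * x j| := abs_mul _ _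
    _ ≤ _ := mul_le_mul_of_nonneg_left h1 (abs_nonneg _)

theorem mulVec_dot_self_le (S : Matrix κ ι ℝ) (x : ι → ℝ) :
    (S *ᵥ x) ⬝ᵥ (S *ᵥ x) ≤ absSum (Sᵀ * S) * (x ⬝ᵥ x) := by
  rw [mulVec_dot, mulVec_mulVec]
  exact quad_le_absSum _ _

theorem quad_add_le {S : Matrix ι ι ℝ} (hS : S.PosSemidef) (x y : ι → ℝ) :
    (x + y) ⬝ᵥ (S *ᵥ (x + y)) ≤ 2 * (x ⬝ᵥ (S *ᵥ x)) + 2 * (y ⬝ᵥ (S *ᵥ y)) := by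
  have h := quad_nonneg hS (x - y)
  simp only [mulVec_add, mulVec_sub, dotProduct_add, add_dotProduct, dotProduct_sub,
    sub_dotProduct] at h ⊢
  linarith

theorem dot_add_self_le (x y : ι → ℝ) :
    (x + y) ⬝ᵥ (x + y) ≤ 2 * (x ⬝ᵥ x) + 2 * (y ⬝ᵥ y) := by
  have h := dot_self_nonneg (x - y)
  simp only [dotProduct_add, add_dotProduct, dotProduct_sub, sub_dotProduct] at h ⊢
  linarith

section Riccati

variable [DecidableEq κ]

/-- The Riccati operator. -/
def ric (A : Matrix ι ι ℝ) (B : Matrix ι κ ℝ) (Q : Matrix ι ι ℝ) (R : Matrix κ κ ℝ)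
    (P : Matrix ι ι ℝ) : Matrix ι ι ℝ :=
  Aᵀ * P * A - (Bᵀ * P * A)ᵀ * (Bᵀ * P * B + R)⁻¹ * (Bᵀ * P * A) + Q

/-- The optimal gain. -/
def gain (A : Matrix ι ι ℝ) (B : Matrix ι κ ℝ) (R : Matrix κ κ ℝ)
    (P : Matrix ι ι ℝ) : Matrix κ ι ℝ :=
  (Bᵀ * P * B + R)⁻¹ * (Bᵀ * P * A)

variable {A Q : Matrix ι ι ℝ} {B : Matrix ι κ ℝ} {R : Matrix κ κ ℝ} {P P' : Matrix ι ι ℝ}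

theorem posDef_gram (hP : P.PosSemidef) (hR : R.PosDef) : (Bᵀ * P * B + R).PosDef := by
  refine PosDef.posSemidef_add ?_ hR
  simpa [conjTranspose_eq_transpose_of_trivial] using hP.conjTranspose_mul_mul_same B

theorem complete_square (hP : Pᵀ = P) (hR : Rᵀ = R) (hG : IsUnit (Bᵀ * P * B + R))
    (x : ι → ℝ) (u : κ → ℝ) :
    (A *ᵥ x + B *ᵥ u) ⬝ᵥ (P *ᵥ (A *ᵥ x + B *ᵥ u)) + x ⬝ᵥ (Q *ᵥ x) + u ⬝ᵥ (R *ᵥ u) =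
      x ⬝ᵥ (ric A B Q R P *ᵥ x) +
        (u + gain A B R P *ᵥ x) ⬝ᵥ ((Bᵀ * P * B + R) *ᵥ (u + gain A B R P *ᵥ x)) := by
  set G := Bᵀ * P * B + R with hGdef
  have hGT : Gᵀ = G := by
    rw [hGdef]; simp [transpose_mul, hP, hR, Matrix.mul_assoc]
  have hdet : IsUnit G.det := (Matrix.isUnit_iff_isUnit_det _).1 hG
  have hGK : G * gain A B R P = Bᵀ * P * A := by
    rw [gain, ← hGdef, ← Matrix.mul_assoc, mul_nonsing_inv _ hdet, Matrix.one_mul]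
  have hN : (Bᵀ * P * A)ᵀ = Aᵀ * P * B := by
    simp [transpose_mul, hP, Matrix.mul_assoc]
  have hric : ric A B Q R P = Aᵀ * P * A - (Aᵀ * P * B) * gain A B R P + Q := by
    rw [ric, gain, hN, ← hGdef, Matrix.mul_assoc (Aᵀ * P * B)]
  have e1 : x ⬝ᵥ ((Aᵀ * P * B) *ᵥ u) = u ⬝ᵥ ((Bᵀ * P * A) *ᵥ x) := by
    rw [← hN, ← mulVec_dot, dotProduct_comm]
  set K := gain A B R P
  have e2 : (K *ᵥ x) ⬝ᵥ (G *ᵥ u) = u ⬝ᵥ ((Bᵀ * P * A) *ᵥ x) := by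
    rw [dot_mulVec_comm hGT, mulVec_mulVec, hGK]
  have e3 : (K *ᵥ x) ⬝ᵥ (G *ᵥ (K *ᵥ x)) = x ⬝ᵥ (((Aᵀ * P * B) * K) *ᵥ x) := by
    rw [mulVec_mulVec, hGK, dotProduct_comm, mulVec_dot, hN, mulVec_mulVec]
  have e4 : u ⬝ᵥ (G *ᵥ (K *ᵥ x)) = u ⬝ᵥ ((Bᵀ * P * A) *ᵥ x) := by rw [mulVec_mulVec, hGK]
  have e5 : u ⬝ᵥ (G *ᵥ u) = u ⬝ᵥ ((Bᵀ * P * B) *ᵥ u) + u ⬝ᵥ (R *ᵥ u) := by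
    rw [hGdef, add_mulVec, dotProduct_add]
  simp only [mulVec_add, dotProduct_add, add_dotProduct, hric, add_mulVec, sub_mulVec,
    dotProduct_sub, e2, e3, e4, e5]
  simp only [mulVec_dot, mulVec_mulVec, ← Matrix.mul_assoc, e1]
  ring

/-- The completed square is nonnegative: the Riccati operator is the minimum over `u` of the
one-step cost with terminal weight `P`, attained at minus the gain times `x` (`quad_ric`). -/
theorem quad_ric_le (hP : P.PosSemidef) (hR : R.PosDef) (x : ι → ℝ) (u : κ → ℝ) :
    x ⬝ᵥ (ric A B Q R P *ᵥ x) ≤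
      (A *ᵥ x + B *ᵥ u) ⬝ᵥ (P *ᵥ (A *ᵥ x + B *ᵥ u)) + x ⬝ᵥ (Q *ᵥ x) + u ⬝ᵥ (R *ᵥ u) := by
  have hG := posDef_gram (B := B) hP hR
  rw [complete_square (transpose_eq hP.1) (transpose_eq hR.1) hG.isUnit]
  linarith [quad_nonneg hG.posSemidef (u + gain A B R P *ᵥ x)]

theorem quad_ric (hP : P.PosSemidef) (hR : R.PosDef) (x : ι → ℝ) :
    x ⬝ᵥ (ric A B Q R P *ᵥ x) =
      (A *ᵥ x + B *ᵥ (-(gain A B R P *ᵥ x))) ⬝ᵥ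
        (P *ᵥ (A *ᵥ x + B *ᵥ (-(gain A B R P *ᵥ x)))) + x ⬝ᵥ (Q *ᵥ x)
        + (gain A B R P *ᵥ x) ⬝ᵥ (R *ᵥ (gain A B R P *ᵥ x)) := by
  have hG := posDef_gram (B := B) hP hR
  have := complete_square (A := A) (Q := Q) (transpose_eq hP.1) (transpose_eq hR.1) hG.isUnit x
    (-(gain A B R P *ᵥ x))
  simp only [neg_add_cancel, mulVec_zero, zero_dotProduct, add_zero] at this
  rw [← this]
  simp [mulVec_neg]

theorem transpose_ric (hP : Pᵀ = P) (hR : Rᵀ = R) (hQ : Qᵀ = Q) :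
    (ric A B Q R P)ᵀ = ric A B Q R P := by
  have hG : (Bᵀ * P * B + R)ᵀ = Bᵀ * P * B + R := by
    simp [transpose_mul, hP, hR, Matrix.mul_assoc]
  rw [ric, transpose_add, transpose_sub, hQ]
  rw [transpose_mul ((Bᵀ * P * A)ᵀ * _), transpose_mul ((Bᵀ * P * A)ᵀ), transpose_nonsing_inv, hG]
  simp [transpose_mul, hP, Matrix.mul_assoc]

theorem posSemidef_ric (hP : P.PosSemidef) (hR : R.PosDef) (hQ : Q.PosSemidef) :
    (ric A B Q R P).PosSemidef := by
  refine PosSemidef.of_dotProduct_mulVec_nonneg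
    (isHermitian_iff.2 (transpose_ric (transpose_eq hP.1) (transpose_eq hR.1)
      (transpose_eq hQ.1))) fun x => ?_
  simp only [star_trivial]
  rw [quad_ric hP hR]
  exact add_nonneg (add_nonneg (quad_nonneg hP _) (quad_nonneg hQ _)) (quad_nonneg hR.posSemidef _)

/-- The minimizer for the larger terminal weight is a competitor for the smaller one. -/
theorem quad_ric_mono (hP : P.PosSemidef) (hP' : P'.PosSemidef) (hR : R.PosDef)
    (h : ∀ x, x ⬝ᵥ (P *ᵥ x) ≤ x ⬝ᵥ (P' *ᵥ x)) (x : ι → ℝ) :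
    x ⬝ᵥ (ric A B Q R P *ᵥ x) ≤ x ⬝ᵥ (ric A B Q R P' *ᵥ x) := by
  rw [quad_ric hP' hR]
  refine (quad_ric_le hP hR x (-(gain A B R P' *ᵥ x))).trans ?_
  have := h (A *ᵥ x + B *ᵥ (-(gain A B R P' *ᵥ x)))
  simp only [mulVec_neg, neg_dotProduct, dotProduct_neg, neg_neg] at this ⊢
  linarith

/-- The inverse is the adjugate divided by the determinant, and both are polynomial in the entries.
-/
theorem tendsto_inv_matrix {p : ℕ → Matrix κ κ ℝ} {G : Matrix κ κ ℝ}
    (hp : Tendsto p atTop (𝓝 G)) (hdet : G.det ≠ 0) :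
    Tendsto (fun k => (p k)⁻¹) atTop (𝓝 G⁻¹) := by
  have h1 : Tendsto (fun k => (p k).det) atTop (𝓝 G.det) :=
    ((by fun_prop : Continuous fun X : Matrix κ κ ℝ => X.det).tendsto G).comp hp
  have h2 : Tendsto (fun k => (p k).adjugate) atTop (𝓝 G.adjugate) :=
    ((by fun_prop : Continuous fun X : Matrix κ κ ℝ => X.adjugate).tendsto G).comp hp
  simp only [Matrix.inv_def, Ring.inverse_eq_inv']
  exact (h1.inv₀ hdet).smul h2

theorem tendsto_ric {p : ℕ → Matrix ι ι ℝ} (hp : Tendsto p atTop (𝓝 P)) (hP : P.PosSemidef)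
    (hR : R.PosDef) : Tendsto (fun k => ric A B Q R (p k)) atTop (𝓝 (ric A B Q R P)) := by
  have hc : Tendsto (fun k => Bᵀ * p k * B + R) atTop (𝓝 (Bᵀ * P * B + R)) :=
    ((by fun_prop : Continuous fun X : Matrix ι ι ℝ => Bᵀ * X * B + R).tendsto P).comp hp
  have hinv := tendsto_inv_matrix hc (posDef_gram (B := B) hP hR).det_pos.ne'
  have hc : Continuous fun Y : Matrix ι ι ℝ × Matrix κ κ ℝ =>
      Aᵀ * Y.1 * A - (Bᵀ * Y.1 * A)ᵀ * Y.2 * (Bᵀ * Y.1 * A) + Q := by fun_prop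
  have h := (hc.tendsto (P, (Bᵀ * P * B + R)⁻¹)).comp (hp.prodMk_nhds hinv)
  simp only [Function.comp_def] at h
  simpa only [ric] using h

end Riccati

theorem entry_eq_polar [DecidableEq ι] {S : Matrix ι ι ℝ} (hS : Sᵀ = S) (i j : ι) :
    S i j = ((Pi.single i 1 + Pi.single j 1) ⬝ᵥ (S *ᵥ (Pi.single i 1 + Pi.single j 1))
      - Pi.single i 1 ⬝ᵥ (S *ᵥ Pi.single i 1) - Pi.single j 1 ⬝ᵥ (S *ᵥ Pi.single j 1)) / 2 := by
  have h : S j i = S i j := by conv_lhs => rw [← hS, transpose_apply]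
  simp [mulVec_add, h]
  ring

/-- Each quadratic form converges, being monotone and bounded; polarization turns this into
convergence of every entry. -/
theorem tendsto_of_mono_bdd {p : ℕ → Matrix ι ι ℝ} (hs : ∀ k, (p k).PosSemidef)
    (hm : ∀ k x, x ⬝ᵥ (p k *ᵥ x) ≤ x ⬝ᵥ (p (k + 1) *ᵥ x)) {C : ℝ}
    (hb : ∀ k x, x ⬝ᵥ (p k *ᵥ x) ≤ C * (x ⬝ᵥ x)) :
    ∃ P : Matrix ι ι ℝ, P.PosSemidef ∧ Tendsto p atTop (𝓝 P) := by
  classical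
  have hq : ∀ x : ι → ℝ, ∃ c, Tendsto (fun k => x ⬝ᵥ (p k *ᵥ x)) atTop (𝓝 c) := fun x =>
    ⟨_, tendsto_atTop_ciSup (monotone_nat_of_le_succ fun k => hm k x)
      ⟨C * (x ⬝ᵥ x), by rintro _ ⟨k, rfl⟩; exact hb k x⟩⟩
  choose c hc using hq
  have ht : Tendsto p atTop (𝓝 (Matrix.of fun i j : ι =>
      (c (Pi.single i 1 + Pi.single j 1) - c (Pi.single i 1) - c (Pi.single j 1)) / 2)) := by
    refine tendsto_pi_nhds.2 fun i => tendsto_pi_nhds.2 fun j => ?_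
    have : (fun k => p k i j) = fun k => _ :=
      funext fun k => entry_eq_polar (transpose_eq (hs k).1) i j
    rw [this]
    exact (((hc _).sub (hc _)).sub (hc _)).div_const _
  refine ⟨_, ?_, ht⟩
  refine PosSemidef.of_dotProduct_mulVec_nonneg (isHermitian_iff.2 ?_) fun x => ?_
  · ext i j
    simp only [transpose_apply, of_apply]
    rw [add_comm (Pi.single j 1)]; ring
  · have hx : Tendsto (fun k => x ⬝ᵥ (p k *ᵥ x)) atTop (𝓝 _) :=
      ((Continuous.tendsto (by fun_prop : Continuous fun X : Matrix ι ι ℝ => x ⬝ᵥ (X *ᵥ x)) _)).comp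
        ht
    simpa using ge_of_tendsto' hx fun k => quad_nonneg (hs k) x

/-- Value iteration from 0 increases, and its limit is a fixed point by continuity. The inputs `U k
*ᵥ x` are an open-loop policy moving `x` along `F k *ᵥ x`. Only `F → 0` is known, not summability,
so the uniform bound comes from restarting the policy each time the state has been contracted by a
fixed factor. -/
theorem exists_ric_eq [DecidableEq ι] [DecidableEq κ] {A Q : Matrix ι ι ℝ} {B : Matrix ι κ ℝ}
    {R : Matrix κ κ ℝ} (hQ : Q.PosSemidef) (hR : R.PosDef) {F : ℕ → Matrix ι ι ℝ}
    {U : ℕ → Matrix κ ι ℝ} (h0 : F 0 = 1) (hs : ∀ k, F (k + 1) = A * F k + B * U k)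
    (hF : Tendsto F atTop (𝓝 0)) :
    ∃ P : Matrix ι ι ℝ, P.PosSemidef ∧ P = ric A B Q R P := by
  set p : ℕ → Matrix ι ι ℝ := fun k => (ric A B Q R)^[k] 0 with hp
  have hp0 : p 0 = 0 := rfl
  have hps : ∀ k, p (k + 1) = ric A B Q R (p k) := fun k => Function.iterate_succ_apply' _ _ _
  have hpsd : ∀ k, (p k).PosSemidef := by
    intro k
    induction k with
    | zero => rw [hp0]; exact PosSemidef.zero
    | succ k ih => rw [hps]; exact posSemidef_ric ih hR hQ
  have hmono : ∀ k x, x ⬝ᵥ (p k *ᵥ x) ≤ x ⬝ᵥ (p (k + 1) *ᵥ x) := by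
    intro k
    induction k with
    | zero => intro x; rw [hp0]; simpa using quad_nonneg (hpsd 1) x
    | succ k ih => intro x; rw [hps, hps (k + 1)]; exact quad_ric_mono (hpsd _) (hpsd _) hR ih x
  -- `K` is the length of a block after which the squared norm is at least halved; `1 ≤ K` lets the
  -- strong induction below descend.
  have hK : ∃ K, 1 ≤ K ∧ absSum ((F K)ᵀ * F K) < 1 / 2 := by
    have : Tendsto (fun k => absSum ((F k)ᵀ * F k)) atTop (𝓝 (absSum ((0 : Matrix ι ι ℝ)ᵀ * 0))) := by
      have hc : Continuous fun X : Matrix ι ι ℝ => absSum (Xᵀ * X) := by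
        unfold absSum; fun_prop
      exact (hc.tendsto 0).comp hF
    have h2 : absSum ((0 : Matrix ι ι ℝ)ᵀ * 0) = 0 := by simp [absSum]
    rw [h2] at this
    obtain ⟨K, h, h'⟩ := ((this.eventually (gt_mem_nhds (by norm_num : (0 : ℝ) < 1 / 2))).and
      (eventually_ge_atTop 1)).exists
    exact ⟨K, h', h⟩
  obtain ⟨K, hK1, hK⟩ := hK
  set S : Matrix ι ι ℝ := ∑ j ∈ Finset.range K, ((F j)ᵀ * Q * F j + (U j)ᵀ * R * U j) with hS
  -- Following the policy for `k` stages costs the running sum and leaves `p N` as weight on the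
  -- state reached.
  have hstep : ∀ (k N : ℕ) (x : ι → ℝ), x ⬝ᵥ (p (N + k) *ᵥ x) ≤
      x ⬝ᵥ ((∑ j ∈ Finset.range k, ((F j)ᵀ * Q * F j + (U j)ᵀ * R * U j)) *ᵥ x) +
        (F k *ᵥ x) ⬝ᵥ (p N *ᵥ (F k *ᵥ x)) := by
    intro k
    induction k with
    | zero => intro N x; simp [h0]
    | succ k ih =>
      intro N x
      have h1 := ih (N + 1) x
      have h2 := quad_ric_le (A := A) (B := B) (Q := Q) (hpsd N) hR (F k *ᵥ x) (U k *ᵥ x)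
      rw [hps] at h1
      rw [show N + (k + 1) = N + 1 + k by ring, Finset.sum_range_succ, add_mulVec, dotProduct_add]
      have h3 : F (k + 1) *ᵥ x = A *ᵥ (F k *ᵥ x) + B *ᵥ (U k *ᵥ x) := by
        rw [hs, add_mulVec, mulVec_mulVec, mulVec_mulVec]
      rw [h3]
      have h4 : x ⬝ᵥ (((F k)ᵀ * Q * F k + (U k)ᵀ * R * U k) *ᵥ x) =
          (F k *ᵥ x) ⬝ᵥ (Q *ᵥ (F k *ᵥ x)) + (U k *ᵥ x) ⬝ᵥ (R *ᵥ (U k *ᵥ x)) := by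
        simp only [mulVec_dot, mulVec_mulVec, add_mulVec, dotProduct_add, Matrix.mul_assoc]
      rw [h4]
      linarith
  -- A block costs at most `absSum S` and halves what remains: `2 * absSum S` is the fixed point of
  -- c ↦ `absSum S` + c/2.
  have hb : ∀ (N : ℕ) (x : ι → ℝ), x ⬝ᵥ (p N *ᵥ x) ≤ (2 * absSum S) * (x ⬝ᵥ x) := by
    intro N
    induction N using Nat.strong_induction_on with
    | _ N ih =>
      intro x
      by_cases hN : N < K
      · have hmon : x ⬝ᵥ (p N *ᵥ x) ≤ x ⬝ᵥ (p K *ᵥ x) :=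
          (monotone_nat_of_le_succ fun k => hmono k x) hN.le
        have h1 := hstep K 0 x
        rw [zero_add, hp0] at h1
        simp only [zero_mulVec, dotProduct_zero, add_zero] at h1
        have h2 := quad_le_absSum S x
        have := mul_nonneg (absSum_nonneg S) (dot_self_nonneg x)
        linarith
      · obtain ⟨M, rfl⟩ := Nat.exists_eq_add_of_le' (not_lt.1 hN)
        have h1 := hstep K M x
        have h2 := quad_le_absSum S x
        have h3 := ih M (by omega) (F K *ᵥ x)
        have h4 := mulVec_dot_self_le (F K) x
        have h5 : (F K *ᵥ x) ⬝ᵥ (F K *ᵥ x) ≤ 1 / 2 * (x ⬝ᵥ x) :=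
          h4.trans (mul_le_mul_of_nonneg_right hK.le (dot_self_nonneg x))
        have h6 := mul_le_mul_of_nonneg_left h5 (by linarith [absSum_nonneg S] : 0 ≤ 2 * absSum S)
        linarith
  obtain ⟨P, hP, ht⟩ := tendsto_of_mono_bdd hpsd hmono hb
  refine ⟨P, hP, tendsto_nhds_unique ((tendsto_add_atTop_iff_nat 1).2 ht) ?_⟩
  simp only [hps]
  exact tendsto_ric ht hP hR

end LQ
end

/-! ### Observability estimates and powers of Schur stable matrices. -/

noncomputable section

namespace LQ

variable {n r : ℕ}

theorem quad_mul_self {C : Matrix (Fin n) (Fin n) ℝ} (hC : C.PosSemidef) (x : Fin n → ℝ) :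
    x ⬝ᵥ ((C * C) *ᵥ x) = (C *ᵥ x) ⬝ᵥ (C *ᵥ x) := by
  rw [mulVec_dot, transpose_eq hC.1, mulVec_mulVec]

/-- A null vector `y` of `P` has zero optimal cost: its output and its optimal control vanish, so `A
*ᵥ y` is again a null vector. The whole output sequence is then zero and observability applies. -/
theorem posDef_of_ric_eq {κ : Type*} [Fintype κ] [DecidableEq κ] {A C P : Matrix (Fin n) (Fin n) ℝ}
    {B : Matrix (Fin n) κ ℝ} {R : Matrix κ κ ℝ} (hC : C.PosSemidef) (hR : R.PosDef)
    (hobs : IsObservablePair A C) (hP : P.PosSemidef) (h : P = ric A B (C * C) R P) :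
    P.PosDef := by
  refine PosDef.of_dotProduct_mulVec_pos hP.1 fun x hx => ?_
  simp only [star_trivial]
  refine lt_of_le_of_ne (quad_nonneg hP x) fun h0 => hx (hobs x ?_)
  have key : ∀ y, y ⬝ᵥ (P *ᵥ y) = 0 → C *ᵥ y = 0 ∧ (A *ᵥ y) ⬝ᵥ (P *ᵥ (A *ᵥ y)) = 0 := by
    intro y hy
    have h1 := hy
    rw [h, quad_ric hP hR, quad_mul_self hC] at h1
    set K := gain A B R P
    have a1 := quad_nonneg hP (A *ᵥ y + B *ᵥ (-(K *ᵥ y)))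
    have a2 := dot_self_nonneg (C *ᵥ y)
    have a3 := quad_nonneg hR.posSemidef (K *ᵥ y)
    have hK : K *ᵥ y = 0 := by
      by_contra hne
      linarith [quad_pos hR hne]
    refine ⟨dotProduct_self_eq_zero.1 (by linarith), ?_⟩
    rw [hK] at h1
    simp only [neg_zero, mulVec_zero, add_zero, dotProduct_zero] at h1
    linarith [quad_nonneg hP (A *ᵥ y)]
  have hk : ∀ k, (A ^ k *ᵥ x) ⬝ᵥ (P *ᵥ (A ^ k *ᵥ x)) = 0 := by
    intro k
    induction k with
    | zero => simpa using h0.symm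
    | succ k ih => rw [pow_succ', ← mulVec_mulVec]; exact (key _ ih).2
  intro k
  rw [← mulVec_mulVec]
  exact (key _ (hk k)).1

/-- The kernels of the stacked matrices C, CA, CA², … form a decreasing chain of subspaces, which
stabilizes; finitely many outputs thus define an injective linear map, and this map is bounded
below. -/
theorem exists_observability_bound {A : Matrix (Fin n) (Fin n) ℝ} {C : Matrix (Fin r) (Fin n) ℝ}
    (hobs : IsObservablePair A C) : ∃ (N : ℕ) (c : ℝ), 0 ≤ c ∧ ∀ x : Fin n → ℝ,
      x ⬝ᵥ x ≤ c * ∑ k ∈ Finset.range N, ((C * A ^ k) *ᵥ x) ⬝ᵥ ((C * A ^ k) *ᵥ x) := by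
  let f : ℕ →o (Submodule ℝ (Fin n → ℝ))ᵒᵈ :=
    ⟨fun N => OrderDual.toDual (⨅ k : Fin N, (C * A ^ (k : ℕ)).mulVecLin.ker), by
      intro a b hab
      change (⨅ k : Fin b, (C * A ^ (k : ℕ)).mulVecLin.ker) ≤
        ⨅ k : Fin a, (C * A ^ (k : ℕ)).mulVecLin.ker
      refine le_iInf fun k => ?_
      exact iInf_le (fun k : Fin b => (C * A ^ (k : ℕ)).mulVecLin.ker) ⟨k, k.2.trans_le hab⟩⟩
  obtain ⟨N, hN⟩ := IsArtinian.monotone_stabilizes f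
  let O : (Fin n → ℝ) →ₗ[ℝ] (Fin N → Fin r → ℝ) :=
    LinearMap.pi fun k => (C * A ^ (k : ℕ)).mulVecLin
  have hker : O.ker = ⊥ := by
    rw [Submodule.eq_bot_iff]
    intro x hx
    rw [LinearMap.mem_ker] at hx
    refine hobs x fun k => ?_
    have hxN : x ∈ (OrderDual.ofDual (f N) : Submodule ℝ (Fin n → ℝ)) := by
      refine (Submodule.mem_iInf _).2 fun j => ?_
      exact congrFun hx j
    have hxM : x ∈ (OrderDual.ofDual (f (max N (k + 1))) : Submodule ℝ (Fin n → ℝ)) := by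
      rw [← hN _ (le_max_left _ _)]; exact hxN
    have := (Submodule.mem_iInf _).1 hxM ⟨k, lt_of_lt_of_le (Nat.lt_succ_self k) (le_max_right _ _)⟩
    simpa using this
  obtain ⟨K, -, hK⟩ := O.exists_antilipschitzWith hker
  -- `K` is the lower-bound constant of the stacked map in the sup norm; `n` compares the Euclidean
  -- square with the sup norm.
  refine ⟨N, n * (K : ℝ) ^ 2, by positivity, fun x => ?_⟩
  set s := ∑ k ∈ Finset.range N, ((C * A ^ k) *ᵥ x) ⬝ᵥ ((C * A ^ k) *ᵥ x) with hs
  have hs0 : 0 ≤ s := Finset.sum_nonneg fun _ _ => dot_self_nonneg _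
  have h1 : ‖x‖ ≤ K * ‖O x‖ := by simpa using hK.le_mul_dist x 0
  have h2 : ‖O x‖ ≤ Real.sqrt s := by
    refine (pi_norm_le_iff_of_nonneg (Real.sqrt_nonneg _)).2 fun k =>
      (pi_norm_le_iff_of_nonneg (Real.sqrt_nonneg _)).2 fun i => ?_
    rw [Real.norm_eq_abs]
    refine Real.abs_le_sqrt ?_
    refine (sq_le_dot_self _ i).trans ?_
    exact Finset.single_le_sum (f := fun k => ((C * A ^ k) *ᵥ x) ⬝ᵥ ((C * A ^ k) *ᵥ x))
      (fun _ _ => dot_self_nonneg _) (Finset.mem_range.2 k.2)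
  have h3 : x ⬝ᵥ x ≤ n * ‖x‖ ^ 2 := by
    calc x ⬝ᵥ x = ∑ i, x i * x i := rfl
      _ ≤ ∑ _i : Fin n, ‖x‖ ^ 2 := Finset.sum_le_sum fun i _ => by
          have := norm_le_pi_norm x i
          rw [← sq, ← sq_abs, ← Real.norm_eq_abs]
          exact pow_le_pow_left₀ (norm_nonneg _) this 2
      _ = n * ‖x‖ ^ 2 := by simp
  calc x ⬝ᵥ x ≤ n * ‖x‖ ^ 2 := h3
    _ ≤ n * (K * Real.sqrt s) ^ 2 := by
        gcongr
        exact h1.trans (mul_le_mul_of_nonneg_left h2 K.2)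
    _ = n * (K : ℝ) ^ 2 * s := by rw [mul_pow, Real.sq_sqrt hs0]; ring

/-- Induction on `k` by shifting the trajectory by one step: C A^(k+1) x_0 = C A^k x_1 - C A^k w_0.
-/
theorem exists_output_bound (A : Matrix (Fin n) (Fin n) ℝ) (C : Matrix (Fin r) (Fin n) ℝ) (k : ℕ) :
    ∃ c : ℝ, 0 ≤ c ∧ ∀ x w : ℕ → Fin n → ℝ, (∀ j, x (j + 1) = A *ᵥ x j + w j) →
      ((C * A ^ k) *ᵥ x 0) ⬝ᵥ ((C * A ^ k) *ᵥ x 0) ≤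
        c * ∑ j ∈ Finset.range (k + 1), ((C *ᵥ x j) ⬝ᵥ (C *ᵥ x j) + w j ⬝ᵥ w j) := by
  induction k with
  | zero =>
    refine ⟨1, zero_le_one, fun x w _ => ?_⟩
    have := dot_self_nonneg (w 0)
    simp only [pow_zero, Matrix.mul_one, zero_add, Finset.range_one, Finset.sum_singleton, one_mul]
    linarith
  | succ k ih =>
    obtain ⟨c, hc, h⟩ := ih
    set D := C * A ^ k
    refine ⟨2 * c + 2 * absSum (Dᵀ * D), by linarith [absSum_nonneg (Dᵀ * D)], fun x w hx => ?_⟩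
    have h1 := h (fun j => x (j + 1)) (fun j => w (j + 1)) fun j => hx (j + 1)
    have e : (C * A ^ (k + 1)) *ᵥ x 0 = D *ᵥ x (0 + 1) + D *ᵥ (-w 0) := by
      rw [hx 0, mulVec_add, mulVec_neg, mulVec_mulVec, pow_succ, ← Matrix.mul_assoc]
      simp [D]
    rw [e]
    refine (dot_add_self_le _ _).trans ?_
    have h2 := mulVec_dot_self_le D (-w 0)
    rw [neg_dotProduct_neg] at h2
    rw [Finset.sum_range_succ' _ (k + 1)]
    set s := ∑ j ∈ Finset.range (k + 1),
      ((C *ᵥ x (j + 1)) ⬝ᵥ (C *ᵥ x (j + 1)) + w (j + 1) ⬝ᵥ w (j + 1))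
    have hs : 0 ≤ s := Finset.sum_nonneg fun _ _ => add_nonneg (dot_self_nonneg _) (dot_self_nonneg _)
    have h3 := dot_self_nonneg (C *ᵥ x 0)
    have h4 := dot_self_nonneg (w 0)
    have h5 := absSum_nonneg (Dᵀ * D)
    nlinarith [mul_nonneg hc h3, mul_nonneg hc h4, mul_nonneg h5 h3, mul_nonneg h5 hs]

/-- The state of an observable system is bounded by finitely many outputs and inputs. -/
theorem exists_state_bound {A : Matrix (Fin n) (Fin n) ℝ} {C : Matrix (Fin r) (Fin n) ℝ}
    (hobs : IsObservablePair A C) : ∃ (N : ℕ) (c : ℝ), 0 ≤ c ∧ ∀ x w : ℕ → Fin n → ℝ,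
      (∀ j, x (j + 1) = A *ᵥ x j + w j) →
        x 0 ⬝ᵥ x 0 ≤ c * ∑ j ∈ Finset.range N, ((C *ᵥ x j) ⬝ᵥ (C *ᵥ x j) + w j ⬝ᵥ w j) := by
  obtain ⟨N, c, hc, h⟩ := exists_observability_bound hobs
  choose d hd h' using exists_output_bound A C
  refine ⟨N, c * ∑ k ∈ Finset.range N, d k,
    mul_nonneg hc (Finset.sum_nonneg fun k _ => hd k), fun x w hx => (h (x 0)).trans ?_⟩
  rw [mul_assoc]
  refine mul_le_mul_of_nonneg_left ?_ hc
  rw [Finset.sum_mul]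
  refine Finset.sum_le_sum fun k hk => (h' k x w hx).trans ?_
  refine mul_le_mul_of_nonneg_left ?_ (hd k)
  refine Finset.sum_le_sum_of_subset_of_nonneg ?_
    fun _ _ _ => add_nonneg (dot_self_nonneg _) (dot_self_nonneg _)
  intro j hj
  simp only [Finset.mem_range] at *
  omega

theorem exists_posDef_bound {κ : Type*} [Fintype κ] [DecidableEq κ] {R : Matrix κ κ ℝ}
    (hR : R.PosDef) : ∃ c : ℝ, 0 ≤ c ∧ ∀ u : κ → ℝ, u ⬝ᵥ u ≤ c * (u ⬝ᵥ (R *ᵥ u)) := by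
  -- Positivity of `R` at c u - R⁻¹u gives c² u'Ru ≥ 2c u'u - u'R⁻¹u, and u'R⁻¹u ≤ c u'u by this
  -- choice; the added 1 makes `c` positive, so that it can be cancelled.
  set c := absSum R⁻¹ + 1
  have hc : 0 < c := by linarith [absSum_nonneg R⁻¹]
  have hdet : IsUnit R.det := hR.det_pos.ne'.isUnit
  refine ⟨c, hc.le, fun u => ?_⟩
  have h1 := quad_nonneg hR.posSemidef (c • u - R⁻¹ *ᵥ u)
  have h2 : (R⁻¹ *ᵥ u) ⬝ᵥ (R *ᵥ u) = u ⬝ᵥ u := by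
    rw [mulVec_dot, mulVec_mulVec, transpose_nonsing_inv, transpose_eq hR.1,
      nonsing_inv_mul _ hdet, one_mulVec]
  have h3 := quad_le_absSum R⁻¹ u
  have h4 : u ⬝ᵥ (R⁻¹ *ᵥ u) = (R⁻¹ *ᵥ u) ⬝ᵥ u := dotProduct_comm _ _
  simp only [mulVec_sub, mulVec_smul, dotProduct_sub, sub_dotProduct, smul_dotProduct,
    dotProduct_smul, mulVec_mulVec, mul_nonsing_inv _ hdet, one_mulVec, h2, smul_eq_mul] at h1
  have h5 := dot_self_nonneg u
  have h6 : 0 ≤ c * (c * (u ⬝ᵥ (R *ᵥ u)) - u ⬝ᵥ u) := by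
    have : absSum R⁻¹ = c - 1 := by simp [c]
    rw [this] at h3
    nlinarith
  linarith [nonneg_of_mul_nonneg_right h6 hc]

/-- By Gelfand's formula the norms of the powers are eventually dominated by s^k for some s < 1
above the spectral radius. -/
theorem summable_pow_of_isSchurStable {F : Matrix (Fin n) (Fin n) ℝ} (hF : IsSchurStable F) :
    ∃ g : ℕ → ℝ, Summable g ∧ ∀ k i j, |(F ^ k) i j| ≤ g k := by
  let _ : NormedRing (Matrix (Fin n) (Fin n) ℂ) := Matrix.linftyOpNormedRing
  let _ : NormedAlgebra ℂ (Matrix (Fin n) (Fin n) ℂ) := Matrix.linftyOpNormedAlgebra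
  set M : Matrix (Fin n) (Fin n) ℂ := F.map (algebraMap ℝ ℂ) with hM
  have hρ : spectralRadius ℂ M < 1 := by
    -- In dimension zero the spectrum is empty and the spectral radius has to be computed
    -- separately.
    rcases subsingleton_or_nontrivial (Matrix (Fin n) (Fin n) ℂ) with h | h
    · rw [spectrum.SpectralRadius.of_subsingleton]; exact zero_lt_one
    · have := spectrum.spectralRadius_lt_of_forall_lt (r := 1) M fun k hk => by
        have := hF k hk
        exact_mod_cast this
      simpa using this
  obtain ⟨s, hs1, hs2⟩ := ENNReal.lt_iff_exists_nnreal_btwn.1 hρ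
  have hs2' : s < 1 := by exact_mod_cast hs2
  have hev := (spectrum.pow_nnnorm_pow_one_div_tendsto_nhds_spectralRadius M).eventually
    (gt_mem_nhds hs1)
  refine ⟨fun k => ‖M ^ k‖, ?_, fun k i j => ?_⟩
  · refine Summable.of_norm_bounded_eventually_nat (g := fun k => (s : ℝ) ^ k)
      (summable_geometric_of_lt_one s.2 (by exact_mod_cast hs2')) ?_
    filter_upwards [hev, eventually_gt_atTop 0] with k hk hk0
    rw [norm_norm]
    have h1 : ((‖M ^ k‖₊ : ENNReal) ^ (1 / (k : ℝ))) ^ (k : ℝ) ≤ (s : ENNReal) ^ (k : ℝ) :=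
      ENNReal.rpow_le_rpow hk.le (by positivity)
    rw [← ENNReal.rpow_mul, one_div, inv_mul_cancel₀ (by positivity), ENNReal.rpow_one,
      ENNReal.rpow_natCast] at h1
    exact_mod_cast h1
  · have h1 : (M ^ k) i j = ((F ^ k) i j : ℂ) := by
      rw [hM, ← Matrix.map_pow]; rfl
    rw [← Real.norm_eq_abs, ← Complex.norm_real, ← h1]
    have h2 : ‖M ^ k‖₊ = Finset.univ.sup fun i => ∑ j, ‖(M ^ k) i j‖₊ := linfty_opNNNorm_def _
    have h3 : ‖(M ^ k) i j‖₊ ≤ ‖M ^ k‖₊ := by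
      rw [h2]
      refine le_trans ?_ (Finset.le_sup (f := fun i => ∑ j, ‖(M ^ k) i j‖₊) (Finset.mem_univ i))
      exact Finset.single_le_sum (f := fun j => ‖(M ^ k) i j‖₊) (fun _ _ => zero_le)
        (Finset.mem_univ j)
    exact_mod_cast h3

end LQ
end

/-! ### Normal equations, orthogonality to a σ-algebra and independence. -/

noncomputable section

namespace LQ

section Factor

theorem exists_mul_eq_of_ker_le {n m : ℕ} {N : Matrix (Fin m) (Fin m) ℝ} {T : Matrix (Fin n) (Fin m) ℝ}
    (h : ∀ x, N *ᵥ x = 0 → T *ᵥ x = 0) : ∃ G : Matrix (Fin n) (Fin m) ℝ, G * N = T := by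
  obtain ⟨s, hs⟩ := N.mulVecLin.rangeRestrict.exists_rightInverse_of_surjective
    N.mulVecLin.range_rangeRestrict
  obtain ⟨s', hs'⟩ := LinearMap.exists_extend s
  refine ⟨LinearMap.toMatrix' (T.mulVecLin ∘ₗ s'), ?_⟩
  refine Matrix.toLin'.injective (LinearMap.ext fun x => ?_)
  rw [Matrix.toLin'_mul, Matrix.toLin'_toMatrix']
  set y : LinearMap.range N.mulVecLin := N.mulVecLin.rangeRestrict x with hy
  have h1 : s' (N *ᵥ x) = s y := LinearMap.congr_fun hs' y
  have h2 : N *ᵥ (s y) = N *ᵥ x := congrArg Subtype.val (LinearMap.congr_fun hs y)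
  have h3 := h (s y - x) (by rw [mulVec_sub, h2, sub_self])
  rw [mulVec_sub, sub_eq_zero] at h3
  simpa [h1] using h3

/-- The innovation covariance may be singular, but the normal equations stay solvable: a null vector
`x` of HΣH' + Q_v is a null vector of both summands, so Σ(H'x) = 0, and a matrix factors through
another one whose kernel it annihilates. -/
theorem exists_gain {n m : ℕ} {Sg : Matrix (Fin n) (Fin n) ℝ} (hS : Sg.PosSemidef)
    {Qv : Matrix (Fin m) (Fin m) ℝ} (hQ : Qv.PosSemidef) (H : Matrix (Fin m) (Fin n) ℝ) :
    ∃ G : Matrix (Fin n) (Fin m) ℝ, G * (H * Sg * Hᵀ + Qv) = Sg * Hᵀ := by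
  refine exists_mul_eq_of_ker_le fun x hx => ?_
  have h1 : x ⬝ᵥ ((H * Sg * Hᵀ + Qv) *ᵥ x) = 0 := by rw [hx, dotProduct_zero]
  rw [add_mulVec, dotProduct_add] at h1
  have h2 : x ⬝ᵥ ((H * Sg * Hᵀ) *ᵥ x) = (Hᵀ *ᵥ x) ⬝ᵥ (Sg *ᵥ (Hᵀ *ᵥ x)) := by
    rw [mulVec_dot, mulVec_mulVec, mulVec_mulVec, transpose_transpose, Matrix.mul_assoc]
  have h3 := quad_nonneg hS (Hᵀ *ᵥ x)
  have h4 := quad_nonneg hQ x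
  have h5 := quad_zero hS (x := Hᵀ *ᵥ x) (by linarith)
  rwa [mulVec_mulVec] at h5

end Factor

section Prob

variable {Ω : Type} {m m0 : MeasurableSpace Ω} {P : Measure Ω} [IsProbabilityMeasure P]
variable {ι κ : Type*} [Fintype ι] [Fintype κ]

theorem memLp_mulVec {X : Ω → κ → ℝ} (hX : MemLp X 2 P) (S : Matrix ι κ ℝ) :
    MemLp (fun ω => S *ᵥ X ω) 2 P := by
  refine memLp_pi_iff.2 fun i => ?_
  simp only [mulVec, dotProduct]
  exact memLp_finsetSum _ fun j _ => (memLp_pi_iff.1 hX j).const_mul _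

theorem integrable_apply_mul {X : Ω → ι → ℝ} {Y : Ω → κ → ℝ} (hX : MemLp X 2 P)
    (hY : MemLp Y 2 P) (i : ι) (j : κ) : Integrable (fun ω => X ω i * Y ω j) P :=
  (memLp_pi_iff.1 hX i).integrable_mul (memLp_pi_iff.1 hY j)

theorem integrable_dot {X : Ω → ι → ℝ} {Y : Ω → ι → ℝ} (hX : MemLp X 2 P)
    (hY : MemLp Y 2 P) : Integrable (fun ω => X ω ⬝ᵥ Y ω) P := by
  simp only [dotProduct]
  exact integrable_finsetSum _ fun i _ => integrable_apply_mul hX hY i i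

theorem integrable_quad {X : Ω → ι → ℝ} {Y : Ω → κ → ℝ} (hX : MemLp X 2 P)
    (hY : MemLp Y 2 P) (S : Matrix ι κ ℝ) : Integrable (fun ω => X ω ⬝ᵥ (S *ᵥ Y ω)) P :=
  integrable_dot hX (memLp_mulVec hY S)

/-- `X` has vanishing integral over every event of `m`. -/
def Orth (P : Measure Ω) (m : MeasurableSpace Ω) (X : Ω → ι → ℝ) : Prop :=
  ∀ C, MeasurableSet[m] C → ∀ i, ∫ ω in C, X ω i ∂P = 0

theorem Orth.condExp_apply (hm : m ≤ m0) {X : Ω → ι → ℝ} (h : Orth P m X)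
    (hX : Integrable X P) (i : ι) : P[fun ω => X ω i|m] =ᵐ[P] 0 := by
  symm
  refine ae_eq_condExp_of_forall_setIntegral_eq hm (hX.eval i) (fun _ _ _ => integrableOn_zero)
    (fun C hC _ => ?_) aestronglyMeasurable_zero
  rw [h C hC i]; simp

theorem Orth.integral_mul (hm : m ≤ m0) {X : Ω → ι → ℝ} {f : Ω → ℝ} (h : Orth P m X)
    (hX : MemLp X 2 P) (hf : MemLp f 2 P) (hfm : AEStronglyMeasurable[m] f P) (i : ι) :
    ∫ ω, X ω i * f ω ∂P = 0 := by
  have hXi := memLp_pi_iff.1 hX i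
  have h1 : P[(fun ω => X ω i) * f|m] =ᵐ[P] P[fun ω => X ω i|m] * f :=
    condExp_mul_of_aestronglyMeasurable_right hfm (hXi.integrable_mul hf)
      (hXi.integrable one_le_two)
  have h2 := h.condExp_apply hm (hX.integrable one_le_two) i
  have h3 : ∫ ω, X ω i * f ω ∂P = ∫ ω, (P[(fun ω => X ω i) * f|m]) ω ∂P :=
    (integral_condExp hm).symm
  rw [h3, ← integral_zero Ω ℝ (μ := P)]
  refine integral_congr_ae ?_
  filter_upwards [h1, h2] with ω a b
  rw [a, Pi.mul_apply, b]; simp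

theorem Orth.integral_quad (hm : m ≤ m0) {X : Ω → ι → ℝ} {Y : Ω → κ → ℝ} (h : Orth P m X)
    (hX : MemLp X 2 P) (hY : MemLp Y 2 P) (hYm : AEStronglyMeasurable[m] Y P) (S : Matrix ι κ ℝ) :
    ∫ ω, X ω ⬝ᵥ (S *ᵥ Y ω) ∂P = 0 := by
  have hSY := memLp_mulVec hY S
  have hc : Continuous fun y : κ → ℝ => S *ᵥ y := by fun_prop
  have hSm : AEStronglyMeasurable[m] (fun ω => S *ᵥ Y ω) P := hc.comp_aestronglyMeasurable hYm
  simp only [dotProduct]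
  rw [integral_finsetSum _ fun i _ => integrable_apply_mul hX hSY i i]
  refine Finset.sum_eq_zero fun i _ => ?_
  refine h.integral_mul hm hX (memLp_pi_iff.1 hSY i) ?_ i
  exact (continuous_apply i).comp_aestronglyMeasurable hSm

theorem Orth.integral_quad' (hm : m ≤ m0) {X : Ω → ι → ℝ} {Y : Ω → κ → ℝ} (h : Orth P m X)
    (hX : MemLp X 2 P) (hY : MemLp Y 2 P) (hYm : AEStronglyMeasurable[m] Y P) (S : Matrix κ ι ℝ) :
    ∫ ω, Y ω ⬝ᵥ (S *ᵥ X ω) ∂P = 0 := by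
  rw [← h.integral_quad hm hX hY hYm Sᵀ]
  refine integral_congr_ae (ae_of_all _ fun ω => ?_)
  simp only
  rw [dotProduct_comm, mulVec_dot]

theorem setIntegral_apply {X : Ω → ι → ℝ} (hX : Integrable X P) (C : Set Ω) (i : ι) :
    ∫ ω in C, X ω i ∂P = (∫ ω in C, X ω ∂P) i :=
  (eval_integral (fun j => (hX.eval j).integrableOn) i).symm

theorem orth_sub_condExp (hm : m ≤ m0) {X : Ω → ι → ℝ} (hX : Integrable X P) :
    Orth P m (X - P[X|m]) := by
  intro C hC i
  rw [setIntegral_apply (hX.sub integrable_condExp)]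
  simp only [Pi.sub_apply]
  rw [integral_sub hX.integrableOn integrable_condExp.integrableOn, setIntegral_condExp hm hX hC,
    sub_self, Pi.zero_apply]

/-- All estimators below are identified in this way: exhibit a measurable candidate and check that
the remainder is orthogonal. -/
theorem Orth.ae_eq_condExp (hm : m ≤ m0) {X Y : Ω → ι → ℝ} (h : Orth P m (X - Y))
    (hX : Integrable X P) (hY : Integrable Y P) (hYm : AEStronglyMeasurable[m] Y P) :
    Y =ᵐ[P] P[X|m] := by
  refine ae_eq_condExp_of_forall_setIntegral_eq hm hX (fun _ _ _ => hY.integrableOn)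
    (fun C hC _ => ?_) hYm
  refine funext fun i => ?_
  rw [← setIntegral_apply hX, ← setIntegral_apply hY]
  have := h C hC i
  simp only [Pi.sub_apply] at this
  rw [integral_sub (hX.eval i).integrableOn (hY.eval i).integrableOn] at this
  linarith

theorem Orth.condExp_eq_zero (hm : m ≤ m0) {X : Ω → ι → ℝ} (h : Orth P m X)
    (hX : Integrable X P) : P[X|m] =ᵐ[P] 0 := by
  refine (Orth.ae_eq_condExp (Y := 0) hm (by simpa using h) hX (integrable_zero _ _ _)
    aestronglyMeasurable_zero).symm

theorem orth_of_condExp_eq_zero (hm : m ≤ m0) {X : Ω → ι → ℝ} (hX : Integrable X P)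
    (h : P[X|m] =ᵐ[P] 0) : Orth P m X := by
  intro C hC i
  rw [setIntegral_apply hX, ← setIntegral_condExp hm hX hC,
    setIntegral_congr_ae (g := fun _ => 0) (hm _ hC) (h.mono fun ω hω _ => hω)]
  simp

theorem Orth.mono {m' : MeasurableSpace Ω} (hm : m' ≤ m) {X : Ω → ι → ℝ} (h : Orth P m X) :
    Orth P m' X := fun C hC => h C (hm C hC)

theorem Orth.congr {X Y : Ω → ι → ℝ} (h : Orth P m X) (hXY : X =ᵐ[P] Y) : Orth P m Y := by
  intro C hC i
  rw [← h C hC i]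
  exact integral_congr_ae (ae_restrict_of_ae (hXY.mono fun ω hω => (congrFun hω i).symm))

theorem Orth.add {X Y : Ω → ι → ℝ} (h : Orth P m X) (h' : Orth P m Y) (hX : Integrable X P)
    (hY : Integrable Y P) : Orth P m (X + Y) := by
  intro C hC i
  simp only [Pi.add_apply]
  rw [integral_add (hX.eval i).integrableOn (hY.eval i).integrableOn, h C hC, h' C hC, add_zero]

theorem Orth.sub {X Y : Ω → ι → ℝ} (h : Orth P m X) (h' : Orth P m Y) (hX : Integrable X P)
    (hY : Integrable Y P) : Orth P m (X - Y) := by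
  intro C hC i
  simp only [Pi.sub_apply]
  rw [integral_sub (hX.eval i).integrableOn (hY.eval i).integrableOn, h C hC, h' C hC, sub_zero]

theorem Orth.mulVec {X : Ω → κ → ℝ} (h : Orth P m X) (hX : Integrable X P)
    (S : Matrix ι κ ℝ) : Orth P m (fun ω => S *ᵥ X ω) := by
  intro C hC i
  simp only [Matrix.mulVec, dotProduct]
  rw [integral_finsetSum _ fun j _ => ((hX.eval j).const_mul _).integrableOn]
  refine Finset.sum_eq_zero fun j _ => ?_
  rw [integral_const_mul, h C hC j, mul_zero]

theorem integral_quad_add {X Y : Ω → ι → ℝ} (hX : MemLp X 2 P) (hY : MemLp Y 2 P)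
    (S : Matrix ι ι ℝ) : ∫ ω, (X ω + Y ω) ⬝ᵥ (S *ᵥ (X ω + Y ω)) ∂P =
      ∫ ω, X ω ⬝ᵥ (S *ᵥ X ω) ∂P + ∫ ω, X ω ⬝ᵥ (S *ᵥ Y ω) ∂P
        + ∫ ω, Y ω ⬝ᵥ (S *ᵥ X ω) ∂P + ∫ ω, Y ω ⬝ᵥ (S *ᵥ Y ω) ∂P := by
  have e : ∀ ω, (X ω + Y ω) ⬝ᵥ (S *ᵥ (X ω + Y ω)) = X ω ⬝ᵥ (S *ᵥ X ω) + X ω ⬝ᵥ (S *ᵥ Y ω)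
      + Y ω ⬝ᵥ (S *ᵥ X ω) + Y ω ⬝ᵥ (S *ᵥ Y ω) := by
    intro ω
    simp only [mulVec_add, dotProduct_add, add_dotProduct]
    ring
  have i1 := integrable_quad hX hX S
  have i2 := integrable_quad hX hY S
  have i3 := integrable_quad hY hX S
  have i4 := integrable_quad hY hY S
  have i5 : Integrable (fun ω => X ω ⬝ᵥ (S *ᵥ X ω) + X ω ⬝ᵥ (S *ᵥ Y ω)) P := i1.add i2
  have i6 : Integrable (fun ω => X ω ⬝ᵥ (S *ᵥ X ω) + X ω ⬝ᵥ (S *ᵥ Y ω) + Y ω ⬝ᵥ (S *ᵥ X ω)) P :=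
    i5.add i3
  rw [integral_congr_ae (ae_of_all _ e), integral_add i6 i4, integral_add i5 i3,
    integral_add i1 i2]

/-- Pythagoras: `Y` is orthogonal to the information that determines `X`. -/
theorem Orth.integral_quad_add (hm : m ≤ m0) {X Y : Ω → ι → ℝ} (h : Orth P m Y)
    (hX : MemLp X 2 P) (hY : MemLp Y 2 P) (hXm : AEStronglyMeasurable[m] X P) (S : Matrix ι ι ℝ) :
    ∫ ω, (X ω + Y ω) ⬝ᵥ (S *ᵥ (X ω + Y ω)) ∂P =
      ∫ ω, X ω ⬝ᵥ (S *ᵥ X ω) ∂P + ∫ ω, Y ω ⬝ᵥ (S *ᵥ Y ω) ∂P := by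
  rw [LQ.integral_quad_add hX hY, h.integral_quad hm hY hX hXm,
    h.integral_quad' hm hY hX hXm]
  ring

/-- In terms of laws this is associativity of the product measure. -/
theorem indepFun_assoc {α β γ : Type*} [MeasurableSpace α] [MeasurableSpace β] [MeasurableSpace γ]
    {X : Ω → α} {Y : Ω → β} {Z : Ω → γ} (hX : Measurable X) (hY : Measurable Y) (hZ : Measurable Z)
    (h : IndepFun X (fun ω => (Y ω, Z ω)) P) (h' : IndepFun Y Z P) :
    IndepFun (fun ω => (X ω, Y ω)) Z P := by
  have hXY : IndepFun X Y P := h.comp measurable_id measurable_fst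
  rw [indepFun_iff_map_prod_eq_prod_map_map hX.aemeasurable (hY.prodMk hZ).aemeasurable] at h
  rw [indepFun_iff_map_prod_eq_prod_map_map hY.aemeasurable hZ.aemeasurable] at h'
  rw [indepFun_iff_map_prod_eq_prod_map_map hX.aemeasurable hY.aemeasurable] at hXY
  rw [indepFun_iff_map_prod_eq_prod_map_map (hX.prodMk hY).aemeasurable hZ.aemeasurable, hXY]
  have : IsProbabilityMeasure (P.map X) := Measure.isProbabilityMeasure_map hX.aemeasurable
  have : IsProbabilityMeasure (P.map Y) := Measure.isProbabilityMeasure_map hY.aemeasurable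
  have : IsProbabilityMeasure (P.map Z) := Measure.isProbabilityMeasure_map hZ.aemeasurable
  rw [h'] at h
  have e : (P.map fun ω => ((X ω, Y ω), Z ω)) =
      (P.map fun ω => (X ω, (Y ω, Z ω))).map MeasurableEquiv.prodAssoc.symm := by
    rw [Measure.map_map (MeasurableEquiv.measurable _) (hX.prodMk (hY.prodMk hZ))]; rfl
  rw [e, h]
  have hp := (measurePreserving_prodAssoc (P.map X) (P.map Y) (P.map Z)).symm
  exact hp.map_eq

end Prob

end LQ
end

/-! ### Gaussian inputs and the history of receptions. -/

noncomputable section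

open LQ

theorem IsGaussianVector.hasGaussianLaw {Ω : Type} [MeasurableSpace Ω] {r : ℕ} {P : Measure Ω}
    {X : Ω → Fin r → ℝ} {mean : Fin r → ℝ} {cov : Matrix (Fin r) (Fin r) ℝ}
    (h : IsGaussianVector P X mean cov) : HasGaussianLaw X P := by
  refine ⟨⟨fun l => ?_⟩⟩
  obtain ⟨c, hc⟩ : ∃ c : Fin r → ℝ, ∀ x, l x = c ⬝ᵥ x := by
    refine ⟨fun i => l (Pi.single i 1), fun x => ?_⟩
    have : x = ∑ i, x i • (Pi.single i 1 : Fin r → ℝ) := by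
      ext j; simp [Finset.sum_apply, Pi.single_apply]
    conv_lhs => rw [this]
    simp [dotProduct, mul_comm]
  have h1 := h.2.2 c
  have h2 : (P.map X).map l = gaussianReal (c ⬝ᵥ mean) (c ⬝ᵥ (cov *ᵥ c)).toNNReal := by
    rw [Measure.map_map l.continuous.measurable h.1, ← h1]
    congr 1
    ext ω; simp [hc]
  have hm : ∫ x, l x ∂(P.map X) = c ⬝ᵥ mean := by
    have : ∫ y, y ∂((P.map X).map l) = ∫ x, l x ∂(P.map X) :=
      integral_map l.continuous.measurable.aemeasurable (by fun_prop)
    rw [← this, h2, integral_id_gaussianReal]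
  have hv : Var[l; P.map X] = (c ⬝ᵥ (cov *ᵥ c)).toNNReal := by
    have : Var[id; (P.map X).map l] = Var[l; P.map X] := by
      rw [variance_map (by fun_prop) l.continuous.measurable.aemeasurable]; rfl
    rw [← this, h2, variance_id_gaussianReal]
  rw [h2, hm, hv, Real.toNNReal_coe]

namespace IsGaussianVector

variable {Ω : Type} [MeasurableSpace Ω] {r : ℕ} {P : Measure Ω} [IsProbabilityMeasure P]
    {X : Ω → Fin r → ℝ} {mean : Fin r → ℝ} {cov : Matrix (Fin r) (Fin r) ℝ}

theorem memLp (h : IsGaussianVector P X mean cov) : MemLp X 2 P := h.hasGaussianLaw.memLp_two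

theorem integral_dot (h : IsGaussianVector P X mean cov) (c : Fin r → ℝ) :
    ∫ ω, c ⬝ᵥ X ω ∂P = c ⬝ᵥ mean := by
  have hm : Measurable fun ω => c ⬝ᵥ X ω :=
    (by fun_prop : Measurable fun x : Fin r → ℝ => c ⬝ᵥ x).comp h.1
  have : ∫ y, y ∂(P.map fun ω => c ⬝ᵥ X ω) = ∫ ω, c ⬝ᵥ X ω ∂P :=
    integral_map hm.aemeasurable (by fun_prop)
  rw [← this, h.2.2, integral_id_gaussianReal]

theorem integral_apply (h : IsGaussianVector P X mean cov) (i : Fin r) :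
    ∫ ω, X ω i ∂P = mean i := by
  simpa using h.integral_dot (Pi.single i 1)

theorem integral_dot_sq (h : IsGaussianVector P X mean cov) (c : Fin r → ℝ) :
    ∫ ω, (c ⬝ᵥ (X ω - mean)) ^ 2 ∂P = c ⬝ᵥ (cov *ᵥ c) := by
  have hm : Measurable fun ω => c ⬝ᵥ X ω :=
    (by fun_prop : Measurable fun x : Fin r → ℝ => c ⬝ᵥ x).comp h.1
  have h1 : Var[id; P.map fun ω => c ⬝ᵥ X ω] = Var[fun ω => c ⬝ᵥ X ω; P] := by
    rw [variance_map (by fun_prop) hm.aemeasurable]; rfl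
  rw [h.2.2, variance_id_gaussianReal, variance_eq_integral hm.aemeasurable, h.integral_dot,
    Real.coe_toNNReal _ (quad_nonneg h.2.1 c)] at h1
  rw [h1]
  simp [dotProduct_sub]

/-- Second moments of a centred Gaussian vector. -/
theorem integral_mul (h : IsGaussianVector P X mean cov) (i j : Fin r) :
    ∫ ω, (X ω i - mean i) * (X ω j - mean j) ∂P = cov i j := by
  have hI : ∀ c : Fin r → ℝ, Integrable (fun ω => (c ⬝ᵥ (X ω - mean)) ^ 2) P := by
    intro c
    have : MemLp (fun ω => c ⬝ᵥ (X ω - mean)) 2 P := by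
      simp only [dotProduct]
      exact memLp_finsetSum _ fun k _ =>
        (memLp_pi_iff.1 (h.memLp.sub (memLp_const mean)) k).const_mul _
    exact this.integrable_sq
  have e : ∀ ω, (X ω i - mean i) * (X ω j - mean j) =
      (((Pi.single i 1 + Pi.single j 1) ⬝ᵥ (X ω - mean)) ^ 2
      - (Pi.single i 1 ⬝ᵥ (X ω - mean)) ^ 2 - (Pi.single j 1 ⬝ᵥ (X ω - mean)) ^ 2) / 2 := by
    intro ω
    simp only [add_dotProduct, single_dotProduct, one_mul, Pi.sub_apply]
    ring
  rw [entry_eq_polar (transpose_eq h.2.1.1) i j, ← h.integral_dot_sq, ← h.integral_dot_sq,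
    ← h.integral_dot_sq, ← integral_sub (hI _) (hI _), ← integral_sub _ (hI _), ← integral_div]
  · exact integral_congr_ae (ae_of_all _ e)
  · exact (hI _).sub (hI _)

end IsGaussianVector

namespace NCS

variable {n m a b : ℕ} {S : NCS n m a b} {Ω : Type}

/-- The history before the reception at time `k`: initial state, noise and earlier receptions. -/
abbrev hist (x0 : Ω → Fin n → ℝ) (v : ℕ → Ω → Fin m → ℝ) (β : ℕ → Ω → ℝ) (k : ℕ) :
    MeasurableSpace Ω :=
  MeasurableSpace.comap (fun ω => ((x0 ω, fun j => v j ω), fun j : Fin k => β j ω)) inferInstance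

section hist

variable {x0 : Ω → Fin n → ℝ} {v : ℕ → Ω → Fin m → ℝ} {β : ℕ → Ω → ℝ}

theorem measurable_hist_x0 (k : ℕ) : Measurable[hist x0 v β k] x0 :=
  measurable_fst.comp (measurable_fst.comp (comap_measurable _))

theorem measurable_hist_β {k j : ℕ} (hj : j < k) : Measurable[hist x0 v β k] (β j) := by
  have hf : Measurable fun q : ((Fin n → ℝ) × (ℕ → Fin m → ℝ)) × (Fin k → ℝ) => q.2 ⟨j, hj⟩ := by
    fun_prop
  exact hf.comp (comap_measurable _)

theorem hist_mono : Monotone (hist x0 v β) := by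
  intro j k hjk
  have hf : Measurable fun q : ((Fin n → ℝ) × (ℕ → Fin m → ℝ)) × (Fin k → ℝ) =>
      (q.1, fun i : Fin j => q.2 ⟨i, i.2.trans_le hjk⟩) := by
    fun_prop
  exact (hf.comp (comap_measurable
    (fun ω => ((x0 ω, fun j => v j ω), fun j : Fin k => β j ω)))).comap_le

/-- Indicator of no reception before time `k`. -/
def tau (β : ℕ → Ω → ℝ) (k : ℕ) (ω : Ω) : ℝ := ∏ j ∈ Finset.range k, (1 - β j ω)

theorem tau_zero (ω : Ω) : tau β 0 ω = 1 := by simp [tau]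

theorem tau_succ (k : ℕ) (ω : Ω) : tau β (k + 1) ω = tau β k ω * (1 - β k ω) :=
  Finset.prod_range_succ _ _

theorem measurable_hist_tau (k : ℕ) : Measurable[hist x0 v β k] (tau β k) := by
  have : tau β k = fun ω => ∏ j ∈ Finset.range k, (1 - β j ω) := rfl
  rw [this]
  exact Finset.measurable_fun_prod (m := hist x0 v β k) _ fun j hj =>
    measurable_const.sub (measurable_hist_β (Finset.mem_range.1 hj))

end hist

variable [m0 : MeasurableSpace Ω] {P : Measure Ω}

namespace IsInput

variable {mean : Fin n → ℝ} {cov : Matrix (Fin n) (Fin n) ℝ} {x0 : Ω → Fin n → ℝ}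
  {v : ℕ → Ω → Fin m → ℝ} {β : ℕ → Ω → ℝ} [IsProbabilityMeasure P]

theorem measurable_v (h : S.IsInput P mean cov x0 v β) (k : ℕ) : Measurable (v k) :=
  (h.gaussian_v k).1

theorem measurable_x0 (h : S.IsInput P mean cov x0 v β) : Measurable x0 := h.gaussian_x0.1

theorem hist_le (h : S.IsInput P mean cov x0 v β) (k : ℕ) : hist x0 v β k ≤ m0 :=
  Measurable.comap_le (((h.measurable_x0.prodMk (measurable_pi_lambda _ h.measurable_v))).prodMk
    (measurable_pi_lambda _ fun j => h.measurable_β j))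

/-- The history contains the complete noise sequence, future included, but only the receptions
before `k`. Hence β_k is independent of everything the controllers have used up to the reception at
time `k`. -/
theorem indepFun_hist (h : S.IsInput P mean cov x0 v β) (k : ℕ) :
    IndepFun (fun ω => ((x0 ω, fun j => v j ω), fun j : Fin k => β j ω)) (β k) P := by
  have mv := measurable_pi_lambda (fun ω k => v k ω) h.measurable_v
  have mβ := measurable_pi_lambda (fun ω k => β k ω) h.measurable_β
  have h1 : IndepFun (fun ω => (x0 ω, fun j => v j ω)) (fun ω j => β j ω) P :=
    indepFun_assoc h.measurable_x0 mv mβ h.indep_x0 h.indep_v_β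
  have h2 : IndepFun (fun ω (j : Finset.range k) => β j ω) (fun ω (j : ({k} : Finset ℕ)) => β j ω) P :=
    h.indep_β.indepFun_finset _ _ (by simp) h.measurable_β
  have h3 : IndepFun (fun ω (j : Fin k) => β j ω) (β k) P := by
    have h4 := h2.comp (φ := fun (f : Finset.range k → ℝ) (j : Fin k) => f ⟨j, Finset.mem_range.2 j.2⟩)
      (ψ := fun f : ({k} : Finset ℕ) → ℝ => f ⟨k, by simp⟩)
      (by fun_prop) (measurable_pi_apply (X := fun _ : ({k} : Finset ℕ) => ℝ) _)
    exact h4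
  refine indepFun_assoc (h.measurable_x0.prodMk mv)
    (measurable_pi_lambda _ fun j => h.measurable_β j) (h.measurable_β k) ?_ h3
  exact h1.comp measurable_id (ψ := fun f => ((fun j : Fin k => f j), f k)) (by fun_prop)

theorem indepFun_of_measurable_hist (h : S.IsInput P mean cov x0 v β) {k : ℕ} {f : Ω → ℝ}
    (hf : Measurable[hist x0 v β k] f) : IndepFun f (β k) P := by
  have h1 := h.indepFun_hist k
  rw [IndepFun_iff_Indep] at h1 ⊢
  exact indep_of_indep_of_le_left h1 hf.comap_le

theorem integral_β (h : S.IsInput P mean cov x0 v β) (hp1 : S.p < 1) (k : ℕ) :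
    ∫ ω, β k ω ∂P = 1 - S.p := by
  have hms : MeasurableSet {ω | β k ω = 1} := h.measurable_β k (measurableSet_singleton 1)
  have e : β k = Set.indicator {ω | β k ω = 1} 1 := by
    ext ω
    rcases h.β_zero_or_one k ω with h0 | h1
    · simp [Set.indicator, h0]
    · simp [Set.indicator, h1]
  rw [e, integral_indicator_one hms, Measure.real, h.β_prob, ENNReal.toReal_ofReal (by linarith)]

theorem integral_β_mul (h : S.IsInput P mean cov x0 v β) (hp1 : S.p < 1) {k : ℕ} {f : Ω → ℝ}
    (hf : Measurable[hist x0 v β k] f) :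
    ∫ ω, β k ω * f ω ∂P = (1 - S.p) * ∫ ω, f ω ∂P := by
  have := (h.indepFun_of_measurable_hist hf).symm.integral_fun_mul_eq_mul_integral
    (h.measurable_β k).aestronglyMeasurable (hf.mono (h.hist_le k) le_rfl).aestronglyMeasurable
  rw [this, h.integral_β hp1]

theorem integrable_β_mul (h : S.IsInput P mean cov x0 v β) (k : ℕ) {f : Ω → ℝ}
    (hf : Integrable f P) : Integrable (fun ω => β k ω * f ω) P := by
  refine hf.bdd_mul (c := 1) (h.measurable_β k).aestronglyMeasurable (ae_of_all _ fun ω => ?_)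
  rcases h.β_zero_or_one k ω with h0 | h1
  · simp [h0]
  · simp [h1]

theorem integral_one_sub_β_mul (h : S.IsInput P mean cov x0 v β) (hp1 : S.p < 1) {k : ℕ}
    {f : Ω → ℝ} (hf : Measurable[hist x0 v β k] f) (hi : Integrable f P) :
    ∫ ω, (1 - β k ω) * f ω ∂P = S.p * ∫ ω, f ω ∂P := by
  simp only [sub_mul, one_mul]
  rw [integral_sub hi (h.integrable_β_mul k hi), h.integral_β_mul hp1 hf]
  ring

theorem tau_zero_or_one (h : S.IsInput P mean cov x0 v β) (k : ℕ) (ω : Ω) :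
    tau β k ω = 0 ∨ tau β k ω = 1 := by
  induction k with
  | zero => right; exact tau_zero ω
  | succ k ih =>
    rw [tau_succ]
    rcases ih with h0 | h1 <;> rcases h.β_zero_or_one k ω with h2 | h2 <;> simp [*]

theorem measurable_tau (h : S.IsInput P mean cov x0 v β) (k : ℕ) : Measurable (tau β k) :=
  (measurable_hist_tau (x0 := x0) (v := v) k).mono (h.hist_le k) le_rfl

theorem integrable_tau_mul (h : S.IsInput P mean cov x0 v β) (k : ℕ) {f : Ω → ℝ}
    (hf : Integrable f P) : Integrable (fun ω => tau β k ω * f ω) P := by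
  refine hf.bdd_mul (c := 1) (h.measurable_tau k).aestronglyMeasurable (ae_of_all _ fun ω => ?_)
  rcases h.tau_zero_or_one k ω with h0 | h1
  · simp [h0]
  · simp [h1]

/-- Each loss is independent of the history before it and contributes a factor p. -/
theorem integral_tau_mul (h : S.IsInput P mean cov x0 v β) (hp1 : S.p < 1) (k : ℕ)
    {f : Ω → ℝ} (hf : Measurable[hist x0 v β 0] f) (hi : Integrable f P) :
    ∫ ω, tau β k ω * f ω ∂P = S.p ^ k * ∫ ω, f ω ∂P := by
  induction k with
  | zero => simp [tau_zero]
  | succ k ih =>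
    have hm : Measurable[hist x0 v β k] fun ω => tau β k ω * f ω :=
      (measurable_hist_tau k).mul (hf.mono (hist_mono (Nat.zero_le k)) le_rfl)
    have := h.integral_one_sub_β_mul hp1 hm (h.integrable_tau_mul k hi)
    rw [pow_succ', mul_assoc, ← ih, ← this]
    refine integral_congr_ae (ae_of_all _ fun ω => ?_)
    simp only [tau_succ]; ring

theorem memLp_tau_smul (h : S.IsInput P mean cov x0 v β) (k : ℕ) {r : ℕ} {X : Ω → Fin r → ℝ}
    (hX : MemLp X 2 P) : MemLp (fun ω => tau β k ω • X ω) 2 P := by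
  refine hX.of_le ((h.measurable_tau k).aestronglyMeasurable.smul hX.1) (ae_of_all _ fun ω => ?_)
  rcases h.tau_zero_or_one k ω with h0 | h1
  · simp [h0]
  · simp [h1]

theorem memLp_β_smul (h : S.IsInput P mean cov x0 v β) (k : ℕ) {r : ℕ} {X : Ω → Fin r → ℝ}
    (hX : MemLp X 2 P) : MemLp (fun ω => β k ω • X ω) 2 P := by
  refine hX.of_le ((h.measurable_β k).aestronglyMeasurable.smul hX.1) (ae_of_all _ fun ω => ?_)
  rcases h.β_zero_or_one k ω with h0 | h1
  · simp [h0]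
  · simp [h1]

end IsInput
end NCS
end

/-! ### Mixed second moments and the Kalman filter of the uncontrolled state. -/

noncomputable section

open LQ

namespace LQ

section CrossMoment

variable {Ω : Type} {m0 : MeasurableSpace Ω} {P : Measure Ω} [IsProbabilityMeasure P]
variable {ι κ l : Type*} [Fintype ι] [Fintype κ] [Fintype l]

/-- The matrix of second mixed moments. -/
def cross (P : Measure Ω) (X : Ω → ι → ℝ) (Y : Ω → κ → ℝ) : Matrix ι κ ℝ :=
  Matrix.of fun i j => ∫ ω, X ω i * Y ω j ∂P

theorem cross_transpose (X : Ω → ι → ℝ) (Y : Ω → κ → ℝ) : (cross P X Y)ᵀ = cross P Y X := by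
  ext i j; simp [cross, mul_comm]

theorem cross_add_left {X X' : Ω → ι → ℝ} {Y : Ω → κ → ℝ} (hX : MemLp X 2 P) (hX' : MemLp X' 2 P)
    (hY : MemLp Y 2 P) : cross P (fun ω => X ω + X' ω) Y = cross P X Y + cross P X' Y := by
  ext i j
  simp only [cross, of_apply, Matrix.add_apply, Pi.add_apply, add_mul]
  exact integral_add (integrable_apply_mul hX hY i j) (integrable_apply_mul hX' hY i j)

theorem cross_sub_left {X X' : Ω → ι → ℝ} {Y : Ω → κ → ℝ} (hX : MemLp X 2 P) (hX' : MemLp X' 2 P)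
    (hY : MemLp Y 2 P) : cross P (fun ω => X ω - X' ω) Y = cross P X Y - cross P X' Y := by
  ext i j
  simp only [cross, of_apply, Matrix.sub_apply, Pi.sub_apply, sub_mul]
  exact integral_sub (integrable_apply_mul hX hY i j) (integrable_apply_mul hX' hY i j)

theorem cross_mulVec_left {X : Ω → κ → ℝ} {Y : Ω → l → ℝ} (hX : MemLp X 2 P)
    (hY : MemLp Y 2 P) (T : Matrix ι κ ℝ) : cross P (fun ω => T *ᵥ X ω) Y = T * cross P X Y := by
  ext i j
  simp only [cross, of_apply, Matrix.mul_apply, mulVec, dotProduct, Finset.sum_mul]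
  rw [integral_finsetSum]
  · refine Finset.sum_congr rfl fun k _ => ?_
    rw [← integral_const_mul]
    exact integral_congr_ae (ae_of_all _ fun ω => by simp only; ring)
  · intro k _
    simp only [mul_assoc]
    exact (integrable_apply_mul hX hY k j).const_mul _

theorem cross_add_right {X : Ω → ι → ℝ} {Y Y' : Ω → κ → ℝ} (hX : MemLp X 2 P) (hY : MemLp Y 2 P)
    (hY' : MemLp Y' 2 P) : cross P X (fun ω => Y ω + Y' ω) = cross P X Y + cross P X Y' := by
  rw [← cross_transpose, cross_add_left hY hY' hX, transpose_add, cross_transpose, cross_transpose]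

theorem cross_sub_right {X : Ω → ι → ℝ} {Y Y' : Ω → κ → ℝ} (hX : MemLp X 2 P) (hY : MemLp Y 2 P)
    (hY' : MemLp Y' 2 P) : cross P X (fun ω => Y ω - Y' ω) = cross P X Y - cross P X Y' := by
  rw [← cross_transpose, cross_sub_left hY hY' hX, transpose_sub, cross_transpose, cross_transpose]

theorem cross_mulVec_right {X : Ω → ι → ℝ} {Y : Ω → l → ℝ} (hX : MemLp X 2 P)
    (hY : MemLp Y 2 P) (T : Matrix κ l ℝ) : cross P X (fun ω => T *ᵥ Y ω) = cross P X Y * Tᵀ := by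
  rw [← cross_transpose, cross_mulVec_left hY hX, transpose_mul, cross_transpose]

theorem integral_quad_eq_trace {X : Ω → ι → ℝ} {Y : Ω → κ → ℝ} (hX : MemLp X 2 P)
    (hY : MemLp Y 2 P) (T : Matrix ι κ ℝ) :
    ∫ ω, X ω ⬝ᵥ (T *ᵥ Y ω) ∂P = Matrix.trace (T * cross P Y X) := by
  have h : T * cross P Y X = cross P (fun ω => T *ᵥ Y ω) X := (cross_mulVec_left hY hX T).symm
  rw [h]
  simp only [dotProduct, Matrix.trace, Matrix.diag, cross, of_apply]
  rw [integral_finsetSum _ fun i _ => integrable_apply_mul hX (memLp_mulVec hY T) i i]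
  exact Finset.sum_congr rfl fun i _ =>
    integral_congr_ae (ae_of_all _ fun ω => by simp only; ring)

theorem cross_eq_zero_of_indepFun {X : Ω → ι → ℝ} {Y : Ω → κ → ℝ} (hX : MemLp X 2 P)
    (hY : MemLp Y 2 P) (h : IndepFun X Y P) (h0 : ∀ j, ∫ ω, Y ω j ∂P = 0) : cross P X Y = 0 := by
  ext i j
  simp only [cross, of_apply, Matrix.zero_apply]
  have h1 : IndepFun (fun ω => X ω i) (fun ω => Y ω j) P :=
    h.comp (measurable_pi_apply i) (measurable_pi_apply j)
  rw [h1.integral_fun_mul_eq_mul_integral (memLp_pi_iff.1 hX i).1 (memLp_pi_iff.1 hY j).1, h0,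
    mul_zero]

theorem integral_mulVec {X : Ω → κ → ℝ} (hX : Integrable X P) (T : Matrix ι κ ℝ) :
    ∫ ω, T *ᵥ X ω ∂P = T *ᵥ ∫ ω, X ω ∂P :=
  (LinearMap.toContinuousLinearMap T.mulVecLin).integral_comp_comm hX

end CrossMoment

end LQ

namespace NCS

variable {n m a b : ℕ} (S : NCS n m a b) {Ω : Type}

/-- A gain solving the normal equations of the Kalman filter, also for a singular innovation
covariance. -/
def filterGain (Sg : Matrix (Fin n) (Fin n) ℝ) : Matrix (Fin n) (Fin m) ℝ :=
  Classical.epsilon fun G => G * S.innovCov Sg = Sg * S.Hᵀ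

/-- Error covariance after a measurement update with gain `G`. -/
def updWith (G : Matrix (Fin n) (Fin m) ℝ) (Sg : Matrix (Fin n) (Fin n) ℝ) :
    Matrix (Fin n) (Fin n) ℝ :=
  (1 - G * S.H) * Sg * (1 - G * S.H)ᵀ + G * S.Qv * Gᵀ

/-- Prediction error covariance as long as no packet is received. -/
def errCov (cov : Matrix (Fin n) (Fin n) ℝ) : ℕ → Matrix (Fin n) (Fin n) ℝ
  | 0 => cov
  | k + 1 => S.A * S.updWith (S.filterGain (errCov cov k)) (errCov cov k) * S.Aᵀ

/-- The gain at time `k` as long as no packet is received. -/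
def gainAt (cov : Matrix (Fin n) (Fin n) ℝ) (k : ℕ) : Matrix (Fin n) (Fin m) ℝ :=
  S.filterGain (S.errCov cov k)

/-- Filtering error covariance as long as no packet is received. -/
def postCov (cov : Matrix (Fin n) (Fin n) ℝ) (k : ℕ) : Matrix (Fin n) (Fin n) ℝ :=
  S.updWith (S.gainAt cov k) (S.errCov cov k)

/-- The measurement of the uncontrolled state. -/
def freeMeas (x0 : Ω → Fin n → ℝ) (v : ℕ → Ω → Fin m → ℝ) (k : ℕ) (ω : Ω) : Fin m → ℝ :=
  S.H *ᵥ ((S.A ^ k) *ᵥ x0 ω) + v k ω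

/-- One-step prediction of the uncontrolled state. -/
def freePred (mean : Fin n → ℝ) (cov : Matrix (Fin n) (Fin n) ℝ)
    (x0 : Ω → Fin n → ℝ) (v : ℕ → Ω → Fin m → ℝ) : ℕ → Ω → Fin n → ℝ
  | 0 => fun _ => mean
  | k + 1 => fun ω => S.A *ᵥ (freePred mean cov x0 v k ω + S.gainAt cov k *ᵥ
      (S.freeMeas x0 v k ω - S.H *ᵥ freePred mean cov x0 v k ω))

/-- The Kalman filter of the uncontrolled state. -/
def freeFilt (mean : Fin n → ℝ) (cov : Matrix (Fin n) (Fin n) ℝ)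
    (x0 : Ω → Fin n → ℝ) (v : ℕ → Ω → Fin m → ℝ) (k : ℕ) (ω : Ω) : Fin n → ℝ :=
  S.freePred mean cov x0 v k ω + S.gainAt cov k *ᵥ
    (S.freeMeas x0 v k ω - S.H *ᵥ S.freePred mean cov x0 v k ω)

/-- Prediction error. -/
def predErr (mean : Fin n → ℝ) (cov : Matrix (Fin n) (Fin n) ℝ)
    (x0 : Ω → Fin n → ℝ) (v : ℕ → Ω → Fin m → ℝ) (k : ℕ) (ω : Ω) : Fin n → ℝ :=
  (S.A ^ k) *ᵥ x0 ω - S.freePred mean cov x0 v k ω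

/-- Filtering error. -/
def filtErr (mean : Fin n → ℝ) (cov : Matrix (Fin n) (Fin n) ℝ)
    (x0 : Ω → Fin n → ℝ) (v : ℕ → Ω → Fin m → ℝ) (k : ℕ) (ω : Ω) : Fin n → ℝ :=
  (S.A ^ k) *ᵥ x0 ω - S.freeFilt mean cov x0 v k ω

/-- The information carried by the uncontrolled measurements. -/
abbrev infoF (x0 : Ω → Fin n → ℝ) (v : ℕ → Ω → Fin m → ℝ) (k : ℕ) : MeasurableSpace Ω :=
  MeasurableSpace.comap (fun ω (q : Fin (k + 1) × Fin m) => S.freeMeas x0 v q.1 ω q.2) inferInstance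

variable {S} {mean : Fin n → ℝ} {cov : Matrix (Fin n) (Fin n) ℝ} {x0 : Ω → Fin n → ℝ}
  {v : ℕ → Ω → Fin m → ℝ} {β : ℕ → Ω → ℝ}

theorem predErr_succ (k : ℕ) (ω : Ω) :
    S.predErr mean cov x0 v (k + 1) ω = S.A *ᵥ S.filtErr mean cov x0 v k ω := by
  simp only [predErr, filtErr, freePred, freeFilt, mulVec_sub, mulVec_mulVec, pow_succ']

theorem freeMeas_eq (k : ℕ) (ω : Ω) : S.freeMeas x0 v k ω =
    (S.H *ᵥ S.predErr mean cov x0 v k ω + v k ω) + S.H *ᵥ S.freePred mean cov x0 v k ω := by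
  simp only [predErr, freeMeas, mulVec_sub]
  abel

theorem freeFilt_eq (k : ℕ) (ω : Ω) : S.freeFilt mean cov x0 v k ω =
    S.freePred mean cov x0 v k ω + S.gainAt cov k *ᵥ
      (S.H *ᵥ S.predErr mean cov x0 v k ω + v k ω) := by
  rw [freeFilt, freeMeas_eq (mean := mean) (cov := cov), add_sub_cancel_right]

theorem filtErr_eq (k : ℕ) (ω : Ω) : S.filtErr mean cov x0 v k ω =
    (1 - S.gainAt cov k * S.H) *ᵥ S.predErr mean cov x0 v k ω - S.gainAt cov k *ᵥ v k ω := by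
  rw [filtErr, freeFilt_eq, sub_mulVec, one_mulVec, ← mulVec_mulVec, mulVec_add]
  simp only [predErr]
  abel

theorem posSemidef_updWith (hQ : S.Qv.PosSemidef) (G : Matrix (Fin n) (Fin m) ℝ)
    {Sg : Matrix (Fin n) (Fin n) ℝ} (h : Sg.PosSemidef) : (S.updWith G Sg).PosSemidef := by
  have h1 := h.mul_mul_conjTranspose_same (1 - G * S.H)
  have h2 := hQ.mul_mul_conjTranspose_same G
  simp only [conjTranspose_eq_transpose_of_trivial] at h1 h2
  exact h1.add h2

theorem posSemidef_errCov (hQ : S.Qv.PosSemidef) (hc : cov.PosSemidef) (k : ℕ) :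
    (S.errCov cov k).PosSemidef := by
  induction k with
  | zero => exact hc
  | succ k ih =>
    have := (posSemidef_updWith hQ (S.filterGain (S.errCov cov k)) ih).mul_mul_conjTranspose_same S.A
    rw [conjTranspose_eq_transpose_of_trivial] at this
    exact this

theorem gainAt_mul_innovCov (hQ : S.Qv.PosSemidef) (hc : cov.PosSemidef) (k : ℕ) :
    S.gainAt cov k * S.innovCov (S.errCov cov k) = S.errCov cov k * S.Hᵀ :=
  Classical.epsilon_spec (p := fun G => G * S.innovCov (S.errCov cov k) = S.errCov cov k * S.Hᵀ)
    (exists_gain (posSemidef_errCov hQ hc k) hQ S.H)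

variable [m0 : MeasurableSpace Ω] {P : Measure Ω} [IsProbabilityMeasure P]

namespace IsInput

theorem memLp_x0 (h : S.IsInput P mean cov x0 v β) : MemLp x0 2 P := h.gaussian_x0.memLp

theorem memLp_v (h : S.IsInput P mean cov x0 v β) (k : ℕ) : MemLp (v k) 2 P :=
  (h.gaussian_v k).memLp

theorem integral_v (h : S.IsInput P mean cov x0 v β) (k : ℕ) (i : Fin m) :
    ∫ ω, v k ω i ∂P = 0 := (h.gaussian_v k).integral_apply i

theorem posSemidef_Qv (h : S.IsInput P mean cov x0 v β) : S.Qv.PosSemidef := (h.gaussian_v 0).2.1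

theorem posSemidef_cov (h : S.IsInput P mean cov x0 v β) : cov.PosSemidef := h.gaussian_x0.2.1

theorem cross_v_self (h : S.IsInput P mean cov x0 v β) (k : ℕ) : cross P (v k) (v k) = S.Qv := by
  ext i j
  simpa [cross] using (h.gaussian_v k).integral_mul i j

theorem cross_v_of_ne (h : S.IsInput P mean cov x0 v β) {j k : ℕ} (hjk : j ≠ k) :
    cross P (v j) (v k) = 0 :=
  cross_eq_zero_of_indepFun (h.memLp_v j) (h.memLp_v k) (h.indep_v.indepFun hjk) (h.integral_v k)

theorem indepFun_x0_v (h : S.IsInput P mean cov x0 v β) (k : ℕ) : IndepFun x0 (v k) P :=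
  h.indep_x0.comp measurable_id (ψ := fun q : (ℕ → Fin m → ℝ) × (ℕ → ℝ) => q.1 k) (by fun_prop)

theorem cross_x0_v (h : S.IsInput P mean cov x0 v β) (k : ℕ) : cross P x0 (v k) = 0 :=
  cross_eq_zero_of_indepFun h.memLp_x0 (h.memLp_v k) (h.indepFun_x0_v k) (h.integral_v k)

theorem memLp_freeMeas (h : S.IsInput P mean cov x0 v β) (k : ℕ) :
    MemLp (S.freeMeas x0 v k) 2 P := by
  have h1 : MemLp (fun ω => S.H *ᵥ ((S.A ^ k) *ᵥ x0 ω)) 2 P :=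
    memLp_mulVec (memLp_mulVec h.memLp_x0 _) _
  exact h1.add (h.memLp_v k)

theorem memLp_freePred (h : S.IsInput P mean cov x0 v β) (k : ℕ) :
    MemLp (S.freePred mean cov x0 v k) 2 P := by
  induction k with
  | zero => exact memLp_const _
  | succ k ih =>
    exact memLp_mulVec (ih.add (memLp_mulVec ((h.memLp_freeMeas k).sub (memLp_mulVec ih _)) _)) _

theorem memLp_freeFilt (h : S.IsInput P mean cov x0 v β) (k : ℕ) :
    MemLp (S.freeFilt mean cov x0 v k) 2 P :=
  (h.memLp_freePred k).add
    (memLp_mulVec ((h.memLp_freeMeas k).sub (memLp_mulVec (h.memLp_freePred k) _)) _)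

theorem memLp_predErr (h : S.IsInput P mean cov x0 v β) (k : ℕ) :
    MemLp (S.predErr mean cov x0 v k) 2 P :=
  (memLp_mulVec h.memLp_x0 _).sub (h.memLp_freePred k)

theorem memLp_filtErr (h : S.IsInput P mean cov x0 v β) (k : ℕ) :
    MemLp (S.filtErr mean cov x0 v k) 2 P :=
  (memLp_mulVec h.memLp_x0 _).sub (h.memLp_freeFilt k)

theorem integral_filtErr_of_predErr (h : S.IsInput P mean cov x0 v β) {k : ℕ}
    (hk : ∫ ω, S.predErr mean cov x0 v k ω ∂P = 0) :
    ∫ ω, S.filtErr mean cov x0 v k ω ∂P = 0 := by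
  have h1 := h.memLp_predErr k
  have h2 := memLp_mulVec h1 (1 - S.gainAt cov k * S.H)
  have h3 := memLp_mulVec (h.memLp_v k) (S.gainAt cov k)
  have hv : ∫ ω, v k ω ∂P = 0 := by
    ext i
    rw [eval_integral fun j => ((h.memLp_v k).integrable one_le_two).eval j]
    exact h.integral_v k i
  simp only [filtErr_eq]
  rw [integral_sub (h2.integrable one_le_two) (h3.integrable one_le_two),
    integral_mulVec (h1.integrable one_le_two),
    integral_mulVec ((h.memLp_v k).integrable one_le_two), hk, hv]
  simp

theorem integral_predErr (h : S.IsInput P mean cov x0 v β) (k : ℕ) :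
    ∫ ω, S.predErr mean cov x0 v k ω ∂P = 0 := by
  induction k with
  | zero =>
    have hx0 : ∫ ω, x0 ω ∂P = mean := by
      ext i
      rw [eval_integral fun j => (h.memLp_x0.integrable one_le_two).eval j]
      exact h.gaussian_x0.integral_apply i
    simp only [predErr, freePred, pow_zero, one_mulVec]
    rw [integral_sub (h.memLp_x0.integrable one_le_two) (integrable_const _), hx0]
    simp
  | succ k ih =>
    simp only [predErr_succ]
    rw [integral_mulVec ((h.memLp_filtErr k).integrable one_le_two),
      h.integral_filtErr_of_predErr ih, mulVec_zero]

theorem integral_filtErr (h : S.IsInput P mean cov x0 v β) (k : ℕ) (i : Fin n) :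
    ∫ ω, S.filtErr mean cov x0 v k ω i ∂P = 0 := by
  rw [← eval_integral fun j => ((h.memLp_filtErr k).integrable one_le_two).eval j,
    h.integral_filtErr_of_predErr (h.integral_predErr k)]
  rfl

/-- `filtErr` against a fixed square-integrable vector. -/
theorem cross_filtErr_left (h : S.IsInput P mean cov x0 v β) (k : ℕ) {r : ℕ} {Y : Ω → Fin r → ℝ}
    (hY : MemLp Y 2 P) : cross P (S.filtErr mean cov x0 v k) Y =
      (1 - S.gainAt cov k * S.H) * cross P (S.predErr mean cov x0 v k) Y
        - S.gainAt cov k * cross P (v k) Y := by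
  have : S.filtErr mean cov x0 v k = fun ω => (1 - S.gainAt cov k * S.H) *ᵥ
    S.predErr mean cov x0 v k ω - S.gainAt cov k *ᵥ v k ω := funext (filtErr_eq k)
  rw [this, cross_sub_left (memLp_mulVec (h.memLp_predErr k) _) (memLp_mulVec (h.memLp_v k) _) hY,
    cross_mulVec_left (h.memLp_predErr k) hY, cross_mulVec_left (h.memLp_v k) hY]

theorem cross_predErr_succ_left (h : S.IsInput P mean cov x0 v β) (k : ℕ) {r : ℕ}
    {Y : Ω → Fin r → ℝ} (hY : MemLp Y 2 P) : cross P (S.predErr mean cov x0 v (k + 1)) Y =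
      S.A * cross P (S.filtErr mean cov x0 v k) Y := by
  have : S.predErr mean cov x0 v (k + 1) = fun ω => S.A *ᵥ S.filtErr mean cov x0 v k ω :=
    funext (predErr_succ k)
  rw [this, cross_mulVec_left (h.memLp_filtErr k) hY]

/-- The prediction error at time `k` involves only the initial state and noise strictly before `k`.
-/
theorem cross_predErr_v (h : S.IsInput P mean cov x0 v β) {j k : ℕ} (hjk : k ≤ j) :
    cross P (S.predErr mean cov x0 v k) (v j) = 0 := by
  induction k with
  | zero =>
    have e : S.predErr mean cov x0 v 0 = fun ω => x0 ω - mean := by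
      ext ω; simp [predErr, freePred]
    have hc : cross P (fun _ : Ω => mean) (v j) = 0 := by
      ext i l
      simp only [cross, of_apply, Matrix.zero_apply]
      rw [integral_const_mul, h.integral_v, mul_zero]
    rw [e, cross_sub_left h.memLp_x0 (memLp_const _) (h.memLp_v j), h.cross_x0_v, hc, sub_zero]
  | succ k ih =>
    rw [h.cross_predErr_succ_left k (h.memLp_v j), h.cross_filtErr_left k (h.memLp_v j),
      ih (by omega), h.cross_v_of_ne (by omega)]
    simp

theorem cross_filtErr_v (h : S.IsInput P mean cov x0 v β) (k : ℕ) :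
    cross P (S.filtErr mean cov x0 v k) (v k) = -(S.gainAt cov k * S.Qv) := by
  rw [h.cross_filtErr_left k (h.memLp_v k), h.cross_predErr_v le_rfl, h.cross_v_self]
  simp

/-- The error is (1 - GH) times the prediction error minus G v, with uncorrelated terms. This form
of the covariance does not need the normal equations for G. -/
theorem cross_filtErr_of_predErr (h : S.IsInput P mean cov x0 v β) {k : ℕ}
    (hk : cross P (S.predErr mean cov x0 v k) (S.predErr mean cov x0 v k) = S.errCov cov k) :
    cross P (S.filtErr mean cov x0 v k) (S.filtErr mean cov x0 v k) = S.postCov cov k := by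
  have h1 := transpose_eq (posSemidef_errCov h.posSemidef_Qv h.posSemidef_cov k (S := S)).1
  have h2 := transpose_eq h.posSemidef_Qv.1
  rw [h.cross_filtErr_left k (h.memLp_filtErr k), ← cross_transpose (S.filtErr mean cov x0 v k),
    ← cross_transpose (S.filtErr mean cov x0 v k) (v k), h.cross_filtErr_v k,
    h.cross_filtErr_left k (h.memLp_predErr k), hk,
    ← cross_transpose (S.predErr mean cov x0 v k) (v k), h.cross_predErr_v le_rfl, postCov, updWith]
  simp [transpose_mul, h1, h2, Matrix.mul_assoc]

theorem cross_predErr_self (h : S.IsInput P mean cov x0 v β) (k : ℕ) :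
    cross P (S.predErr mean cov x0 v k) (S.predErr mean cov x0 v k) = S.errCov cov k := by
  induction k with
  | zero =>
    ext i j
    simpa [predErr, freePred, cross, errCov] using h.gaussian_x0.integral_mul i j
  | succ k ih =>
    rw [h.cross_predErr_succ_left k (h.memLp_predErr _), ← cross_transpose,
      h.cross_predErr_succ_left k (h.memLp_filtErr _), h.cross_filtErr_of_predErr ih,
      transpose_mul, errCov, postCov, transpose_eq (posSemidef_updWith h.posSemidef_Qv _
      (posSemidef_errCov h.posSemidef_Qv h.posSemidef_cov k)).1, Matrix.mul_assoc]
    rfl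

theorem cross_filtErr_self (h : S.IsInput P mean cov x0 v β) (k : ℕ) :
    cross P (S.filtErr mean cov x0 v k) (S.filtErr mean cov x0 v k) = S.postCov cov k :=
  h.cross_filtErr_of_predErr (h.cross_predErr_self k)

end IsInput
end NCS
end

/-! ### Independence of the filtering error and the measurements. -/

noncomputable section

open LQ

namespace NCS

variable {n m a b : ℕ} {S : NCS n m a b} {Ω : Type} {mean : Fin n → ℝ}
  {cov : Matrix (Fin n) (Fin n) ℝ} {x0 : Ω → Fin n → ℝ}
  {v : ℕ → Ω → Fin m → ℝ} {β : ℕ → Ω → ℝ}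

/-- `X` is an affine function of the initial state and the noise up to time `K`. -/
def IsAffine (x0 : Ω → Fin n → ℝ) (v : ℕ → Ω → Fin m → ℝ) (K : ℕ) {r : ℕ} (X : Ω → Fin r → ℝ) :
    Prop :=
  ∃ (l : ((Fin n → ℝ) × (Fin (K + 1) → Fin m → ℝ)) →L[ℝ] (Fin r → ℝ)) (c : Fin r → ℝ),
    ∀ ω, X ω = l (x0 ω, fun j : Fin (K + 1) => v j ω) + c

namespace IsAffine

variable {K r q : ℕ} {X Y : Ω → Fin r → ℝ}

theorem add (hX : IsAffine x0 v K X) (hY : IsAffine x0 v K Y) :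
    IsAffine x0 v K fun ω => X ω + Y ω := by
  obtain ⟨l, c, h⟩ := hX
  obtain ⟨l', c', h'⟩ := hY
  refine ⟨l + l', c + c', fun ω => ?_⟩
  simp only [h, h', _root_.add_apply]; abel

theorem sub (hX : IsAffine x0 v K X) (hY : IsAffine x0 v K Y) :
    IsAffine x0 v K fun ω => X ω - Y ω := by
  obtain ⟨l, c, h⟩ := hX
  obtain ⟨l', c', h'⟩ := hY
  refine ⟨l - l', c - c', fun ω => ?_⟩
  simp only [h, h', _root_.sub_apply]; abel

theorem mulVec (T : Matrix (Fin q) (Fin r) ℝ) (hX : IsAffine x0 v K X) :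
    IsAffine x0 v K fun ω => T *ᵥ X ω := by
  obtain ⟨l, c, h⟩ := hX
  refine ⟨(LinearMap.toContinuousLinearMap T.mulVecLin).comp l, T *ᵥ c, fun ω => ?_⟩
  simp only [h, mulVec_add]; rfl

theorem const (c : Fin r → ℝ) : IsAffine x0 v K fun _ : Ω => c := ⟨0, c, fun ω => by simp⟩

theorem initial : IsAffine x0 v K x0 :=
  ⟨ContinuousLinearMap.fst ℝ _ _, 0, fun ω => by simp⟩

theorem noise {k : ℕ} (hk : k ≤ K) : IsAffine x0 v K (v k) :=
  ⟨(ContinuousLinearMap.proj (⟨k, by omega⟩ : Fin (K + 1))).comp (ContinuousLinearMap.snd ℝ _ _), 0,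
    fun ω => by simp⟩

theorem freeMeas {k : ℕ} (hk : k ≤ K) : IsAffine x0 v K (S.freeMeas x0 v k) :=
  ((initial.mulVec _).mulVec _).add (noise hk)

theorem freePred {k : ℕ} (hk : k ≤ K + 1) : IsAffine x0 v K (S.freePred mean cov x0 v k) := by
  induction k with
  | zero => exact const _
  | succ k ih =>
    have hi := ih (by omega)
    exact (hi.add (((freeMeas (by omega)).sub (hi.mulVec _)).mulVec _)).mulVec _

theorem freeFilt {k : ℕ} (hk : k ≤ K) : IsAffine x0 v K (S.freeFilt mean cov x0 v k) := by
  have hi : IsAffine x0 v K (S.freePred mean cov x0 v k) := freePred (by omega)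
  exact hi.add (((freeMeas hk).sub (hi.mulVec _)).mulVec _)

theorem filtErr {k : ℕ} (hk : k ≤ K) : IsAffine x0 v K (S.filtErr mean cov x0 v k) :=
  (initial.mulVec _).sub (freeFilt hk)

end IsAffine

theorem measurable_infoF_freeMeas {j k : ℕ} (hj : j ≤ k) :
    Measurable[S.infoF x0 v k] (S.freeMeas x0 v j) := by
  have hf : Measurable fun (f : Fin (k + 1) × Fin m → ℝ) (i : Fin m) =>
      f (⟨j, by omega⟩, i) := by fun_prop
  exact hf.comp (comap_measurable _)

theorem infoF_mono : Monotone (S.infoF x0 v) := by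
  intro j k hjk
  have hf : Measurable fun (f : Fin (k + 1) × Fin m → ℝ) (q : Fin (j + 1) × Fin m) =>
      f (⟨q.1, by omega⟩, q.2) := by fun_prop
  exact (hf.comp (comap_measurable
    (fun ω (q : Fin (k + 1) × Fin m) => S.freeMeas x0 v q.1 ω q.2))).comap_le

theorem measurable_infoF_freePred (k : ℕ) :
    Measurable[S.infoF x0 v k] (S.freePred mean cov x0 v (k + 1)) ∧
    Measurable[S.infoF x0 v k] (S.freeFilt mean cov x0 v k) := by
  have hA : Measurable fun x : Fin n → ℝ => S.A *ᵥ x := by fun_prop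
  have step : ∀ k, Measurable[S.infoF x0 v k] (S.freePred mean cov x0 v k) →
      Measurable[S.infoF x0 v k] (S.freeFilt mean cov x0 v k) := by
    intro k hk
    have hf : Measurable fun q : (Fin n → ℝ) × (Fin m → ℝ) =>
      q.1 + S.gainAt cov k *ᵥ (q.2 - S.H *ᵥ q.1) := by fun_prop
    exact hf.comp (hk.prodMk (measurable_infoF_freeMeas le_rfl))
  induction k with
  | zero =>
    have := step 0 (@measurable_const _ _ _ (S.infoF x0 v 0) mean)
    exact ⟨hA.comp this, this⟩
  | succ k ih =>
    have := step (k + 1) (ih.1.mono (infoF_mono (Nat.le_succ k)) le_rfl)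
    exact ⟨hA.comp this, this⟩

theorem infoF_le_hist (k : ℕ) : S.infoF x0 v k ≤ hist x0 v β 0 := by
  have hf : Measurable fun (f : ((Fin n → ℝ) × (ℕ → Fin m → ℝ)) × (Fin 0 → ℝ))
      (q : Fin (k + 1) × Fin m) => (S.H *ᵥ ((S.A ^ (q.1 : ℕ)) *ᵥ f.1.1) + f.1.2 q.1) q.2 := by
    fun_prop
  exact (hf.comp (comap_measurable
    (fun ω => ((x0 ω, fun j => v j ω), fun j : Fin 0 => β j ω)))).comap_le

theorem measurable_hist_filtErr (k : ℕ) :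
    Measurable[hist x0 v β 0] (S.filtErr mean cov x0 v k) := by
  have h1 : Measurable[hist x0 v β 0] (S.freeFilt mean cov x0 v k) :=
    (measurable_infoF_freePred k).2.mono (infoF_le_hist k) le_rfl
  have hf : Measurable fun q : (Fin n → ℝ) × (Fin n → ℝ) => (S.A ^ k) *ᵥ q.1 - q.2 := by fun_prop
  exact hf.comp ((measurable_hist_x0 0).prodMk h1)

variable [m0 : MeasurableSpace Ω] {P : Measure Ω} [IsProbabilityMeasure P]

namespace IsInput

theorem cross_v_freePred (h : S.IsInput P mean cov x0 v β) {j k : ℕ} (hjk : k ≤ j) :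
    cross P (v j) (S.freePred mean cov x0 v k) = 0 := by
  induction k with
  | zero =>
    ext i l
    simp only [cross, of_apply, Matrix.zero_apply, freePred]
    rw [integral_mul_const, h.integral_v, zero_mul]
  | succ k ih =>
    have e : S.freePred mean cov x0 v (k + 1) = fun ω => S.A *ᵥ
      (S.freePred mean cov x0 v k ω + S.gainAt cov k *ᵥ
        (S.H *ᵥ S.predErr mean cov x0 v k ω + v k ω)) :=
      funext fun ω => congrArg (fun x => S.A *ᵥ x) (freeFilt_eq k ω)
    have h1 := h.memLp_freePred k
    have h2 : MemLp (fun ω => S.H *ᵥ S.predErr mean cov x0 v k ω) 2 P :=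
      memLp_mulVec (h.memLp_predErr k) _
    have h3 : MemLp (fun ω => S.H *ᵥ S.predErr mean cov x0 v k ω + v k ω) 2 P :=
      h2.add (h.memLp_v k)
    have h4 := memLp_mulVec h3 (S.gainAt cov k)
    have h5 : MemLp (fun ω => S.freePred mean cov x0 v k ω + S.gainAt cov k *ᵥ
        (S.H *ᵥ S.predErr mean cov x0 v k ω + v k ω)) 2 P := h1.add h4
    rw [e, cross_mulVec_right (h.memLp_v j) h5, cross_add_right (h.memLp_v j) h1 h4,
      cross_mulVec_right (h.memLp_v j) h3, cross_add_right (h.memLp_v j) h2 (h.memLp_v k),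
      cross_mulVec_right (h.memLp_v j) (h.memLp_predErr k), ih (by omega),
      ← cross_transpose (S.predErr mean cov x0 v k), h.cross_predErr_v (by omega),
      h.cross_v_of_ne (by omega)]
    simp

/-- The filtering error is uncorrelated with the innovation. -/
theorem cross_filtErr_innov (h : S.IsInput P mean cov x0 v β) (k : ℕ) :
    cross P (S.filtErr mean cov x0 v k) (fun ω => S.H *ᵥ S.predErr mean cov x0 v k ω + v k ω) =
      0 := by
  have hg := gainAt_mul_innovCov (S := S) h.posSemidef_Qv h.posSemidef_cov k
  rw [cross_add_right (h.memLp_filtErr k) (memLp_mulVec (h.memLp_predErr k) _) (h.memLp_v k),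
    cross_mulVec_right (h.memLp_filtErr k) (h.memLp_predErr k), h.cross_filtErr_v,
    h.cross_filtErr_left k (h.memLp_predErr k), h.cross_predErr_self, ← cross_transpose _ (v k),
    h.cross_predErr_v le_rfl]
  -- The normal equation ΣH' = G(HΣH' + Q_v) is exactly the vanishing of (1 - GH)ΣH' - G Q_v.
  rw [innovCov, Matrix.mul_add, ← Matrix.mul_assoc, ← Matrix.mul_assoc] at hg
  simp only [transpose_zero, Matrix.mul_zero, sub_zero, Matrix.sub_mul, Matrix.one_mul]
  rw [← hg]; abel

/-- The next prediction is A applied to the previous prediction plus a multiple of the innovation,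
and the filtering error is uncorrelated with both. -/
theorem cross_predErr_freePred (h : S.IsInput P mean cov x0 v β) (k : ℕ) :
    cross P (S.predErr mean cov x0 v k) (S.freePred mean cov x0 v k) = 0 := by
  induction k with
  | zero =>
    ext i l
    have h1 : ∫ ω, S.predErr mean cov x0 v 0 ω i ∂P = 0 := by
      rw [← eval_integral fun j => ((h.memLp_predErr 0).integrable one_le_two).eval j,
        h.integral_predErr]
      rfl
    simp only [cross, of_apply, Matrix.zero_apply, freePred]
    rw [integral_mul_const, h1, zero_mul]
  | succ k ih =>
    have e : S.freePred mean cov x0 v (k + 1) = fun ω => S.A *ᵥ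
      (S.freePred mean cov x0 v k ω + S.gainAt cov k *ᵥ
        (S.H *ᵥ S.predErr mean cov x0 v k ω + v k ω)) :=
      funext fun ω => congrArg (fun x => S.A *ᵥ x) (freeFilt_eq k ω)
    have h1 := h.memLp_freePred k
    have h2 : MemLp (fun ω => S.H *ᵥ S.predErr mean cov x0 v k ω) 2 P :=
      memLp_mulVec (h.memLp_predErr k) _
    have h3 : MemLp (fun ω => S.H *ᵥ S.predErr mean cov x0 v k ω + v k ω) 2 P :=
      h2.add (h.memLp_v k)
    have h4 := memLp_mulVec h3 (S.gainAt cov k)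
    have h5 : MemLp (fun ω => S.freePred mean cov x0 v k ω + S.gainAt cov k *ᵥ
        (S.H *ᵥ S.predErr mean cov x0 v k ω + v k ω)) 2 P := h1.add h4
    rw [h.cross_predErr_succ_left k (h.memLp_freePred _), e,
      cross_mulVec_right (h.memLp_filtErr k) h5, cross_add_right (h.memLp_filtErr k) h1 h4,
      cross_mulVec_right (h.memLp_filtErr k) h3, h.cross_filtErr_innov,
      h.cross_filtErr_left k h1, ih, h.cross_v_freePred le_rfl]
    simp

theorem cross_filtErr_freeMeas_self (h : S.IsInput P mean cov x0 v β) (k : ℕ) :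
    cross P (S.filtErr mean cov x0 v k) (S.freeMeas x0 v k) = 0 := by
  have e : S.freeMeas x0 v k = fun ω => (S.H *ᵥ S.predErr mean cov x0 v k ω + v k ω)
    + S.H *ᵥ S.freePred mean cov x0 v k ω := funext fun ω => freeMeas_eq k ω
  have h3 : MemLp (fun ω => S.H *ᵥ S.predErr mean cov x0 v k ω) 2 P :=
    memLp_mulVec (h.memLp_predErr k) _
  have h2 : MemLp (fun ω => S.H *ᵥ S.predErr mean cov x0 v k ω + v k ω) 2 P :=
    h3.add (h.memLp_v k)
  have h1 := h.memLp_freePred k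
  have h4 : MemLp (fun ω => S.H *ᵥ S.freePred mean cov x0 v k ω) 2 P := memLp_mulVec h1 _
  rw [e, cross_add_right (h.memLp_filtErr k) h2 h4, h.cross_filtErr_innov,
    cross_mulVec_right (h.memLp_filtErr k) h1, h.cross_filtErr_left k h1,
    h.cross_predErr_freePred, h.cross_v_freePred le_rfl]
  simp

theorem cross_v_freeMeas (h : S.IsInput P mean cov x0 v β) {j k : ℕ} (hjk : j < k) :
    cross P (v k) (S.freeMeas x0 v j) = 0 := by
  have e : S.freeMeas x0 v j = fun ω => S.H *ᵥ ((S.A ^ j) *ᵥ x0 ω) + v j ω := rfl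
  have h1 : MemLp (fun ω => (S.A ^ j) *ᵥ x0 ω) 2 P := memLp_mulVec h.memLp_x0 _
  have h2 : MemLp (fun ω => S.H *ᵥ ((S.A ^ j) *ᵥ x0 ω)) 2 P := memLp_mulVec h1 _
  rw [e, cross_add_right (h.memLp_v _) h2 (h.memLp_v j), cross_mulVec_right (h.memLp_v _) h1,
    cross_mulVec_right (h.memLp_v _) h.memLp_x0, ← cross_transpose x0, h.cross_x0_v,
    h.cross_v_of_ne (by omega)]
  simp

/-- The newest measurement is the innovation plus H times the prediction, both uncorrelated with the
error. Later errors are linear in this error and in fresh noise, so the correlation remains zero. -/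
theorem cross_filtErr_freeMeas (h : S.IsInput P mean cov x0 v β) {j k : ℕ} (hjk : j ≤ k) :
    cross P (S.filtErr mean cov x0 v k) (S.freeMeas x0 v j) = 0 := by
  induction k, hjk using Nat.le_induction with
  | base => exact h.cross_filtErr_freeMeas_self j
  | succ k hj ih =>
    have h1 : MemLp (S.freeMeas x0 v j) 2 P := h.memLp_freeMeas j
    rw [h.cross_filtErr_left _ h1, h.cross_predErr_succ_left k h1, ih,
      h.cross_v_freeMeas (Nat.lt_succ_of_le hj)]
    simp

theorem hasGaussianLaw_joint (h : S.IsInput P mean cov x0 v β) (K : ℕ) :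
    HasGaussianLaw (fun ω => (x0 ω, fun j : Fin (K + 1) => v j ω)) P := by
  refine IndepFun.hasGaussianLaw h.gaussian_x0.hasGaussianLaw
    (iIndepFun.hasGaussianLaw (fun j => (h.gaussian_v j).hasGaussianLaw)
      (h.indep_v.precomp Fin.val_injective)) ?_
  exact h.indep_x0.comp measurable_id
    (ψ := fun (q : (ℕ → Fin m → ℝ) × (ℕ → ℝ)) (j : Fin (K + 1)) => q.1 j) (by fun_prop)

/-- Error and measurements are affine in the same jointly Gaussian vector, and for jointly Gaussian
vectors uncorrelated means independent. The additive constants are removed before and restored after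
this argument. -/
theorem indepFun_filtErr (h : S.IsInput P mean cov x0 v β) (k : ℕ) :
    IndepFun (S.filtErr mean cov x0 v k)
      (fun ω (q : Fin (k + 1) × Fin m) => S.freeMeas x0 v q.1 ω q.2) P := by
  obtain ⟨l, c, hl⟩ := IsAffine.filtErr (S := S) (mean := mean) (cov := cov) (x0 := x0) (v := v)
    (le_refl k)
  have hm : ∀ j : Fin (k + 1), IsAffine x0 v k (S.freeMeas x0 v j) :=
    fun j => IsAffine.freeMeas (by omega)
  choose l' c' hl' using hm
  set g : Ω → (Fin n → ℝ) × (Fin (k + 1) → Fin m → ℝ) :=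
    fun ω => (x0 ω, fun j : Fin (k + 1) => v j ω) with hg
  have hG := (h.hasGaussianLaw_joint k).map_fun (l.prod (ContinuousLinearMap.pi
    fun q : Fin (k + 1) × Fin m => (ContinuousLinearMap.proj q.2).comp (l' q.1)))
  have hind := HasGaussianLaw.indepFun_of_covariance_eval (P := P)
    (X := fun i ω => l (g ω) i) (Y := fun (q : Fin (k + 1) × Fin m) ω => l' q.1 (g ω) q.2)
    hG ?_
  · have h1 := hind.comp (φ := fun x : Fin n → ℝ => x + c)
      (ψ := fun (y : Fin (k + 1) × Fin m → ℝ) q => y q + c' q.1 q.2) (by fun_prop) (by fun_prop)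
    have e1 : S.filtErr mean cov x0 v k = (fun x : Fin n → ℝ => x + c) ∘ fun ω i => l (g ω) i :=
      funext fun ω => hl ω
    have e2 : (fun ω (q : Fin (k + 1) × Fin m) => S.freeMeas x0 v q.1 ω q.2) =
        (fun (y : Fin (k + 1) × Fin m → ℝ) q => y q + c' q.1 q.2) ∘
          fun ω (q : Fin (k + 1) × Fin m) => l' q.1 (g ω) q.2 := by
      ext ω q
      simp only [hl', Function.comp_def]
      rfl
    rw [e1, e2]
    exact h1
  · intro i q
    have hf := memLp_pi_iff.1 (h.memLp_filtErr k) i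
    have hw := memLp_pi_iff.1 (h.memLp_freeMeas (S := S) q.1) q.2
    have e1 : (fun ω => l (g ω) i) = fun ω => S.filtErr mean cov x0 v k ω i - c i := by
      ext ω; rw [hl]; simp [hg]
    have e2 : (fun ω => l' q.1 (g ω) q.2) = fun ω => S.freeMeas x0 v q.1 ω q.2 - c' q.1 q.2 := by
      ext ω; rw [hl']; simp [hg]
    rw [e1, e2, covariance_sub_const_left (hf.integrable one_le_two),
      covariance_sub_const_right (hw.integrable one_le_two), covariance_eq_sub hf hw,
      h.integral_filtErr, zero_mul, sub_zero]
    have := congrFun (congrFun (h.cross_filtErr_freeMeas (j := q.1) (k := k) (by omega)) i) q.2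
    simpa [cross] using this

theorem infoF_le (h : S.IsInput P mean cov x0 v β) (k : ℕ) : S.infoF x0 v k ≤ m0 :=
  (infoF_le_hist (β := β) k).trans (h.hist_le 0)

/-- Independence and mean zero; thus `freeFilt` is the conditional expectation of the uncontrolled
state given the measurements. -/
theorem orth_infoF_filtErr (h : S.IsInput P mean cov x0 v β) (k : ℕ) :
    Orth P (S.infoF x0 v k) (S.filtErr mean cov x0 v k) := by
  rintro C ⟨D, hD, rfl⟩ i
  set w := fun ω (q : Fin (k + 1) × Fin m) => S.freeMeas x0 v q.1 ω q.2
  have hw : Measurable w := (comap_measurable w).mono (h.infoF_le k) le_rfl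
  have hind : IndepFun (fun ω => (S.filtErr mean cov x0 v k ω) i)
      (fun ω => D.indicator (1 : (Fin (k + 1) × Fin m → ℝ) → ℝ) (w ω)) P :=
    (h.indepFun_filtErr k).comp (measurable_pi_apply i) (measurable_one.indicator hD)
  rw [← integral_indicator (hw hD)]
  have e : ∀ ω, (w ⁻¹' D).indicator (fun ω => S.filtErr mean cov x0 v k ω i) ω =
      S.filtErr mean cov x0 v k ω i * D.indicator (1 : (Fin (k + 1) × Fin m → ℝ) → ℝ) (w ω) := by
    intro ω
    by_cases hω : w ω ∈ D
    · rw [Set.indicator_of_mem (by exact hω), Set.indicator_of_mem hω]; simp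
    · rw [Set.indicator_of_notMem (by exact hω), Set.indicator_of_notMem hω]; simp
  rw [integral_congr_ae (ae_of_all _ e), hind.integral_fun_mul_eq_mul_integral
    (memLp_pi_iff.1 (h.memLp_filtErr k) i).1
    ((measurable_one.indicator hD).comp hw).aestronglyMeasurable, h.integral_filtErr, zero_mul]

end IsInput
end NCS
end

/-! ### The control-independent information and the detectability bound. -/

noncomputable section

open LQ

namespace LQ

/-- The events that agree on `s` with an event of `m'` form a σ-algebra, so agreement has to be
checked on generators only; `comap_le_trace` reduces this to measurability of the restricted
generator. -/
theorem exists_agree {Ω : Type} {m m' : MeasurableSpace Ω} {s : Set Ω}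
    (h : m ≤ MeasurableSpace.map (Subtype.val : s → Ω) (m'.comap Subtype.val)) {C : Set Ω}
    (hC : MeasurableSet[m] C) : ∃ C', MeasurableSet[m'] C' ∧ ∀ ω ∈ s, (ω ∈ C ↔ ω ∈ C') := by
  obtain ⟨C', hC', e⟩ := h C hC
  exact ⟨C', hC', fun ω hω => (Set.ext_iff.1 e ⟨ω, hω⟩).symm⟩

theorem comap_le_trace {Ω α : Type} [mα : MeasurableSpace α] {M : MeasurableSpace Ω} {s : Set Ω}
    {f : Ω → α} (h : Measurable[M.comap Subtype.val] fun ω : s => f ω) :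
    MeasurableSpace.comap f mα ≤
      MeasurableSpace.map (Subtype.val : s → Ω) (M.comap Subtype.val) := by
  rw [← MeasurableSpace.comap_le_iff_le_map, MeasurableSpace.comap_comp]
  exact h.comap_le

theorem trace_pow_le {n : ℕ} {F N : Matrix (Fin n) (Fin n) ℝ} {g : ℝ} (hF : ∀ i j, |F i j| ≤ g) :
    Matrix.trace (F * N * Fᵀ) ≤ n * absSum N * g ^ 2 := by
  have h : ∀ i, (F * N * Fᵀ) i i ≤ absSum N * g ^ 2 := by
    intro i
    have e : (F * N * Fᵀ) i i = ∑ a, ∑ b, F i a * N a b * F i b := by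
      simp only [Matrix.mul_apply, transpose_apply, Finset.sum_mul]
      rw [Finset.sum_comm]
    rw [e, absSum, Finset.sum_mul]
    refine Finset.sum_le_sum fun a _ => ?_
    rw [Finset.sum_mul]
    refine Finset.sum_le_sum fun b _ => ?_
    calc F i a * N a b * F i b ≤ |F i a * N a b * F i b| := le_abs_self _
      _ = |N a b| * (|F i a| * |F i b|) := by rw [abs_mul, abs_mul]; ring
      _ ≤ |N a b| * (g * g) := by
          gcongr
          · exact (abs_nonneg _).trans (hF i a)
          · exact hF i a
          · exact hF i b
      _ = |N a b| * g ^ 2 := by ring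
  calc Matrix.trace (F * N * Fᵀ) = ∑ i, (F * N * Fᵀ) i i := rfl
    _ ≤ ∑ _i : Fin n, absSum N * g ^ 2 := Finset.sum_le_sum fun i _ => h i
    _ = n * absSum N * g ^ 2 := by simp; ring

theorem summable_sq_of_summable {g : ℕ → ℝ} (hg : Summable g) : Summable fun k => g k ^ 2 := by
  have h1 : Tendsto (fun k => |g k|) atTop (𝓝 0) := by simpa using hg.tendsto_atTop_zero.abs
  refine Summable.of_norm_bounded_eventually_nat (g := fun k => |g k|) hg.abs ?_
  filter_upwards [h1.eventually (gt_mem_nhds one_pos)] with k hk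
  rw [Real.norm_eq_abs, abs_pow]
  nlinarith [abs_nonneg (g k)]

end LQ

namespace NCS

variable {n m a b : ℕ} {S : NCS n m a b} {Ω : Type} {mean : Fin n → ℝ}
  {cov : Matrix (Fin n) (Fin n) ℝ} {x0 : Ω → Fin n → ℝ}
  {v : ℕ → Ω → Fin m → ℝ} {β : ℕ → Ω → ℝ}

/-- The full information of the embedded controller, in control-independent form: receptions,
uncontrolled measurements, and uncontrolled states that were received. -/
abbrev infoG (S : NCS n m a b) (x0 : Ω → Fin n → ℝ) (v : ℕ → Ω → Fin m → ℝ) (β : ℕ → Ω → ℝ)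
    (k : ℕ) : MeasurableSpace Ω :=
  ⨆ j ≤ k, (MeasurableSpace.comap (β j) inferInstance ⊔
    MeasurableSpace.comap (S.freeMeas x0 v j) inferInstance ⊔
    MeasurableSpace.comap (fun ω => β j ω • ((S.A ^ j) *ᵥ x0 ω)) inferInstance)

/-- Estimation error of the embedded controller, which also knows the receptions. -/
def err (S : NCS n m a b) (mean : Fin n → ℝ) (cov : Matrix (Fin n) (Fin n) ℝ)
    (x0 : Ω → Fin n → ℝ) (v : ℕ → Ω → Fin m → ℝ) (β : ℕ → Ω → ℝ) (k : ℕ) (ω : Ω) : Fin n → ℝ :=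
  tau β (k + 1) ω • S.filtErr mean cov x0 v k ω

theorem infoG_mono : Monotone (S.infoG x0 v β) := fun i j hij =>
  iSup₂_le fun k hk => le_iSup₂_of_le k (hk.trans hij) le_rfl

theorem measurable_infoG_β {j k : ℕ} (hj : j ≤ k) : Measurable[S.infoG x0 v β k] (β j) := by
  rw [measurable_iff_comap_le]
  exact le_iSup₂_of_le j hj (le_sup_left.trans le_sup_left)

theorem measurable_infoG_freeMeas {j k : ℕ} (hj : j ≤ k) :
    Measurable[S.infoG x0 v β k] (S.freeMeas x0 v j) := by
  rw [measurable_iff_comap_le]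
  exact le_iSup₂_of_le j hj (le_sup_right.trans le_sup_left)

theorem measurable_infoG_received {j k : ℕ} (hj : j ≤ k) :
    Measurable[S.infoG x0 v β k] (fun ω => β j ω • ((S.A ^ j) *ᵥ x0 ω)) := by
  rw [measurable_iff_comap_le]
  exact le_iSup₂_of_le j hj le_sup_right

theorem infoF_le_infoG (k : ℕ) : S.infoF x0 v k ≤ S.infoG x0 v β k := by
  have h : Measurable[S.infoG x0 v β k]
      fun ω (q : Fin (k + 1) × Fin m) => S.freeMeas x0 v q.1 ω q.2 := by
    let _ : MeasurableSpace Ω := S.infoG x0 v β k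
    refine measurable_pi_iff.2 fun q => ?_
    have h1 : Measurable[S.infoG x0 v β k] (S.freeMeas x0 v q.1) :=
      measurable_infoG_freeMeas (by omega)
    exact (measurable_pi_apply q.2).comp h1
  exact h.comap_le

theorem measurable_infoG_tau {j k : ℕ} (hj : j ≤ k + 1) :
    Measurable[S.infoG x0 v β k] (tau β j) := by
  have : tau β j = fun ω => ∏ i ∈ Finset.range j, (1 - β i ω) := rfl
  rw [this]
  exact Finset.measurable_fun_prod (m := S.infoG x0 v β k) _ fun i hi =>
    measurable_const.sub (measurable_infoG_β (by have := Finset.mem_range.1 hi; omega))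

theorem infoG_le_hist (k : ℕ) : S.infoG x0 v β k ≤ hist x0 v β (k + 1) := by
  refine iSup₂_le fun j hj => sup_le (sup_le ?_ ?_) ?_
  · exact (measurable_hist_β (by omega)).comap_le
  · have h1 : Measurable[S.infoF x0 v j] (S.freeMeas x0 v j) := measurable_infoF_freeMeas le_rfl
    exact (h1.mono ((infoF_le_hist (β := β) j).trans (hist_mono (Nat.zero_le _))) le_rfl).comap_le
  · have hf : Measurable fun q : ℝ × (Fin n → ℝ) => q.1 • ((S.A ^ j) *ᵥ q.2) := by fun_prop
    exact (hf.comp ((measurable_hist_β (show j < k + 1 by omega)).prodMk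
      (measurable_hist_x0 _))).comap_le

/-- After a reception the uncontrolled state is known: it is received, or propagated by `A` from the
previous step. Without a reception what remains is the Kalman filter. -/
theorem measurable_infoG_sub_err (k : ℕ) : Measurable[S.infoG x0 v β k]
    (fun ω => (S.A ^ k) *ᵥ x0 ω - S.err mean cov x0 v β k ω) := by
  have h1 : ∀ k, Measurable[S.infoG x0 v β k]
      (fun ω => (1 - tau β (k + 1) ω) • ((S.A ^ k) *ᵥ x0 ω)) := by
    intro k
    induction k with
    | zero =>
      have : (fun ω => (1 - tau β (0 + 1) ω) • ((S.A ^ 0) *ᵥ x0 ω)) =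
          fun ω => β 0 ω • ((S.A ^ 0) *ᵥ x0 ω) := by
        ext ω; simp [tau_succ, tau_zero]
      rw [this]
      exact measurable_infoG_received le_rfl
    | succ k ih =>
      have : (fun ω => (1 - tau β (k + 1 + 1) ω) • ((S.A ^ (k + 1)) *ᵥ x0 ω)) =
          fun ω => S.A *ᵥ ((1 - tau β (k + 1) ω) • ((S.A ^ k) *ᵥ x0 ω)) +
            tau β (k + 1) ω • (β (k + 1) ω • ((S.A ^ (k + 1)) *ᵥ x0 ω)) := by
        ext1 ω
        rw [mulVec_smul, mulVec_mulVec, ← pow_succ', smul_smul, ← add_smul, tau_succ (k + 1)]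
        congr 1; ring
      rw [this]
      have hA : Measurable fun q : (Fin n → ℝ) × ℝ × (Fin n → ℝ) =>
        S.A *ᵥ q.1 + q.2.1 • q.2.2 := by fun_prop
      exact hA.comp ((ih.mono (infoG_mono (Nat.le_succ k)) le_rfl).prodMk
        ((measurable_infoG_tau (by omega)).prodMk (measurable_infoG_received le_rfl)))
  have e : (fun ω => (S.A ^ k) *ᵥ x0 ω - S.err mean cov x0 v β k ω) = fun ω =>
      (1 - tau β (k + 1) ω) • ((S.A ^ k) *ᵥ x0 ω) +
        tau β (k + 1) ω • S.freeFilt mean cov x0 v k ω := by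
    ext1 ω
    rw [err, filtErr, smul_sub, sub_smul, one_smul]
    abel
  rw [e]
  have hf : Measurable fun q : (Fin n → ℝ) × ℝ × (Fin n → ℝ) => q.1 + q.2.1 • q.2.2 := by fun_prop
  exact hf.comp ((h1 k).prodMk ((measurable_infoG_tau le_rfl).prodMk
    ((measurable_infoF_freePred k).2.mono (infoF_le_infoG k) le_rfl)))

theorem tau_succ_eq_one {k : ℕ} {ω : Ω} (hβ : ∀ k ω, β k ω = 0 ∨ β k ω = 1)
    (h : tau β (k + 1) ω ≠ 0) {j : ℕ} (hj : j ≤ k) : β j ω = 0 := by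
  have h1 := Finset.prod_ne_zero_iff.1 h j (Finset.mem_range.2 (by omega))
  rcases hβ j ω with h0 | h2
  · exact h0
  · rw [h2] at h1; simp at h1

/-- As long as nothing was received, the receptions and the received states are constant and only
the measurements carry information. -/
theorem infoG_agree (hβ : ∀ k ω, β k ω = 0 ∨ β k ω = 1) (k : ℕ) {C : Set Ω}
    (hC : MeasurableSet[S.infoG x0 v β k] C) : ∃ C', MeasurableSet[S.infoF x0 v k] C' ∧
      ∀ ω ∈ {ω | tau β (k + 1) ω ≠ 0}, (ω ∈ C ↔ ω ∈ C') := by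
  refine exists_agree (iSup₂_le fun j hj => sup_le (sup_le ?_ ?_) ?_) hC
  · refine comap_le_trace ?_
    have : (fun ω : {ω | tau β (k + 1) ω ≠ 0} => β j ω) = fun _ => 0 :=
      funext fun ω => tau_succ_eq_one hβ ω.2 hj
    rw [this]; exact measurable_const
  · refine comap_le_trace ?_
    exact (measurable_infoF_freeMeas hj).comp (comap_measurable _)
  · refine comap_le_trace ?_
    have : (fun ω : {ω | tau β (k + 1) ω ≠ 0} => β j ω • ((S.A ^ j) *ᵥ x0 ω)) = fun _ => 0 := by
      funext ω
      rw [tau_succ_eq_one hβ ω.2 hj, zero_smul]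
    rw [this]; exact measurable_const

theorem measurable_hist_err (k : ℕ) :
    Measurable[hist x0 v β (k + 1)] (S.err mean cov x0 v β k) := by
  have hf : Measurable fun q : ℝ × (Fin n → ℝ) => q.1 • q.2 := by fun_prop
  exact hf.comp ((measurable_hist_tau (k + 1)).prodMk
    ((measurable_hist_filtErr k).mono (hist_mono (Nat.zero_le _)) le_rfl))

/-- A Luenberger observer of the uncontrolled state. -/
def observer (S : NCS n m a b) (K : Matrix (Fin n) (Fin m) ℝ) (x0 : Ω → Fin n → ℝ)
    (v : ℕ → Ω → Fin m → ℝ) : ℕ → Ω → Fin n → ℝ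
  | 0 => fun _ => 0
  | k + 1 => fun ω => S.A *ᵥ observer S K x0 v k ω +
      K *ᵥ (S.freeMeas x0 v k ω - S.H *ᵥ observer S K x0 v k ω)

theorem measurable_infoF_observer (K : Matrix (Fin n) (Fin m) ℝ) (k : ℕ) :
    Measurable[S.infoF x0 v k] (S.observer K x0 v k) := by
  induction k with
  | zero => exact measurable_const
  | succ k ih =>
    have hf : Measurable fun q : (Fin n → ℝ) × (Fin m → ℝ) =>
      S.A *ᵥ q.1 + K *ᵥ (q.2 - S.H *ᵥ q.1) := by fun_prop
    exact hf.comp ((ih.mono (infoF_mono (Nat.le_succ k)) le_rfl).prodMk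
      (measurable_infoF_freeMeas (Nat.le_succ k)))

variable [m0 : MeasurableSpace Ω] {P : Measure Ω} [IsProbabilityMeasure P]

namespace IsInput

theorem infoG_le (h : S.IsInput P mean cov x0 v β) (k : ℕ) : S.infoG x0 v β k ≤ m0 :=
  (infoG_le_hist k).trans (h.hist_le _)

theorem memLp_err (h : S.IsInput P mean cov x0 v β) (k : ℕ) :
    MemLp (S.err mean cov x0 v β k) 2 P := h.memLp_tau_smul _ (h.memLp_filtErr k)

/-- On the event of no reception, `C` may be replaced by an event `C'` of the measurements; the loss
indicator then factors out as p^(k+1) and the Kalman error integrates to zero over `C'`. -/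
theorem orth_infoG_err (h : S.IsInput P mean cov x0 v β) (hp1 : S.p < 1) (k : ℕ) :
    Orth P (S.infoG x0 v β k) (S.err mean cov x0 v β k) := by
  intro C hC i
  obtain ⟨C', hC', hCC⟩ := infoG_agree h.β_zero_or_one k hC
  have hmC' := h.infoF_le k C' hC'
  rw [← integral_indicator (h.infoG_le k C hC)]
  have e : ∀ ω, C.indicator (fun ω => S.err mean cov x0 v β k ω i) ω =
      tau β (k + 1) ω * C'.indicator (fun ω => S.filtErr mean cov x0 v k ω i) ω := by
    intro ω
    rcases h.tau_zero_or_one (k + 1) ω with h0 | h1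
    · simp [err, h0, Set.indicator]
    · have := hCC ω (by simp [h1])
      by_cases hω : ω ∈ C
      · rw [Set.indicator_of_mem hω, Set.indicator_of_mem (this.1 hω)]; simp [err]
      · rw [Set.indicator_of_notMem hω, Set.indicator_of_notMem (fun h' => hω (this.2 h'))]; simp
  have hi := ((h.memLp_filtErr k).integrable one_le_two).eval i
  rw [integral_congr_ae (ae_of_all _ e), h.integral_tau_mul hp1, integral_indicator hmC',
    h.orth_infoF_filtErr k C' hC' i, mul_zero]
  · exact Measurable.indicator ((measurable_pi_apply i).comp (measurable_hist_filtErr k))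
      (infoF_le_hist k C' hC')
  · exact hi.indicator hmC'

theorem memLp_observer (h : S.IsInput P mean cov x0 v β) (K : Matrix (Fin n) (Fin m) ℝ) (k : ℕ) :
    MemLp (S.observer K x0 v k) 2 P := by
  induction k with
  | zero => exact memLp_const _
  | succ k ih =>
    have h1 : MemLp (fun ω => S.freeMeas x0 v k ω - S.H *ᵥ S.observer K x0 v k ω) 2 P :=
      (h.memLp_freeMeas k).sub (memLp_mulVec ih _)
    have h2 : MemLp (fun ω => S.A *ᵥ S.observer K x0 v k ω) 2 P := memLp_mulVec ih _
    have h3 : MemLp (fun ω => K *ᵥ (S.freeMeas x0 v k ω - S.H *ᵥ S.observer K x0 v k ω)) 2 P :=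
      memLp_mulVec h1 _
    exact h2.add h3

/-- Boundedness of the error of the Kalman filter for a detectable pair. -/
theorem exists_bound_filtErr (h : S.IsInput P mean cov x0 v β) (hdet : IsDetectablePair S.A S.H) :
    ∃ c : ℝ, 0 ≤ c ∧ ∀ k, ∫ ω, S.filtErr mean cov x0 v k ω ⬝ᵥ S.filtErr mean cov x0 v k ω ∂P ≤
      c := by
  obtain ⟨K, hK⟩ := hdet
  set F := S.A - K * S.H with hF
  obtain ⟨g, hg, hFg⟩ := summable_pow_of_isSchurStable hK
  have hg2 := summable_sq_of_summable hg
  set d : ℕ → Ω → Fin n → ℝ := fun k ω => (S.A ^ k) *ᵥ x0 ω - S.observer K x0 v k ω with hd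
  have hdm : ∀ k, MemLp (d k) 2 P := fun k =>
    (memLp_mulVec h.memLp_x0 _).sub (h.memLp_observer K k)
  have hds : ∀ k, d (k + 1) = fun ω => F *ᵥ d k ω - K *ᵥ v k ω := by
    intro k
    ext1 ω
    simp only [hd, observer, freeMeas, hF, sub_mulVec, mulVec_sub, mulVec_add, mulVec_mulVec,
      pow_succ', Matrix.mul_assoc, Matrix.sub_mul]
    abel
  -- The observer uses the measurement at time `k` only for its state at `k + 1`, so its error at
  -- `k` does not contain the noise at `k`.
  have hdv : ∀ k j, k ≤ j → cross P (d k) (v j) = 0 := by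
    intro k
    induction k with
    | zero =>
      intro j _
      have : d 0 = x0 := by ext1 ω; simp [hd, observer]
      rw [this, h.cross_x0_v]
    | succ k ih =>
      intro j hj
      rw [hds, cross_sub_left (memLp_mulVec (hdm k) _) (memLp_mulVec (h.memLp_v k) _) (h.memLp_v j),
        cross_mulVec_left (hdm k) (h.memLp_v j), cross_mulVec_left (h.memLp_v k) (h.memLp_v j),
        ih j (by omega), h.cross_v_of_ne (by omega)]
      simp
  set N := K * S.Qv * Kᵀ with hN
  have hD : ∀ k, cross P (d (k + 1)) (d (k + 1)) = F * cross P (d k) (d k) * Fᵀ + N := by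
    intro k
    have h1 : MemLp (fun ω => F *ᵥ d k ω) 2 P := memLp_mulVec (hdm k) _
    have h2 : MemLp (fun ω => K *ᵥ v k ω) 2 P := memLp_mulVec (h.memLp_v k) _
    have h3 : MemLp (fun ω => F *ᵥ d k ω - K *ᵥ v k ω) 2 P := h1.sub h2
    rw [hds, cross_sub_left h1 h2 h3, cross_sub_right h1 h1 h2, cross_sub_right h2 h1 h2,
      cross_mulVec_left (hdm k) h1, cross_mulVec_left (hdm k) h2, cross_mulVec_left (h.memLp_v k) h1,
      cross_mulVec_left (h.memLp_v k) h2, cross_mulVec_right (hdm k) (hdm k),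
      cross_mulVec_right (hdm k) (h.memLp_v k), cross_mulVec_right (h.memLp_v k) (hdm k),
      cross_mulVec_right (h.memLp_v k) (h.memLp_v k), ← cross_transpose (d k) (v k),
      hdv k k le_rfl, h.cross_v_self]
    simp [hN, Matrix.mul_assoc]
  have hDk : ∀ k, cross P (d k) (d k) = F ^ k * cross P (d 0) (d 0) * (F ^ k)ᵀ +
      ∑ j ∈ Finset.range k, F ^ j * N * (F ^ j)ᵀ := by
    intro k
    induction k with
    | zero => simp
    | succ k ih =>
      rw [hD, ih, Finset.sum_range_succ', Matrix.mul_add, Matrix.add_mul, Finset.mul_sum,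
        Finset.sum_mul]
      simp only [pow_succ', pow_zero, transpose_mul, Matrix.mul_assoc, transpose_one,
        Matrix.one_mul, Matrix.mul_one]
      abel
  set T := ∑' k, g k ^ 2
  have hT : ∀ s : Finset ℕ, ∑ k ∈ s, g k ^ 2 ≤ T := fun s =>
    hg2.sum_le_tsum s fun _ _ => sq_nonneg _
  have hT0 : 0 ≤ T := tsum_nonneg fun _ => sq_nonneg _
  refine ⟨n * absSum (cross P (d 0) (d 0)) * T + n * absSum N * T, ?_, fun k => ?_⟩
  · have := absSum_nonneg (cross P (d 0) (d 0))
    have := absSum_nonneg N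
    positivity
  · have h1 : ∫ ω, d k ω ⬝ᵥ d k ω ∂P ≤
        n * absSum (cross P (d 0) (d 0)) * T + n * absSum N * T := by
      have e := integral_quad_eq_trace (hdm k) (hdm k) (1 : Matrix (Fin n) (Fin n) ℝ)
      simp only [one_mulVec, Matrix.one_mul] at e
      rw [e, hDk, trace_add, trace_sum]
      refine add_le_add ?_ ?_
      · refine (trace_pow_le (hFg k)).trans ?_
        refine mul_le_mul_of_nonneg_left ?_
          (mul_nonneg (Nat.cast_nonneg _) (absSum_nonneg _))
        simpa using hT {k}
      · refine (Finset.sum_le_sum fun j _ => trace_pow_le (hFg j)).trans ?_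
        rw [← Finset.mul_sum]
        exact mul_le_mul_of_nonneg_left (hT _) (mul_nonneg (Nat.cast_nonneg _) (absSum_nonneg _))
    refine le_trans ?_ h1
    -- The two estimators differ by a function of the measurements, to which the Kalman error is
    -- orthogonal. By Pythagoras the Kalman error does not exceed the observer error, which is
    -- bounded since A - KH is Schur stable.
    set r : Ω → Fin n → ℝ := fun ω => S.freeFilt mean cov x0 v k ω - S.observer K x0 v k ω
    have hr : MemLp r 2 P := (h.memLp_freeFilt k).sub (h.memLp_observer K k)
    have hrm : Measurable[S.infoF x0 v k] r :=
      (measurable_infoF_freePred k).2.sub (measurable_infoF_observer K k)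
    have ho := (h.orth_infoF_filtErr k).integral_quad_add (h.infoF_le k) hr (h.memLp_filtErr k)
      hrm.stronglyMeasurable.aestronglyMeasurable (1 : Matrix (Fin n) (Fin n) ℝ)
    simp only [one_mulVec] at ho
    have e : ∀ ω, d k ω = r ω + S.filtErr mean cov x0 v k ω := by
      intro ω
      simp only [hd, r, filtErr]; abel
    simp only [e]
    rw [ho]
    have : 0 ≤ ∫ ω, r ω ⬝ᵥ r ω ∂P := integral_nonneg fun ω => dot_self_nonneg _
    linarith

end IsInput
end NCS
end

/-! ### Information under admissible controls and the orthogonal decomposition. -/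

noncomputable section

open LQ

namespace NCS

variable {n m a b : ℕ} {S : NCS n m a b} {Ω : Type} {mean : Fin n → ℝ}
  {cov : Matrix (Fin n) (Fin n) ℝ} {x0 : Ω → Fin n → ℝ}
  {v : ℕ → Ω → Fin m → ℝ} {β : ℕ → Ω → ℝ}
  {x : ℕ → Ω → Fin n → ℝ} {u : ℕ → Ω → (Fin a ⊕ Fin b) → ℝ} {ut : ℕ → Ω → Fin b → ℝ}

/-- The remote information together with the receptions. -/
abbrev infoA (β : ℕ → Ω → ℝ) (x : ℕ → Ω → Fin n → ℝ) (k : ℕ) : MeasurableSpace Ω :=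
  infoW β x k ⊔ ⨆ j ≤ k, MeasurableSpace.comap (β j) inferInstance

theorem infoW_mono : Monotone (infoW β x) := fun i j hij =>
  iSup₂_le fun k hk => le_iSup₂_of_le k (hk.trans hij) le_rfl

theorem infoP_mono : Monotone (S.infoP v β x) := fun i j hij =>
  sup_le ((infoW_mono hij).trans le_sup_left)
    (le_sup_of_le_right (iSup₂_le fun k hk => le_iSup₂_of_le k (hk.trans hij) le_rfl))

theorem infoA_mono : Monotone (infoA β x) := fun i j hij =>
  sup_le ((infoW_mono hij).trans le_sup_left)
    (le_sup_of_le_right (iSup₂_le fun k hk => le_iSup₂_of_le k (hk.trans hij) le_rfl))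

theorem measurable_infoW_received {j k : ℕ} (hj : j ≤ k) :
    Measurable[infoW β x k] fun ω => β j ω • x j ω := by
  rw [measurable_iff_comap_le]
  exact le_iSup₂_of_le j hj le_rfl

theorem measurable_infoA_β {j k : ℕ} (hj : j ≤ k) : Measurable[infoA β x k] (β j) := by
  rw [measurable_iff_comap_le]
  exact le_sup_of_le_right (le_iSup₂_of_le j hj le_rfl)

theorem measurable_infoP_meas {j k : ℕ} (hj : j ≤ k) :
    Measurable[S.infoP v β x k] fun ω => S.H *ᵥ x j ω + v j ω := by
  rw [measurable_iff_comap_le]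
  exact le_sup_of_le_right (le_iSup₂_of_le j hj le_rfl)

/-- At a loss, the observation and the reception indicator of time `k + 1` are constant, so no new
information arrives. -/
theorem infoA_agree (k : ℕ) {C : Set Ω} (hC : MeasurableSet[infoA β x (k + 1)] C) :
    ∃ C', MeasurableSet[infoA β x k] C' ∧ ∀ ω ∈ {ω | β (k + 1) ω = 0}, (ω ∈ C ↔ ω ∈ C') := by
  refine exists_agree (sup_le (iSup₂_le fun j hj => ?_) (iSup₂_le fun j hj => ?_)) hC
  · refine comap_le_trace ?_
    rcases Nat.lt_or_ge k j with hkj | hjk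
    · obtain rfl : j = k + 1 := by omega
      have : (fun ω : {ω | β (k + 1) ω = 0} => β (k + 1) ω • x (k + 1) ω) = fun _ => 0 := by
        funext ω
        rw [ω.2, zero_smul]
      rw [this]; exact measurable_const
    · exact ((measurable_infoW_received hjk).mono le_sup_left le_rfl).comp (comap_measurable _)
  · refine comap_le_trace ?_
    rcases Nat.lt_or_ge k j with hkj | hjk
    · obtain rfl : j = k + 1 := by omega
      have : (fun ω : {ω | β (k + 1) ω = 0} => β (k + 1) ω) = fun _ => 0 := funext fun ω => ω.2
      rw [this]; exact measurable_const
    · exact (measurable_infoA_β hjk).comp (comap_measurable _)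

variable [m0 : MeasurableSpace Ω] {P : Measure Ω}

namespace IsAdmissible

/-- The deviation from the uncontrolled state is a function of past controls. It is proved together
with the inclusion of `infoP` in `infoG`: known deviations turn actual observations into
uncontrolled ones, and this makes the next control, hence the next deviation, measurable. This is
the absence of a dual effect. -/
theorem measurable_dev (hA : S.IsAdmissible P x0 v β x u ut) (k : ℕ) :
    ∀ j ≤ k, Measurable[S.infoG x0 v β k] fun ω => x j ω - (S.A ^ j) *ᵥ x0 ω := by
  have hinfo : ∀ k, (∀ j ≤ k, Measurable[S.infoG x0 v β k] fun ω => x j ω - (S.A ^ j) *ᵥ x0 ω) →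
      S.infoP v β x k ≤ S.infoG x0 v β k := by
    intro k hk
    refine sup_le (iSup₂_le fun j hj => ?_) (iSup₂_le fun j hj => ?_)
    · have e : (fun ω => β j ω • x j ω) = fun ω => β j ω • ((S.A ^ j) *ᵥ x0 ω) +
          β j ω • (x j ω - (S.A ^ j) *ᵥ x0 ω) := by
        ext1 ω; rw [← smul_add]; congr 1; abel
      rw [e]
      have hf : Measurable fun q : (Fin n → ℝ) × ℝ × (Fin n → ℝ) => q.1 + q.2.1 • q.2.2 := by
        fun_prop
      exact (hf.comp ((measurable_infoG_received hj).prodMk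
        ((measurable_infoG_β hj).prodMk (hk j hj)))).comap_le
    · have e : (fun ω => S.H *ᵥ x j ω + v j ω) = fun ω => S.freeMeas x0 v j ω +
          S.H *ᵥ (x j ω - (S.A ^ j) *ᵥ x0 ω) := by
        ext1 ω; simp only [freeMeas, mulVec_sub]; abel
      rw [e]
      have hf : Measurable fun q : (Fin m → ℝ) × (Fin n → ℝ) => q.1 + S.H *ᵥ q.2 := by
        fun_prop
      exact (hf.comp ((measurable_infoG_freeMeas hj).prodMk (hk j hj))).comap_le
  induction k with
  | zero =>
    intro j hj
    obtain rfl : j = 0 := by omega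
    have : (fun ω => x 0 ω - (S.A ^ 0) *ᵥ x0 ω) = fun _ => 0 := by
      ext1 ω; simp [hA.traj.1]
    rw [this]; exact measurable_const
  | succ k ih =>
    intro j hj
    rcases Nat.lt_or_ge k j with hkj | hjk
    · obtain rfl : j = k + 1 := by omega
      have e : (fun ω => x (k + 1) ω - (S.A ^ (k + 1)) *ᵥ x0 ω) = fun ω =>
          S.A *ᵥ (x k ω - (S.A ^ k) *ᵥ x0 ω) + S.B *ᵥ u k ω + S.BP *ᵥ ut k ω := by
        ext1 ω
        rw [hA.traj.2, mulVec_sub, mulVec_mulVec, pow_succ']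
        abel
      rw [e]
      have hf : Measurable fun q : (Fin n → ℝ) × ((Fin a ⊕ Fin b) → ℝ) × (Fin b → ℝ) =>
        S.A *ᵥ q.1 + S.B *ᵥ q.2.1 + S.BP *ᵥ q.2.2 := by fun_prop
      have h1 := hinfo k ih
      have h2 : Measurable[S.infoG x0 v β k] (u k) :=
        (hA.meas_u k).mono (le_sup_left.trans h1) le_rfl
      exact (hf.comp ((ih k le_rfl).prodMk (h2.prodMk ((hA.meas_ut k).mono h1 le_rfl)))).mono
        (infoG_mono (Nat.le_succ k)) le_rfl
    · exact (ih j hjk).mono (infoG_mono (Nat.le_succ k)) le_rfl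

theorem infoP_le_infoG (hA : S.IsAdmissible P x0 v β x u ut) (k : ℕ) :
    S.infoP v β x k ≤ S.infoG x0 v β k := by
  have hk := hA.measurable_dev k
  refine sup_le (iSup₂_le fun j hj => ?_) (iSup₂_le fun j hj => ?_)
  · have e : (fun ω => β j ω • x j ω) = fun ω => β j ω • ((S.A ^ j) *ᵥ x0 ω) +
        β j ω • (x j ω - (S.A ^ j) *ᵥ x0 ω) := by
      ext1 ω; rw [← smul_add]; congr 1; abel
    rw [e]
    have hf : Measurable fun q : (Fin n → ℝ) × ℝ × (Fin n → ℝ) => q.1 + q.2.1 • q.2.2 := by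
      fun_prop
    exact (hf.comp ((measurable_infoG_received hj).prodMk
      ((measurable_infoG_β hj).prodMk (hk j hj)))).comap_le
  · have e : (fun ω => S.H *ᵥ x j ω + v j ω) = fun ω => S.freeMeas x0 v j ω +
        S.H *ᵥ (x j ω - (S.A ^ j) *ᵥ x0 ω) := by
      ext1 ω; simp only [freeMeas, mulVec_sub]; abel
    rw [e]
    have hf : Measurable fun q : (Fin m → ℝ) × (Fin n → ℝ) => q.1 + S.H *ᵥ q.2 := by
      fun_prop
    exact (hf.comp ((measurable_infoG_freeMeas hj).prodMk (hk j hj))).comap_le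

theorem infoA_le_infoG (hA : S.IsAdmissible P x0 v β x u ut) (k : ℕ) :
    infoA β x k ≤ S.infoG x0 v β k :=
  sup_le (le_sup_left.trans (hA.infoP_le_infoG k))
    (iSup₂_le fun j hj => (measurable_infoG_β hj).comap_le)

/-- The state without the estimation error is known to the embedded controller. -/
theorem measurable_sub_err (hA : S.IsAdmissible P x0 v β x u ut) (k : ℕ) :
    Measurable[S.infoG x0 v β k] fun ω => x k ω - S.err mean cov x0 v β k ω := by
  have e : (fun ω => x k ω - S.err mean cov x0 v β k ω) = fun ω =>
      (x k ω - (S.A ^ k) *ᵥ x0 ω) + ((S.A ^ k) *ᵥ x0 ω - S.err mean cov x0 v β k ω) := by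
    ext1 ω; abel
  rw [e]
  have hf : Measurable fun q : (Fin n → ℝ) × (Fin n → ℝ) => q.1 + q.2 := by fun_prop
  exact hf.comp ((hA.measurable_dev k k le_rfl).prodMk (measurable_infoG_sub_err k))

end IsAdmissible

/-- The estimate of the remote controller if it also knows the receptions. -/
def estA (P : Measure Ω) (β : ℕ → Ω → ℝ) (x : ℕ → Ω → Fin n → ℝ) (k : ℕ) : Ω → Fin n → ℝ :=
  condExp (infoA β x k) P (x k)

/-- The difference of the estimates of the embedded and the remote controller, both of which
know the receptions. -/
def gap (S : NCS n m a b) (P : Measure Ω) (mean : Fin n → ℝ) (cov : Matrix (Fin n) (Fin n) ℝ)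
    (x0 : Ω → Fin n → ℝ) (v : ℕ → Ω → Fin m → ℝ) (β : ℕ → Ω → ℝ) (x : ℕ → Ω → Fin n → ℝ) (k : ℕ)
    (ω : Ω) : Fin n → ℝ :=
  x k ω - S.err mean cov x0 v β k ω - estA P β x k ω

/-- The part of the embedded control predicted by the remote information and the receptions. -/
def utPred (P : Measure Ω) (β : ℕ → Ω → ℝ) (x : ℕ → Ω → Fin n → ℝ) (ut : ℕ → Ω → Fin b → ℝ)
    (k : ℕ) : Ω → Fin b → ℝ := condExp (infoA β x k) P (ut k)

/-- Embedding of the embedded controls into the joint controls. -/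
def embP (a b : ℕ) : Matrix (Fin a ⊕ Fin b) (Fin b) ℝ := Matrix.fromRows 0 1

theorem B_mul_embP : S.B * embP a b = S.BP := by
  rw [B, embP, fromCols_mul_fromRows]; simp

theorem embP_R_embP : (embP a b)ᵀ * S.R * embP a b = S.RP := by
  rw [embP, R, Matrix.transpose_fromRows]
  rw [Matrix.fromCols_mul_fromBlocks, fromCols_mul_fromRows]
  simp

section Step

variable [IsProbabilityMeasure P] (h : S.IsInput P mean cov x0 v β)
  (hA : S.IsAdmissible P x0 v β x u ut)
include h hA

theorem IsAdmissible.memLp_x (k : ℕ) : MemLp (x k) 2 P := by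
  induction k with
  | zero => rw [hA.traj.1]; exact h.memLp_x0
  | succ k ih =>
    have e : x (k + 1) = fun ω => S.A *ᵥ x k ω + S.B *ᵥ u k ω + S.BP *ᵥ ut k ω :=
      funext (hA.traj.2 k)
    rw [e]
    have h2 : MemLp (fun ω => S.A *ᵥ x k ω) 2 P := memLp_mulVec ih _
    have h3 : MemLp (fun ω => S.B *ᵥ u k ω) 2 P := memLp_mulVec (hA.memLp_u k) _
    have h4 : MemLp (fun ω => S.A *ᵥ x k ω + S.B *ᵥ u k ω) 2 P := h2.add h3
    have h5 : MemLp (fun ω => S.BP *ᵥ ut k ω) 2 P := memLp_mulVec (hA.memLp_ut k) _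
    exact h4.add h5

theorem IsAdmissible.infoA_le (k : ℕ) : infoA β x k ≤ m0 :=
  (hA.infoA_le_infoG k).trans (h.infoG_le k)

theorem IsAdmissible.memLp_estA (k : ℕ) : MemLp (estA P β x k) 2 P :=
  (hA.memLp_x h k).condExp one_le_two

theorem IsAdmissible.memLp_gap (k : ℕ) : MemLp (S.gap P mean cov x0 v β x k) 2 P :=
  ((hA.memLp_x h k).sub (h.memLp_err k)).sub (hA.memLp_estA h k)

theorem IsAdmissible.memLp_utPred (k : ℕ) : MemLp (utPred P β x ut k) 2 P :=
  (hA.memLp_ut k).condExp one_le_two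

omit h hA [IsProbabilityMeasure P] in
theorem measurable_estA (k : ℕ) : Measurable[infoA β x k] (estA P β x k) :=
  stronglyMeasurable_condExp.measurable

omit h hA [IsProbabilityMeasure P] in
theorem measurable_utPred (k : ℕ) : Measurable[infoA β x k] (utPred P β x ut k) :=
  stronglyMeasurable_condExp.measurable

omit h [IsProbabilityMeasure P] in
theorem IsAdmissible.measurable_gap (k : ℕ) :
    Measurable[S.infoG x0 v β k] (S.gap P mean cov x0 v β x k) := by
  have hf : Measurable fun q : (Fin n → ℝ) × (Fin n → ℝ) => q.1 - q.2 := by fun_prop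
  exact hf.comp ((hA.measurable_sub_err k).prodMk
    ((measurable_estA k).mono (hA.infoA_le_infoG k) le_rfl))

/-- The gap is x - `estA`, orthogonal to `infoA`, minus `err`, orthogonal even to the larger
`infoG`. -/
theorem IsAdmissible.orth_gap (hp1 : S.p < 1) (k : ℕ) :
    Orth P (infoA β x k) (S.gap P mean cov x0 v β x k) := by
  have h1 := orth_sub_condExp (hA.infoA_le h k) ((hA.memLp_x h k).integrable one_le_two)
  have h2 := (h.orth_infoG_err hp1 k).mono (hA.infoA_le_infoG k)
  have h3 := h1.sub h2 (((hA.memLp_x h k).sub (hA.memLp_estA h k)).integrable one_le_two)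
    ((h.memLp_err k).integrable one_le_two)
  refine h3.congr (ae_of_all _ fun ω => ?_)
  simp only [gap, estA, Pi.sub_apply]; abel

theorem IsAdmissible.orth_utPred (k : ℕ) :
    Orth P (infoA β x k) (fun ω => ut k ω - utPred P β x ut k ω) :=
  orth_sub_condExp (hA.infoA_le h k) ((hA.memLp_ut k).integrable one_le_two)

omit h hA [IsProbabilityMeasure P] in
theorem aesm {M : MeasurableSpace Ω} {r : Type} [Fintype r] {X : Ω → r → ℝ} (hX : Measurable[M] X) :
    AEStronglyMeasurable[M] X P := hX.stronglyMeasurable.aestronglyMeasurable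

end Step
end NCS
end

/-! ### The one-step identity for the value function. -/

noncomputable section

open LQ

namespace LQ

variable {Ω : Type} {m m0 : MeasurableSpace Ω} {P : Measure Ω} [IsProbabilityMeasure P]
variable {ι κ : Type*} [Fintype ι] [Fintype κ]

/-- The expected value of the quadratic form `X' T X`. -/
def qform (P : Measure Ω) (T : Matrix ι ι ℝ) (X : Ω → ι → ℝ) : ℝ := ∫ ω, X ω ⬝ᵥ (T *ᵥ X ω) ∂P

omit [IsProbabilityMeasure P] in
theorem qform_congr (T : Matrix ι ι ℝ) {X Y : Ω → ι → ℝ} (h : X =ᵐ[P] Y) :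
    qform P T X = qform P T Y :=
  integral_congr_ae (h.mono fun ω hω => by simp only [hω])

omit [IsProbabilityMeasure P] in
theorem qform_nonneg {T : Matrix ι ι ℝ} (hT : T.PosSemidef) (X : Ω → ι → ℝ) : 0 ≤ qform P T X :=
  integral_nonneg fun ω => quad_nonneg hT _

omit [IsProbabilityMeasure P] in
theorem qform_mulVec (T : Matrix ι ι ℝ) (M : Matrix ι κ ℝ) (X : Ω → κ → ℝ) :
    qform P T (fun ω => M *ᵥ X ω) = qform P (Mᵀ * T * M) X := by
  simp only [qform, mulVec_dot, mulVec_mulVec, Matrix.mul_assoc]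

theorem qform_matrix_add (T T' : Matrix ι ι ℝ) (c c' : ℝ) {X : Ω → ι → ℝ} (hX : MemLp X 2 P) :
    qform P (c • T + c' • T') X = c * qform P T X + c' * qform P T' X := by
  simp only [qform]
  rw [← integral_const_mul, ← integral_const_mul,
    ← integral_add ((integrable_quad hX hX T).const_mul c)
      ((integrable_quad hX hX T').const_mul c')]
  refine integral_congr_ae (ae_of_all _ fun ω => ?_)
  simp only [add_mulVec, dotProduct_add, smul_mulVec, dotProduct_smul, smul_eq_mul]

theorem Orth.qform_add (hm : m ≤ m0) {X Y : Ω → ι → ℝ} (h : Orth P m Y)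
    (hX : MemLp X 2 P) (hY : MemLp Y 2 P) (hXm : Measurable[m] X) (T : Matrix ι ι ℝ) :
    qform P T (fun ω => X ω + Y ω) = qform P T X + qform P T Y :=
  h.integral_quad_add hm hX hY hXm.stronglyMeasurable.aestronglyMeasurable T

theorem qform_complete_square [DecidableEq ι] [DecidableEq κ] {A Q T : Matrix ι ι ℝ}
    {B : Matrix ι κ ℝ} {R : Matrix κ κ ℝ}
    (hT : T.PosDef) (hR : R.PosDef) {X : Ω → ι → ℝ} {U : Ω → κ → ℝ} (hX : MemLp X 2 P)
    (hU : MemLp U 2 P) :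
    qform P T (fun ω => A *ᵥ X ω + B *ᵥ U ω) + qform P Q X + qform P R U =
      qform P (ric A B Q R T) X +
        qform P (Bᵀ * T * B + R) (fun ω => U ω + gain A B R T *ᵥ X ω) := by
  have h1 : MemLp (fun ω => A *ᵥ X ω) 2 P := memLp_mulVec hX _
  have h2 : MemLp (fun ω => B *ᵥ U ω) 2 P := memLp_mulVec hU _
  have h3 : MemLp (fun ω => A *ᵥ X ω + B *ᵥ U ω) 2 P := h1.add h2
  have h4 : MemLp (fun ω => gain A B R T *ᵥ X ω) 2 P := memLp_mulVec hX _
  have h5 : MemLp (fun ω => U ω + gain A B R T *ᵥ X ω) 2 P := hU.add h4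
  have i1 := integrable_quad h3 h3 T
  have i2 := integrable_quad hX hX Q
  have i3 := integrable_quad hU hU R
  have i4 := integrable_quad hX hX (ric A B Q R T)
  have i5 := integrable_quad h5 h5 (Bᵀ * T * B + R)
  have i6 : Integrable (fun ω => (A *ᵥ X ω + B *ᵥ U ω) ⬝ᵥ (T *ᵥ (A *ᵥ X ω + B *ᵥ U ω)) +
    X ω ⬝ᵥ (Q *ᵥ X ω)) P := i1.add i2
  simp only [qform]
  rw [← integral_add i1 i2, ← integral_add i6 i3, ← integral_add i4 i5]
  exact integral_congr_ae (ae_of_all _ fun ω => complete_square (transpose_eq hT.1)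
    (transpose_eq hR.1) (posDef_gram hT.posSemidef hR).isUnit _ _)

end LQ

namespace NCS

variable {n m a b : ℕ} {S : NCS n m a b} {Ω : Type} {mean : Fin n → ℝ}
  {cov : Matrix (Fin n) (Fin n) ℝ} {x0 : Ω → Fin n → ℝ}
  {v : ℕ → Ω → Fin m → ℝ} {β : ℕ → Ω → ℝ}
  {x : ℕ → Ω → Fin n → ℝ} {u : ℕ → Ω → (Fin a ⊕ Fin b) → ℝ} {ut : ℕ → Ω → Fin b → ℝ}

variable [m0 : MeasurableSpace Ω] {P : Measure Ω}

/-- The joint control including the predictable part of the embedded control. -/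
def uBar (P : Measure Ω) (β : ℕ → Ω → ℝ) (x : ℕ → Ω → Fin n → ℝ)
    (u : ℕ → Ω → (Fin a ⊕ Fin b) → ℝ) (ut : ℕ → Ω → Fin b → ℝ) (k : ℕ) (ω : Ω) :
    (Fin a ⊕ Fin b) → ℝ := u k ω + embP a b *ᵥ utPred P β x ut k ω

/-- The unpredictable part of the embedded control. -/
def utBar (P : Measure Ω) (β : ℕ → Ω → ℝ) (x : ℕ → Ω → Fin n → ℝ)
    (ut : ℕ → Ω → Fin b → ℝ) (k : ℕ) (ω : Ω) : Fin b → ℝ := ut k ω - utPred P β x ut k ω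

/-- The part of the next state that the remote controller predicts. -/
def predA (S : NCS n m a b) (P : Measure Ω) (β : ℕ → Ω → ℝ) (x : ℕ → Ω → Fin n → ℝ)
    (u : ℕ → Ω → (Fin a ⊕ Fin b) → ℝ) (ut : ℕ → Ω → Fin b → ℝ) (k : ℕ) (ω : Ω) : Fin n → ℝ :=
  S.A *ᵥ estA P β x k ω + S.B *ᵥ uBar P β x u ut k ω

/-- The part of the next state that only the embedded controller predicts. -/
def predGap (S : NCS n m a b) (P : Measure Ω) (mean : Fin n → ℝ) (cov : Matrix (Fin n) (Fin n) ℝ)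
    (x0 : Ω → Fin n → ℝ) (v : ℕ → Ω → Fin m → ℝ) (β : ℕ → Ω → ℝ) (x : ℕ → Ω → Fin n → ℝ)
    (ut : ℕ → Ω → Fin b → ℝ) (k : ℕ) (ω : Ω) : Fin n → ℝ :=
  S.A *ᵥ S.gap P mean cov x0 v β x k ω + S.BP *ᵥ utBar P β x ut k ω

/-- The innovation of the embedded estimator at time `k + 1` without a reception. -/
def errIncr (S : NCS n m a b) (mean : Fin n → ℝ) (cov : Matrix (Fin n) (Fin n) ℝ)
    (x0 : Ω → Fin n → ℝ) (v : ℕ → Ω → Fin m → ℝ) (β : ℕ → Ω → ℝ) (k : ℕ) (ω : Ω) : Fin n → ℝ :=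
  (1 - β (k + 1) ω) • (S.A *ᵥ S.err mean cov x0 v β k ω) - S.err mean cov x0 v β (k + 1) ω

section Step

variable [IsProbabilityMeasure P] (h : S.IsInput P mean cov x0 v β)
  (hA : S.IsAdmissible P x0 v β x u ut)
include h

theorem IsInput.memLp_one_sub_β_smul (k : ℕ) {r : ℕ} {X : Ω → Fin r → ℝ}
    (hX : MemLp X 2 P) : MemLp (fun ω => (1 - β k ω) • X ω) 2 P := by
  have h1 : MemLp (fun ω => X ω - β k ω • X ω) 2 P := hX.sub (h.memLp_β_smul k hX)
  simpa only [sub_smul, one_smul] using h1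

theorem IsInput.integral_one_sub_β_quad (hp1 : S.p < 1) {k r : ℕ} {X Y : Ω → Fin r → ℝ}
    (hX : MemLp X 2 P) (hY : MemLp Y 2 P) (hXm : Measurable[hist x0 v β k] X)
    (hYm : Measurable[hist x0 v β k] Y) (T : Matrix (Fin r) (Fin r) ℝ) :
    ∫ ω, ((1 - β k ω) • X ω) ⬝ᵥ (T *ᵥ ((1 - β k ω) • Y ω)) ∂P =
      S.p * ∫ ω, X ω ⬝ᵥ (T *ᵥ Y ω) ∂P := by
  have hf : Measurable fun q : (Fin r → ℝ) × (Fin r → ℝ) => q.1 ⬝ᵥ (T *ᵥ q.2) := by fun_prop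
  rw [← h.integral_one_sub_β_mul hp1 (f := fun ω => X ω ⬝ᵥ (T *ᵥ Y ω))
    (hf.comp (hXm.prodMk hYm)) (integrable_quad hX hY T)]
  refine integral_congr_ae (ae_of_all _ fun ω => ?_)
  rcases h.β_zero_or_one k ω with h0 | h1
  · simp [h0]
  · simp [h1]

/-- Since β is 0 or 1 there are no mixed terms, and β_k is independent of the history. -/
theorem IsInput.qform_mix (hp1 : S.p < 1) {k r : ℕ} {X Z : Ω → Fin r → ℝ}
    (hX : MemLp X 2 P) (hZ : MemLp Z 2 P) (hXm : Measurable[hist x0 v β k] X)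
    (hZm : Measurable[hist x0 v β k] Z) (T : Matrix (Fin r) (Fin r) ℝ) :
    qform P T (fun ω => β k ω • X ω + (1 - β k ω) • Z ω) =
      (1 - S.p) * qform P T X + S.p * qform P T Z := by
  have hf : Measurable fun q : (Fin r → ℝ) => q ⬝ᵥ (T *ᵥ q) := by fun_prop
  simp only [qform]
  rw [← h.integral_one_sub_β_mul hp1 (f := fun ω => Z ω ⬝ᵥ (T *ᵥ Z ω)) (hf.comp hZm) (integrable_quad hZ hZ T),
    ← h.integral_β_mul hp1 (f := fun ω => X ω ⬝ᵥ (T *ᵥ X ω)) (hf.comp hXm), ← integral_add]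
  · refine integral_congr_ae (ae_of_all _ fun ω => ?_)
    rcases h.β_zero_or_one k ω with h0 | h1
    · simp [h0]
    · simp [h1]
  · exact h.integrable_β_mul k (integrable_quad hX hX T)
  · have h1 := integrable_quad hZ hZ T
    have h2 : Integrable (fun ω => Z ω ⬝ᵥ (T *ᵥ Z ω) - β k ω * (Z ω ⬝ᵥ (T *ᵥ Z ω))) P :=
      h1.sub (h.integrable_β_mul k h1)
    simpa only [sub_mul, one_mul] using h2

include hA

namespace IsAdmissible

theorem memLp_uBar (k : ℕ) : MemLp (uBar P β x u ut k) 2 P :=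
  (hA.memLp_u k).add (memLp_mulVec (hA.memLp_utPred h k) _)

theorem memLp_utBar (k : ℕ) : MemLp (utBar P β x ut k) 2 P :=
  (hA.memLp_ut k).sub (hA.memLp_utPred h k)

theorem memLp_predA (k : ℕ) : MemLp (S.predA P β x u ut k) 2 P := by
  have h1 : MemLp (fun ω => S.A *ᵥ estA P β x k ω) 2 P := memLp_mulVec (hA.memLp_estA h k) _
  exact h1.add (memLp_mulVec (hA.memLp_uBar h k) _)

theorem memLp_predGap (k : ℕ) : MemLp (S.predGap P mean cov x0 v β x ut k) 2 P := by
  have h1 : MemLp (fun ω => S.A *ᵥ S.gap P mean cov x0 v β x k ω) 2 P :=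
    memLp_mulVec (hA.memLp_gap h k) _
  exact h1.add (memLp_mulVec (hA.memLp_utBar h k) _)

omit h [IsProbabilityMeasure P] in
theorem measurable_uBar (k : ℕ) : Measurable[infoA β x k] (uBar P β x u ut k) := by
  have hf : Measurable fun q : ((Fin a ⊕ Fin b) → ℝ) × (Fin b → ℝ) => q.1 + embP a b *ᵥ q.2 := by
    fun_prop
  exact hf.comp (((hA.meas_u k).mono le_sup_left le_rfl).prodMk (measurable_utPred k))

omit h [IsProbabilityMeasure P] in
theorem measurable_predA (k : ℕ) : Measurable[infoA β x k] (S.predA P β x u ut k) := by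
  have hf : Measurable fun q : (Fin n → ℝ) × ((Fin a ⊕ Fin b) → ℝ) =>
    S.A *ᵥ q.1 + S.B *ᵥ q.2 := by fun_prop
  exact hf.comp ((measurable_estA k).prodMk (hA.measurable_uBar k))

omit h [IsProbabilityMeasure P] in
theorem measurable_utBar (k : ℕ) : Measurable[S.infoG x0 v β k] (utBar P β x ut k) := by
  have hf : Measurable fun q : (Fin b → ℝ) × (Fin b → ℝ) => q.1 - q.2 := by fun_prop
  exact hf.comp (((hA.meas_ut k).mono (hA.infoP_le_infoG k) le_rfl).prodMk
    ((measurable_utPred k).mono (hA.infoA_le_infoG k) le_rfl))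

omit h [IsProbabilityMeasure P] in
theorem measurable_predGap (k : ℕ) :
    Measurable[S.infoG x0 v β k] (S.predGap P mean cov x0 v β x ut k) := by
  have hf : Measurable fun q : (Fin n → ℝ) × (Fin b → ℝ) => S.A *ᵥ q.1 + S.BP *ᵥ q.2 := by
    fun_prop
  exact hf.comp ((hA.measurable_gap k).prodMk (hA.measurable_utBar k))

theorem orth_predGap (hp1 : S.p < 1) (k : ℕ) :
    Orth P (infoA β x k) (S.predGap P mean cov x0 v β x ut k) :=
  ((hA.orth_gap h hp1 k).mulVec ((hA.memLp_gap h k).integrable one_le_two) S.A).add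
    ((hA.orth_utPred h k).mulVec ((hA.memLp_utBar h k).integrable one_le_two) S.BP)
    ((memLp_mulVec (hA.memLp_gap h k) _).integrable one_le_two)
    ((memLp_mulVec (hA.memLp_utBar h k) _).integrable one_le_two)

omit h [IsProbabilityMeasure P] in
-- The embedded control enters twice: its predictable part through B (because B · `embP` = B^P), the
-- rest through B^P. The three summands are what the remote controller predicts, what only the
-- embedded controller predicts, and the propagated error.
theorem state_succ (k : ℕ) (ω : Ω) : x (k + 1) ω = S.predA P β x u ut k ω +
    (S.predGap P mean cov x0 v β x ut k ω + S.A *ᵥ S.err mean cov x0 v β k ω) := by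
  simp only [hA.traj.2, predA, predGap, uBar, utBar, gap, mulVec_add, mulVec_sub, mulVec_mulVec,
    B_mul_embP]
  abel

omit h [IsProbabilityMeasure P] in
theorem measurable_hist_x (k : ℕ) : Measurable[hist x0 v β (k + 1)] (x (k + 1)) := by
  have hf : Measurable fun q : (Fin n → ℝ) × (Fin n → ℝ) × (Fin n → ℝ) =>
      q.1 + (q.2.1 + S.A *ᵥ q.2.2) := by fun_prop
  have h1 := (hA.measurable_predA k).mono ((hA.infoA_le_infoG k).trans (infoG_le_hist k)) le_rfl
  -- The mean and covariance used in the decomposition are arbitrary here: only the sum matters and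
  -- it does not depend on them.
  have h2 := (hA.measurable_predGap (mean := 0) (cov := 0) k).mono (infoG_le_hist k) le_rfl
  rw [funext (hA.state_succ (mean := 0) (cov := 0) k)]
  exact hf.comp (h1.prodMk (h2.prodMk (measurable_hist_err k)))

theorem orth_predGap_add_err (hp1 : S.p < 1) (k : ℕ) : Orth P (infoA β x k) fun ω =>
    S.predGap P mean cov x0 v β x ut k ω + S.A *ᵥ S.err mean cov x0 v β k ω :=
  (hA.orth_predGap h hp1 k).add
    (((h.orth_infoG_err hp1 k).mono (hA.infoA_le_infoG k)).mulVec
      ((h.memLp_err k).integrable one_le_two) S.A)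
    ((hA.memLp_predGap h k).integrable one_le_two)
    ((memLp_mulVec (h.memLp_err k) _).integrable one_le_two)

theorem memLp_predGap_add_err (k : ℕ) : MemLp (fun ω =>
    S.predGap P mean cov x0 v β x ut k ω + S.A *ᵥ S.err mean cov x0 v β k ω) 2 P :=
  (hA.memLp_predGap h k).add (memLp_mulVec (h.memLp_err k) _)

omit hA in
-- Given a loss at `k + 1`, the information of time `k + 1` reduces to that of time `k`, and the
-- loss is independent of `X`; so orthogonality survives multiplication by the loss indicator.
theorem orth_one_sub_smul (hp1 : S.p < 1) (hA' : infoA β x k ≤ hist x0 v β (k + 1))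
    (hle : infoA β x (k + 1) ≤ m0) {X : Ω → Fin n → ℝ}
    (hX : MemLp X 2 P) (hXm : Measurable[hist x0 v β (k + 1)] X) (ho : Orth P (infoA β x k) X) :
    Orth P (infoA β x (k + 1)) fun ω => (1 - β (k + 1) ω) • X ω := by
  intro C hC i
  obtain ⟨C', hC', hCC⟩ := infoA_agree k hC
  have hC'm := (hA'.trans (h.hist_le _)) C' hC'
  have hi := (hX.integrable one_le_two).eval i
  rw [← integral_indicator (hle C hC)]
  have e : ∀ ω, C.indicator (fun ω => ((1 - β (k + 1) ω) • X ω) i) ω =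
      (1 - β (k + 1) ω) * C'.indicator (fun ω => X ω i) ω := by
    intro ω
    rcases h.β_zero_or_one (k + 1) ω with h0 | h1
    · have := hCC ω h0
      by_cases hω : ω ∈ C
      · rw [Set.indicator_of_mem hω, Set.indicator_of_mem (this.1 hω)]; simp
      · rw [Set.indicator_of_notMem hω, Set.indicator_of_notMem (fun h' => hω (this.2 h'))]; simp
    · simp [h1, Set.indicator]
  rw [integral_congr_ae (ae_of_all _ e), h.integral_one_sub_β_mul hp1, integral_indicator hC'm,
    ho C' hC' i, mul_zero]
  · exact Measurable.indicator ((measurable_pi_apply i).comp hXm) (hA' C' hC')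
  · exact hi.indicator hC'm

/-- At a reception the state itself is known; at a loss the estimate is the prediction, the
remainder being orthogonal by `orth_one_sub_smul`. -/
theorem estA_succ (hp1 : S.p < 1) (k : ℕ) : estA P β x (k + 1) =ᵐ[P] fun ω =>
    β (k + 1) ω • x (k + 1) ω + (1 - β (k + 1) ω) • S.predA P β x u ut k ω := by
  symm
  have hY := hA.memLp_predGap_add_err h k
  have hZ := hA.memLp_predA h k
  have hm : MemLp (fun ω => β (k + 1) ω • x (k + 1) ω +
      (1 - β (k + 1) ω) • S.predA P β x u ut k ω) 2 P :=
    (h.memLp_β_smul (k + 1) (hA.memLp_x h (k + 1))).add (h.memLp_one_sub_β_smul (k + 1) hZ)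
  refine Orth.ae_eq_condExp (hA.infoA_le h (k + 1)) ?_ ((hA.memLp_x h (k + 1)).integrable one_le_two)
    (hm.integrable one_le_two) ?_
  · refine (orth_one_sub_smul h hp1 ((hA.infoA_le_infoG k).trans (infoG_le_hist k))
      (hA.infoA_le h (k + 1)) hY ?_ (hA.orth_predGap_add_err h hp1 k)).congr
      (ae_of_all _ fun ω => ?_)
    · have hf : Measurable fun q : (Fin n → ℝ) × (Fin n → ℝ) => q.1 + S.A *ᵥ q.2 := by fun_prop
      exact hf.comp (((hA.measurable_predGap k).mono (infoG_le_hist k) le_rfl).prodMk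
        (measurable_hist_err k))
    · simp only [Pi.sub_apply]
      rw [hA.state_succ (mean := mean) (cov := cov) k ω]
      module
  · have hf : Measurable fun q : (Fin n → ℝ) × ℝ × (Fin n → ℝ) => q.1 + (1 - q.2.1) • q.2.2 := by
      fun_prop
    exact aesm (hf.comp (((measurable_infoW_received le_rfl).mono le_sup_left le_rfl).prodMk
      ((measurable_infoA_β le_rfl).prodMk
        ((hA.measurable_predA k).mono (infoA_mono (Nat.le_succ k)) le_rfl))))

theorem gap_succ (hp1 : S.p < 1) (k : ℕ) : S.gap P mean cov x0 v β x (k + 1) =ᵐ[P] fun ω =>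
    (1 - β (k + 1) ω) • S.predGap P mean cov x0 v β x ut k ω + S.errIncr mean cov x0 v β k ω := by
  filter_upwards [hA.estA_succ h hp1 k] with ω hω
  rw [gap, hω, hA.state_succ (mean := mean) (cov := cov) k ω, errIncr]
  module

theorem memLp_errIncr (k : ℕ) : MemLp (S.errIncr mean cov x0 v β k) 2 P :=
  (h.memLp_one_sub_β_smul (k + 1) (memLp_mulVec (h.memLp_err k) _)).sub (h.memLp_err (k + 1))

/-- With probability 1 - p the estimate becomes the state and so absorbs the predicted gap and the
propagated error; this is the (1-p)P^W part of Δ. -/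
theorem qform_estA_succ (hp1 : S.p < 1) (k : ℕ) (T : Matrix (Fin n) (Fin n) ℝ) :
    qform P T (estA P β x (k + 1)) = qform P T (S.predA P β x u ut k) +
      (1 - S.p) * (qform P T (S.predGap P mean cov x0 v β x ut k) +
        qform P T fun ω => S.A *ᵥ S.err mean cov x0 v β k ω) := by
  have hZm := hA.measurable_predA k
  rw [qform_congr T (hA.estA_succ h hp1 k), h.qform_mix hp1 (hA.memLp_x h (k + 1))
    (hA.memLp_predA h k) (hA.measurable_hist_x k)
    (hZm.mono ((hA.infoA_le_infoG k).trans (infoG_le_hist k)) le_rfl),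
    qform_congr T (ae_of_all _ (hA.state_succ (mean := mean) (cov := cov) k)),
    (hA.orth_predGap_add_err h hp1 k).qform_add (hA.infoA_le h k) (hA.memLp_predA h k)
      (hA.memLp_predGap_add_err h k) hZm,
    ((h.orth_infoG_err hp1 k).mulVec ((h.memLp_err k).integrable one_le_two) S.A).qform_add
      (h.infoG_le k) (hA.memLp_predGap h k) (memLp_mulVec (h.memLp_err k) _)
      (hA.measurable_predGap k)]
  ring

/-- With probability p the predicted gap survives; this is the pP^P part of Δ. The innovation
`errIncr` is uncorrelated with it, because the old error is orthogonal to the old `infoG` and the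
new error to the new one. -/
theorem qform_gap_succ (hp1 : S.p < 1) (k : ℕ) (T : Matrix (Fin n) (Fin n) ℝ) (hT : Tᵀ = T) :
    qform P T (S.gap P mean cov x0 v β x (k + 1)) =
      S.p * qform P T (S.predGap P mean cov x0 v β x ut k) +
        qform P T (S.errIncr mean cov x0 v β k) := by
  have hY := hA.memLp_predGap h k
  have hAe : MemLp (fun ω => S.A *ᵥ S.err mean cov x0 v β k ω) 2 P := memLp_mulVec (h.memLp_err k) _
  have hYm := hA.measurable_predGap (mean := mean) (cov := cov) k
  have hY' := h.memLp_one_sub_β_smul (k + 1) hY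
  have hAe' := h.memLp_one_sub_β_smul (k + 1) hAe
  have hc : Measurable fun x : Fin n → ℝ => S.A *ᵥ x := by fun_prop
  have hf : Measurable fun q : ℝ × (Fin n → ℝ) => (1 - q.1) • q.2 := by fun_prop
  have c1 : ∫ ω, ((1 - β (k + 1) ω) • S.predGap P mean cov x0 v β x ut k ω) ⬝ᵥ
      (T *ᵥ S.errIncr mean cov x0 v β k ω) ∂P = 0 := by
    have z1 := h.integral_one_sub_β_quad hp1 hY hAe (hYm.mono (infoG_le_hist k) le_rfl)
      (hc.comp (measurable_hist_err k)) T
    rw [((h.orth_infoG_err hp1 k).mulVec ((h.memLp_err k).integrable one_le_two) S.A).integral_quad'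
      (h.infoG_le k) hAe hY (aesm hYm) T, mul_zero] at z1
    have z2 := (h.orth_infoG_err hp1 (k + 1)).integral_quad' (h.infoG_le (k + 1))
      (h.memLp_err (k + 1)) hY' (aesm (hf.comp ((measurable_infoG_β le_rfl).prodMk
        (hYm.mono (infoG_mono (Nat.le_succ k)) le_rfl)))) T
    simp only [errIncr, mulVec_sub, dotProduct_sub]
    rw [integral_sub (integrable_quad hY' hAe' T) (integrable_quad hY' (h.memLp_err (k + 1)) T)]
    rw [z1, z2, sub_zero]
  have c2 : ∫ ω, S.errIncr mean cov x0 v β k ω ⬝ᵥ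
      (T *ᵥ ((1 - β (k + 1) ω) • S.predGap P mean cov x0 v β x ut k ω)) ∂P = 0 := by
    rw [← c1]
    exact integral_congr_ae (ae_of_all _ fun ω => dot_mulVec_comm hT _ _)
  rw [qform_congr T (hA.gap_succ h hp1 k)]
  have := integral_quad_add hY' (hA.memLp_errIncr h k) T
  rw [c1, c2, h.integral_one_sub_β_quad hp1 hY hY (hYm.mono (infoG_le_hist k) le_rfl)
    (hYm.mono (infoG_le_hist k) le_rfl) T] at this
  simp only [qform]
  rw [this]; ring

theorem qform_state (hp1 : S.p < 1) (k : ℕ) (T : Matrix (Fin n) (Fin n) ℝ) :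
    qform P T (x k) = qform P T (estA P β x k) + qform P T (S.gap P mean cov x0 v β x k) +
      qform P T (S.err mean cov x0 v β k) := by
  have e : x k = fun ω => (estA P β x k ω + S.gap P mean cov x0 v β x k ω) +
      S.err mean cov x0 v β k ω := by
    ext1 ω; simp only [gap]; abel
  have hm : MemLp (fun ω => estA P β x k ω + S.gap P mean cov x0 v β x k ω) 2 P :=
    (hA.memLp_estA h k).add (hA.memLp_gap h k)
  have hf : Measurable fun q : (Fin n → ℝ) × (Fin n → ℝ) => q.1 + q.2 := by fun_prop
  have hmm : Measurable[S.infoG x0 v β k]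
      fun ω => estA P β x k ω + S.gap P mean cov x0 v β x k ω :=
    hf.comp (((measurable_estA k).mono (hA.infoA_le_infoG k) le_rfl).prodMk (hA.measurable_gap k))
  conv_lhs => rw [e]
  rw [(h.orth_infoG_err hp1 k).qform_add (h.infoG_le k) hm (h.memLp_err k) hmm,
    (hA.orth_gap h hp1 k).qform_add (hA.infoA_le h k) (hA.memLp_estA h k) (hA.memLp_gap h k)
      (measurable_estA k)]

/-- Tower property: the embedded control and its prediction from the larger σ-algebra `infoA` have
the same conditional mean given `infoW`, which is zero by admissibility. -/
theorem orth_infoW_utPred (k : ℕ) : Orth P (infoW β x k) (utPred P β x ut k) := by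
  have hle : infoW β x k ≤ m0 := le_sup_left.trans (hA.infoA_le h k)
  have h1 := orth_of_condExp_eq_zero hle ((hA.memLp_ut k).integrable one_le_two) (hA.centered_ut k)
  have h2 := (hA.orth_utPred h k).mono (m' := infoW β x k) le_sup_left
  refine (h1.sub h2 ((hA.memLp_ut k).integrable one_le_two)
    ((hA.memLp_utBar h k).integrable one_le_two)).congr (ae_of_all _ fun ω => ?_)
  simp

/-- Moving the predictable part of the embedded control into the joint control is free: it is
orthogonal to `u`, so no mixed term appears, and R restricted to the embedded block is R^P. -/
theorem qform_control (k : ℕ) : qform P S.R (u k) + qform P S.RP (ut k) =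
    qform P S.R (uBar P β x u ut k) + qform P S.RP (utBar P β x ut k) := by
  have hle : infoW β x k ≤ m0 := le_sup_left.trans (hA.infoA_le h k)
  have hc := hA.memLp_utPred h k
  have e1 : qform P S.R (uBar P β x u ut k) = _ :=
    ((hA.orth_infoW_utPred h k).mulVec (hc.integrable one_le_two) (embP a b)).qform_add hle
      (hA.memLp_u k) (memLp_mulVec hc _) (hA.meas_u k) S.R
  have e2 : ut k = fun ω => utPred P β x ut k ω + utBar P β x ut k ω := by
    ext1 ω; simp [utBar]
  have e3 : qform P S.RP (ut k) = _ :=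
    (congrArg _ e2).trans ((hA.orth_utPred h k).qform_add (hA.infoA_le h k) hc (hA.memLp_utBar h k)
      (measurable_utPred k) S.RP)
  rw [e1, e3, qform_mulVec, embP_R_embP]
  change _ = _ + qform P S.RP (fun ω => ut k ω - utPred P β x ut k ω)
  ring

end IsAdmissible

end Step

/-- The expected cost of a stage. -/
def stageCost (S : NCS n m a b) (P : Measure Ω) (x : ℕ → Ω → Fin n → ℝ)
    (u : ℕ → Ω → (Fin a ⊕ Fin b) → ℝ) (ut : ℕ → Ω → Fin b → ℝ) (k : ℕ) : ℝ :=
  qform P S.Q (x k) + qform P S.R (u k) + qform P S.RP (ut k)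

/-- The value function of the estimates. -/
def value (S : NCS n m a b) (PW PP : Matrix (Fin n) (Fin n) ℝ) (P : Measure Ω) (mean : Fin n → ℝ)
    (cov : Matrix (Fin n) (Fin n) ℝ) (x0 : Ω → Fin n → ℝ) (v : ℕ → Ω → Fin m → ℝ)
    (β : ℕ → Ω → ℝ) (x : ℕ → Ω → Fin n → ℝ) (k : ℕ) : ℝ :=
  qform P PW (estA P β x k) + qform P PP (S.gap P mean cov x0 v β x k)

/-- The control-independent part of the cost of a stage. -/
def estCost (S : NCS n m a b) (PW PP : Matrix (Fin n) (Fin n) ℝ) (P : Measure Ω) (mean : Fin n → ℝ)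
    (cov : Matrix (Fin n) (Fin n) ℝ) (x0 : Ω → Fin n → ℝ) (v : ℕ → Ω → Fin m → ℝ)
    (β : ℕ → Ω → ℝ) (k : ℕ) : ℝ :=
  (1 - S.p) * qform P PW (fun ω => S.A *ᵥ S.err mean cov x0 v β k ω) +
    qform P PP (S.errIncr mean cov x0 v β k) + qform P S.Q (S.err mean cov x0 v β k)

/-- The excess cost of a stage over the optimal feedback. -/
def excess (S : NCS n m a b) (PW PP : Matrix (Fin n) (Fin n) ℝ) (P : Measure Ω) (mean : Fin n → ℝ)
    (cov : Matrix (Fin n) (Fin n) ℝ) (x0 : Ω → Fin n → ℝ) (v : ℕ → Ω → Fin m → ℝ)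
    (β : ℕ → Ω → ℝ) (x : ℕ → Ω → Fin n → ℝ) (u : ℕ → Ω → (Fin a ⊕ Fin b) → ℝ)
    (ut : ℕ → Ω → Fin b → ℝ) (k : ℕ) : ℝ :=
  qform P (S.Gam PW) (fun ω => uBar P β x u ut k ω + ((S.Gam PW)⁻¹ * S.M PW) *ᵥ estA P β x k ω) +
  qform P (S.Om PW PP) (fun ω => utBar P β x ut k ω +
    ((S.Om PW PP)⁻¹ * S.L PW PP) *ᵥ S.gap P mean cov x0 v β x k ω)

theorem posDef_R (hRW : S.RW.PosDef) (hRP : S.RP.PosDef) : S.R.PosDef := by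
  refine PosDef.of_dotProduct_mulVec_pos ?_ fun z hz => ?_
  · rw [isHermitian_iff, R, fromBlocks_transpose, transpose_eq hRW.1, transpose_eq hRP.1]
    simp
  · obtain ⟨y, w, rfl⟩ : ∃ y w, z = Sum.elim y w := ⟨z ∘ Sum.inl, z ∘ Sum.inr, by simp⟩
    rw [R, fromBlocks_mulVec]
    simp only [star_trivial, Sum.elim_comp_inl, Sum.elim_comp_inr, zero_mulVec, add_zero, zero_add,
      sumElim_dotProduct_sumElim]
    by_cases hy : y = 0
    · have hw : w ≠ 0 := by
        rintro rfl; apply hz; rw [hy]; ext i; cases i <;> rfl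
      have := quad_pos hRP hw
      simpa [hy] using this
    · linarith [quad_pos hRW hy, quad_nonneg hRP.posSemidef w]

/-- The heart of the proof. The squares are completed separately, with weight P^W in the remote part
and with weight Δ in the gap; the Riccati equations turn the resulting weights back into P^W and
P^P. -/
theorem IsAdmissible.value_succ [IsProbabilityMeasure P] (h : S.IsInput P mean cov x0 v β)
    (hA : S.IsAdmissible P x0 v β x u ut) (hp1 : S.p < 1) (hRW : S.RW.PosDef) (hRP : S.RP.PosDef)
    {PW PP : Matrix (Fin n) (Fin n) ℝ} (hric : S.IsRiccatiSolution PW PP) (hPW : PW.PosDef)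
    (hΔ : (S.Delta PW PP).PosDef) (hPP : PPᵀ = PP) (k : ℕ) :
    S.stageCost P x u ut k + S.value PW PP P mean cov x0 v β x (k + 1) =
      S.value PW PP P mean cov x0 v β x k + S.excess PW PP P mean cov x0 v β x u ut k +
        S.estCost PW PP P mean cov x0 v β k := by
  have c1 := qform_complete_square (A := S.A) (Q := S.Q) (B := S.B) hPW (posDef_R hRW hRP)
    (hA.memLp_estA h k) (hA.memLp_uBar h k)
  have c2 := qform_complete_square (A := S.A) (Q := S.Q) (B := S.BP) hΔ hRP
    (hA.memLp_gap h k) (hA.memLp_utBar h k)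
  have r1 : ric S.A S.B S.Q S.R PW = PW := hric.1.symm
  have r2 : ric S.A S.BP S.Q S.RP (S.Delta PW PP) = PP := hric.2.symm
  rw [r1] at c1
  rw [r2] at c2
  have e1 := hA.qform_estA_succ h hp1 k PW
  have e2 := hA.qform_gap_succ h hp1 k PP hPP
  have e3 := hA.qform_state h hp1 k S.Q
  have e4 := hA.qform_control h k
  -- The contributions of the predicted gap to the next estimate and to the next gap add up to the
  -- weight Δ.
  have e5 : qform P (S.Delta PW PP) (S.predGap P mean cov x0 v β x ut k) = _ :=
    qform_matrix_add PW PP (1 - S.p) S.p (hA.memLp_predGap h k)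
  simp only [stageCost, value, excess, estCost]
  change qform P PW (S.predA P β x u ut k) + _ + _ = _ + qform P (S.Gam PW)
    (fun ω => uBar P β x u ut k ω + ((S.Gam PW)⁻¹ * S.M PW) *ᵥ estA P β x k ω) at c1
  change qform P (S.Delta PW PP) (S.predGap P mean cov x0 v β x ut k) + _ + _ =
    _ + qform P (S.Om PW PP) (fun ω => utBar P β x ut k ω +
    ((S.Om PW PP)⁻¹ * S.L PW PP) *ᵥ S.gap P mean cov x0 v β x k ω) at c2
  linarith

end NCS
end

/-! ### Summation of the identity: lower bound, attainment and stability. -/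

noncomputable section

open LQ

namespace LQ

variable {Ω : Type} {m m0 : MeasurableSpace Ω} {P : Measure Ω} [IsProbabilityMeasure P]
variable {ι κ : Type*} [Fintype ι] [Fintype κ] [DecidableEq ι]

theorem qform_one (X : Ω → ι → ℝ) : qform P 1 X = ∫ ω, X ω ⬝ᵥ X ω ∂P := by
  simp only [qform, one_mulVec]

theorem qform_le_absSum (T : Matrix ι ι ℝ) {X : Ω → ι → ℝ} (hX : MemLp X 2 P) :
    qform P T X ≤ absSum T * qform P 1 X := by
  rw [qform_one, qform, ← integral_const_mul]
  exact integral_mono (integrable_quad hX hX T) ((integrable_dot hX hX).const_mul _)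
    fun ω => quad_le_absSum T _

omit [DecidableEq ι] in
theorem qform_add_le {T : Matrix ι ι ℝ} (hT : T.PosSemidef) {X Y : Ω → ι → ℝ} (hX : MemLp X 2 P)
    (hY : MemLp Y 2 P) :
    qform P T (fun ω => X ω + Y ω) ≤ 2 * qform P T X + 2 * qform P T Y := by
  have hXY : MemLp (fun ω => X ω + Y ω) 2 P := hX.add hY
  have i1 := (integrable_quad hX hX T).const_mul 2
  have i2 := (integrable_quad hY hY T).const_mul 2
  simp only [qform]
  rw [← integral_const_mul, ← integral_const_mul, ← integral_add i1 i2]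
  exact integral_mono (integrable_quad hXY hXY T) (i1.add i2) fun ω => quad_add_le hT _ _

theorem qform_one_nonneg (X : Ω → ι → ℝ) : 0 ≤ qform P 1 X := by
  rw [qform_one]; exact integral_nonneg fun ω => dot_self_nonneg _

end LQ

namespace NCS

variable {n m a b : ℕ} {S : NCS n m a b} {Ω : Type} {mean : Fin n → ℝ}
  {cov : Matrix (Fin n) (Fin n) ℝ} {x0 : Ω → Fin n → ℝ}
  {v : ℕ → Ω → Fin m → ℝ} {β : ℕ → Ω → ℝ}
  {x : ℕ → Ω → Fin n → ℝ} {u : ℕ → Ω → (Fin a ⊕ Fin b) → ℝ} {ut : ℕ → Ω → Fin b → ℝ}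
  {PW PP : Matrix (Fin n) (Fin n) ℝ}

/-- P^P is the Riccati operator applied to Δ > 0, so its positivity need not be assumed. -/
theorem IsRiccatiSolution.posSemidef (hric : S.IsRiccatiSolution PW PP)
    (hΔ : (S.Delta PW PP).PosDef) (hRP : S.RP.PosDef) (hQ : S.Q.PosSemidef) : PP.PosSemidef := by
  have r2 : PP = ric S.A S.BP S.Q S.RP (S.Delta PW PP) := hric.2
  rw [r2]
  exact posSemidef_ric hΔ.posSemidef hRP hQ

theorem posDef_Gam (hRW : S.RW.PosDef) (hRP : S.RP.PosDef) (hPW : PW.PosDef) :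
    (S.Gam PW).PosDef := posDef_gram hPW.posSemidef (posDef_R hRW hRP)

theorem posDef_Om (hRP : S.RP.PosDef) (hΔ : (S.Delta PW PP).PosDef) :
    (S.Om PW PP).PosDef := posDef_gram hΔ.posSemidef hRP

variable [m0 : MeasurableSpace Ω] {P : Measure Ω} [IsProbabilityMeasure P]

namespace IsInput

theorem qform_tau_smul (h : S.IsInput P mean cov x0 v β) (hp1 : S.p < 1) (k : ℕ) {r : ℕ}
    {X : Ω → Fin r → ℝ} (hX : MemLp X 2 P) (hXm : Measurable[hist x0 v β 0] X)
    (T : Matrix (Fin r) (Fin r) ℝ) :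
    qform P T (fun ω => tau β k ω • X ω) = S.p ^ k * qform P T X := by
  have hf : Measurable fun q : Fin r → ℝ => q ⬝ᵥ (T *ᵥ q) := by fun_prop
  simp only [qform]
  rw [← h.integral_tau_mul hp1 k (f := fun ω => X ω ⬝ᵥ (T *ᵥ X ω)) (hf.comp hXm)
    (integrable_quad hX hX T)]
  refine integral_congr_ae (ae_of_all _ fun ω => ?_)
  rcases h.tau_zero_or_one k ω with h0 | h1
  · simp [h0]
  · simp [h1]

theorem qform_err (h : S.IsInput P mean cov x0 v β) (hp1 : S.p < 1) (k : ℕ)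
    (T : Matrix (Fin n) (Fin n) ℝ) : qform P T (S.err mean cov x0 v β k) =
      S.p ^ (k + 1) * qform P T (S.filtErr mean cov x0 v k) :=
  h.qform_tau_smul hp1 (k + 1) (h.memLp_filtErr k) (measurable_hist_filtErr k) T

omit [IsProbabilityMeasure P] in
theorem estCost_nonneg (hp1 : S.p < 1) (hQ : S.Q.PosSemidef)
    (hPW : PW.PosSemidef) (hPP : PP.PosSemidef) (k : ℕ) :
    0 ≤ S.estCost PW PP P mean cov x0 v β k := by
  have h1 := qform_nonneg (P := P) hPW (fun ω => S.A *ᵥ S.err mean cov x0 v β k ω)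
  have h2 := qform_nonneg (P := P) hPP (S.errIncr mean cov x0 v β k)
  have h3 := qform_nonneg (P := P) hQ (S.err mean cov x0 v β k)
  have h4 : 0 < 1 - S.p := by linarith
  unfold estCost
  positivity

/-- The error at time `k` has second moment p^(k+1) times a bounded Kalman covariance, which gives a
geometric majorant. -/
theorem summable_estCost (h : S.IsInput P mean cov x0 v β) (hp0 : 0 ≤ S.p) (hp1 : S.p < 1)
    (hdet : IsDetectablePair S.A S.H) (hQ : S.Q.PosSemidef)
    (hPW : PW.PosSemidef) (hPP : PP.PosSemidef) :
    Summable (S.estCost PW PP P mean cov x0 v β) := by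
  obtain ⟨c, hc, hcb⟩ := h.exists_bound_filtErr hdet
  have herr : ∀ k, qform P 1 (S.err mean cov x0 v β k) ≤ c * S.p ^ (k + 1) := by
    intro k
    rw [h.qform_err hp1, qform_one, mul_comm]
    exact mul_le_mul_of_nonneg_right (hcb k) (pow_nonneg hp0 _)
  have hTerr : ∀ (T : Matrix (Fin n) (Fin n) ℝ) k,
      qform P T (S.err mean cov x0 v β k) ≤ absSum T * (c * S.p ^ (k + 1)) := fun T k =>
    (qform_le_absSum T (h.memLp_err k)).trans
      (mul_le_mul_of_nonneg_left (herr k) (absSum_nonneg T))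
  have hpp : ∀ k, S.p ^ (k + 2) ≤ S.p ^ (k + 1) := fun k =>
    pow_le_pow_of_le_one hp0 hp1.le (Nat.le_succ _)
  set T1 := S.Aᵀ * PW * S.A
  set T2 := S.Aᵀ * PP * S.A
  have hT2 : T2.PosSemidef := by
    simpa [conjTranspose_eq_transpose_of_trivial] using hPP.conjTranspose_mul_mul_same S.A
  have hT1 : T1.PosSemidef := by
    simpa [conjTranspose_eq_transpose_of_trivial] using hPW.conjTranspose_mul_mul_same S.A
  have hb : ∀ k, S.estCost PW PP P mean cov x0 v β k ≤
      (absSum T1 + (2 * absSum T2 + 2 * absSum PP) + absSum S.Q) * c * S.p * S.p ^ k := by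
    intro k
    have hAe : MemLp (fun ω => S.A *ᵥ S.err mean cov x0 v β k ω) 2 P :=
      memLp_mulVec (h.memLp_err k) _
    have hneg : MemLp (fun ω => -S.err mean cov x0 v β (k + 1) ω) 2 P := (h.memLp_err (k + 1)).neg
    have e1 : qform P PW (fun ω => S.A *ᵥ S.err mean cov x0 v β k ω) =
        qform P T1 (S.err mean cov x0 v β k) := qform_mulVec _ _ _
    have e2 : qform P PP (S.errIncr mean cov x0 v β k) ≤
        2 * qform P T2 (S.err mean cov x0 v β k) + 2 * qform P PP (S.err mean cov x0 v β (k + 1)) := by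
      have e3 := qform_add_le hPP (h.memLp_one_sub_β_smul (k + 1) hAe) hneg
      have e4 : qform P PP (fun ω => -S.err mean cov x0 v β (k + 1) ω) =
          qform P PP (S.err mean cov x0 v β (k + 1)) := by simp [qform, mulVec_neg]
      have e5 : qform P PP (fun ω => (1 - β (k + 1) ω) • S.A *ᵥ S.err mean cov x0 v β k ω) ≤
          qform P T2 (S.err mean cov x0 v β k) := by
        rw [← qform_mulVec]
        refine integral_mono (integrable_quad (h.memLp_one_sub_β_smul (k + 1) hAe)
          (h.memLp_one_sub_β_smul (k + 1) hAe) _) (integrable_quad hAe hAe _) fun ω => ?_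
        rcases h.β_zero_or_one (k + 1) ω with h0 | h1
        · simp [h0]
        · simpa only [h1, sub_self, zero_smul, mulVec_zero, dotProduct_zero] using quad_nonneg hPP _
      simp only [← sub_eq_add_neg] at e3
      rw [e4] at e3
      exact e3.trans (by linarith)
    have f1 := hTerr T1 k
    have f2 := hTerr T2 k
    have f3 := hTerr PP (k + 1)
    have f4 := hTerr S.Q k
    have f5 : absSum PP * (c * S.p ^ (k + 1 + 1)) ≤ absSum PP * (c * S.p ^ (k + 1)) :=
      mul_le_mul_of_nonneg_left (mul_le_mul_of_nonneg_left (hpp k) hc) (absSum_nonneg _)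
    have f6 := qform_nonneg (P := P) hT1 (S.err mean cov x0 v β k)
    have f7 : (1 - S.p) * qform P T1 (S.err mean cov x0 v β k) ≤
        qform P T1 (S.err mean cov x0 v β k) := by nlinarith
    rw [estCost, e1]
    have : (absSum T1 + (2 * absSum T2 + 2 * absSum PP) + absSum S.Q) * c * S.p * S.p ^ k =
        absSum T1 * (c * S.p ^ (k + 1)) + (2 * (absSum T2 * (c * S.p ^ (k + 1))) +
          2 * (absSum PP * (c * S.p ^ (k + 1)))) + absSum S.Q * (c * S.p ^ (k + 1)) := by ring
    rw [this]
    linarith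
  exact Summable.of_nonneg_of_le (fun k => estCost_nonneg hp1 hQ hPW hPP k) hb
    ((summable_geometric_of_lt_one hp0 hp1).mul_left _)

end IsInput

section Cost

variable (h : S.IsInput P mean cov x0 v β) (hA : S.IsAdmissible P x0 v β x u ut)
include h hA

namespace IsAdmissible

theorem integrable_stage (k : ℕ) : Integrable (fun ω => x k ω ⬝ᵥ (S.Q *ᵥ x k ω) +
    u k ω ⬝ᵥ (S.R *ᵥ u k ω) + ut k ω ⬝ᵥ (S.RP *ᵥ ut k ω)) P := by
  have hx := hA.memLp_x h k
  exact ((integrable_quad hx hx _).add (integrable_quad (hA.memLp_u k) (hA.memLp_u k) _)).add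
    (integrable_quad (hA.memLp_ut k) (hA.memLp_ut k) _)

theorem integral_stage (k : ℕ) : ∫ ω, (x k ω ⬝ᵥ (S.Q *ᵥ x k ω) +
    u k ω ⬝ᵥ (S.R *ᵥ u k ω) + ut k ω ⬝ᵥ (S.RP *ᵥ ut k ω)) ∂P = S.stageCost P x u ut k := by
  have hx := hA.memLp_x h k
  have i1 := integrable_quad hx hx S.Q
  have i2 := integrable_quad (hA.memLp_u k) (hA.memLp_u k) S.R
  have i3 := integrable_quad (hA.memLp_ut k) (hA.memLp_ut k) S.RP
  have i4 : Integrable (fun ω => x k ω ⬝ᵥ (S.Q *ᵥ x k ω) + u k ω ⬝ᵥ (S.R *ᵥ u k ω)) P := i1.add i2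
  rw [integral_add i4 i3, integral_add i1 i2]; rfl

theorem cost_eq_tsum (hQ : S.Q.PosSemidef) (hRW : S.RW.PosDef) (hRP : S.RP.PosDef) :
    S.cost P x u ut = ∑' k, ENNReal.ofReal (S.stageCost P x u ut k) := by
  have hR := posDef_R hRW hRP
  rw [cost, lintegral_tsum]
  · refine tsum_congr fun k => ?_
    rw [← hA.integral_stage h k, ofReal_integral_eq_lintegral_ofReal (hA.integrable_stage h k)]
    exact ae_of_all _ fun ω => add_nonneg (add_nonneg (quad_nonneg hQ _)
      (quad_nonneg hR.posSemidef _)) (quad_nonneg hRP.posSemidef _)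
  · intro k
    exact (hA.integrable_stage h k).1.aemeasurable.ennreal_ofReal

omit h hA [IsProbabilityMeasure P] in
theorem _root_.NCS.stageCost_nonneg (hQ : S.Q.PosSemidef) (hRW : S.RW.PosDef) (hRP : S.RP.PosDef)
    (k : ℕ) : 0 ≤ S.stageCost P x u ut k :=
  add_nonneg (add_nonneg (qform_nonneg hQ _) (qform_nonneg (posDef_R hRW hRP).posSemidef _))
    (qform_nonneg hRP.posSemidef _)

omit h hA [IsProbabilityMeasure P] in
theorem _root_.NCS.excess_nonneg (hRW : S.RW.PosDef) (hRP : S.RP.PosDef) (hPW : PW.PosDef)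
    (hΔ : (S.Delta PW PP).PosDef) (k : ℕ) :
    0 ≤ S.excess PW PP P mean cov x0 v β x u ut k :=
  add_nonneg (qform_nonneg (posDef_Gam hRW hRP hPW).posSemidef _)
    (qform_nonneg (posDef_Om hRP hΔ).posSemidef _)

/-- Finite cost forces the state to vanish in mean square. -/
theorem tendsto_qform_state {Qhalf : Matrix (Fin n) (Fin n) ℝ} (hQhalf : Qhalf.PosSemidef)
    (hQhalf_sq : Qhalf * Qhalf = S.Q) (hobs : IsObservablePair S.A Qhalf) (hRW : S.RW.PosDef)
    (hRP : S.RP.PosDef) (hs : Summable (S.stageCost P x u ut)) :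
    Tendsto (fun k => qform P 1 (x k)) atTop (𝓝 0) := by
  obtain ⟨N, c, hc, hb⟩ := exists_state_bound hobs
  have hR := posDef_R hRW hRP
  obtain ⟨c1, hc1, hb1⟩ := exists_posDef_bound hR
  obtain ⟨c2, hc2, hb2⟩ := exists_posDef_bound hRP
  set d1 := 2 * (absSum (S.Bᵀ * S.B) * c1) with hd1
  set d2 := 2 * (absSum (S.BPᵀ * S.BP) * c2) with hd2
  have hd1' : 0 ≤ d1 := by have := absSum_nonneg (S.Bᵀ * S.B); positivity
  have hd2' : 0 ≤ d2 := by have := absSum_nonneg (S.BPᵀ * S.BP); positivity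
  -- Output, joint control and embedded control need the factors 1, `d1` and `d2`; the sum serves
  -- all three.
  set D := 1 + d1 + d2 with hD
  have hpt : ∀ k ω, x k ω ⬝ᵥ x k ω ≤ ∑ j ∈ Finset.range N, c * D *
      (x (k + j) ω ⬝ᵥ (S.Q *ᵥ x (k + j) ω) + u (k + j) ω ⬝ᵥ (S.R *ᵥ u (k + j) ω) +
        ut (k + j) ω ⬝ᵥ (S.RP *ᵥ ut (k + j) ω)) := by
    intro k ω
    have h1 := hb (fun j => x (k + j) ω) (fun j => S.B *ᵥ u (k + j) ω + S.BP *ᵥ ut (k + j) ω)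
      (fun j => by
        have := hA.traj.2 (k + j) ω
        simp only [← add_assoc] at this ⊢
        exact this)
    refine h1.trans ?_
    rw [← Finset.mul_sum, mul_assoc c D]
    refine mul_le_mul_of_nonneg_left ?_ hc
    rw [Finset.mul_sum]
    refine Finset.sum_le_sum fun j _ => ?_
    have e1 : (Qhalf *ᵥ x (k + j) ω) ⬝ᵥ (Qhalf *ᵥ x (k + j) ω) =
        x (k + j) ω ⬝ᵥ (S.Q *ᵥ x (k + j) ω) := by
      rw [← quad_mul_self hQhalf, hQhalf_sq]
    have e2 := dot_add_self_le (S.B *ᵥ u (k + j) ω) (S.BP *ᵥ ut (k + j) ω)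
    have e3 := mulVec_dot_self_le S.B (u (k + j) ω)
    have e4 := mulVec_dot_self_le S.BP (ut (k + j) ω)
    have e5 := mul_le_mul_of_nonneg_left (hb1 (u (k + j) ω)) (absSum_nonneg (S.Bᵀ * S.B))
    have e6 := mul_le_mul_of_nonneg_left (hb2 (ut (k + j) ω)) (absSum_nonneg (S.BPᵀ * S.BP))
    have q1 : 0 ≤ x (k + j) ω ⬝ᵥ (S.Q *ᵥ x (k + j) ω) := by rw [← e1]; exact dot_self_nonneg _
    have q2 := quad_nonneg hR.posSemidef (u (k + j) ω)
    have q3 := quad_nonneg hRP.posSemidef (ut (k + j) ω)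
    rw [e1]
    set qx := x (k + j) ω ⬝ᵥ (S.Q *ᵥ x (k + j) ω)
    set qu := u (k + j) ω ⬝ᵥ (S.R *ᵥ u (k + j) ω)
    set qt := ut (k + j) ω ⬝ᵥ (S.RP *ᵥ ut (k + j) ω)
    have f1 : D * (qx + qu + qt) = qx + d1 * qu + d2 * qt + ((d1 + d2) * qx + (1 + d2) * qu
      + (1 + d1) * qt) := by rw [hD]; ring
    have f2 : 0 ≤ (d1 + d2) * qx + (1 + d2) * qu + (1 + d1) * qt := by positivity
    rw [f1]
    have g1 : d1 * qu = 2 * (absSum (S.Bᵀ * S.B) * (c1 * qu)) := by rw [hd1]; ring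
    have g2 : d2 * qt = 2 * (absSum (S.BPᵀ * S.BP) * (c2 * qt)) := by rw [hd2]; ring
    linarith
  have hint : ∀ k, qform P 1 (x k) ≤ ∑ j ∈ Finset.range N, c * D * S.stageCost P x u ut (k + j) := by
    intro k
    have e : ∑ j ∈ Finset.range N, c * D * S.stageCost P x u ut (k + j) =
        ∫ ω, ∑ j ∈ Finset.range N, c * D *
      (x (k + j) ω ⬝ᵥ (S.Q *ᵥ x (k + j) ω) + u (k + j) ω ⬝ᵥ (S.R *ᵥ u (k + j) ω) +
        ut (k + j) ω ⬝ᵥ (S.RP *ᵥ ut (k + j) ω)) ∂P := by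
      rw [integral_finsetSum _ fun j _ => (hA.integrable_stage h (k + j)).const_mul _]
      refine Finset.sum_congr rfl fun j _ => ?_
      rw [integral_const_mul, hA.integral_stage h]
    rw [e, qform_one]
    exact integral_mono (integrable_dot (hA.memLp_x h k) (hA.memLp_x h k))
      (integrable_finsetSum _ fun j _ => (hA.integrable_stage h (k + j)).const_mul _) (hpt k)
  have hlim : Tendsto (fun k => ∑ j ∈ Finset.range N, c * D * S.stageCost P x u ut (k + j)) atTop
      (𝓝 (∑ j ∈ Finset.range N, c * D * 0)) :=
    tendsto_finsetSum _ fun j _ => (((tendsto_add_atTop_iff_nat j).2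
      hs.tendsto_atTop_zero)).const_mul _
  simp only [mul_zero, Finset.sum_const_zero] at hlim
  exact squeeze_zero (fun k => qform_one_nonneg _) hint hlim

/-- By Pythagoras with the identity weight, the second moments of the estimate and of the gap are at
most that of the state. -/
theorem tendsto_value (hp1 : S.p < 1) (hPW : PW.PosSemidef) (hPP : PP.PosSemidef)
    (hx : Tendsto (fun k => qform P 1 (x k)) atTop (𝓝 0)) :
    Tendsto (S.value PW PP P mean cov x0 v β x) atTop (𝓝 0) := by
  refine squeeze_zero (fun k => add_nonneg (qform_nonneg hPW _) (qform_nonneg hPP _))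
    (g := fun k => (absSum PW + absSum PP) * qform P 1 (x k)) (fun k => ?_) ?_
  · have e := hA.qform_state h hp1 k 1
    have e1 := qform_le_absSum PW (hA.memLp_estA h k)
    have e2 := qform_le_absSum PP (hA.memLp_gap h k)
    have n1 := qform_one_nonneg (P := P) (estA P β x k)
    have n2 := qform_one_nonneg (P := P) (S.gap P mean cov x0 v β x k)
    have n3 := qform_one_nonneg (P := P) (S.err mean cov x0 v β k)
    have e3 : absSum PW * qform P 1 (estA P β x k) ≤ absSum PW * qform P 1 (x k) :=
      mul_le_mul_of_nonneg_left (by linarith) (absSum_nonneg _)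
    have e4 : absSum PP * qform P 1 (S.gap P mean cov x0 v β x k) ≤
        absSum PP * qform P 1 (x k) :=
      mul_le_mul_of_nonneg_left (by linarith) (absSum_nonneg _)
    rw [value, add_mul]
    linarith
  · simpa using hx.const_mul (absSum PW + absSum PP)

theorem sum_stageCost (hp1 : S.p < 1) (hRW : S.RW.PosDef) (hRP : S.RP.PosDef)
    (hric : S.IsRiccatiSolution PW PP) (hPW : PW.PosDef)
    (hΔ : (S.Delta PW PP).PosDef) (hPP : PPᵀ = PP) (N : ℕ) :
    ∑ k ∈ Finset.range N, S.stageCost P x u ut k + S.value PW PP P mean cov x0 v β x N =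
      S.value PW PP P mean cov x0 v β x 0 +
        ∑ k ∈ Finset.range N, S.excess PW PP P mean cov x0 v β x u ut k +
        ∑ k ∈ Finset.range N, S.estCost PW PP P mean cov x0 v β k := by
  induction N with
  | zero => simp
  | succ N ih =>
    have := hA.value_succ h hp1 hRW hRP hric hPW hΔ hPP N
    simp only [Finset.sum_range_succ]
    linarith

/-- The value at the initial time together with the estimation cost bounds the cost below. -/
theorem le_cost (hp0 : 0 ≤ S.p) (hp1 : S.p < 1) (hRW : S.RW.PosDef) (hRP : S.RP.PosDef)
    {Qhalf : Matrix (Fin n) (Fin n) ℝ} (hQhalf : Qhalf.PosSemidef)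
    (hQhalf_sq : Qhalf * Qhalf = S.Q) (hobs : IsObservablePair S.A Qhalf)
    (hdet : IsDetectablePair S.A S.H) (hQ : S.Q.PosSemidef)
    (hric : S.IsRiccatiSolution PW PP) (hPW : PW.PosDef) (hΔ : (S.Delta PW PP).PosDef) :
    ENNReal.ofReal (S.value PW PP P mean cov x0 v β x 0 +
      ∑' k, S.estCost PW PP P mean cov x0 v β k) ≤ S.cost P x u ut := by
  have hPP := hric.posSemidef hΔ hRP hQ
  have hsum := h.summable_estCost hp0 hp1 hdet hQ hPW.posSemidef hPP
  have hst := stageCost_nonneg (P := P) (x := x) (u := u) (ut := ut) hQ hRW hRP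
  rw [hA.cost_eq_tsum h hQ hRW hRP]
  -- The bound is trivial for infinite cost; finite cost makes the stage costs summable, and only
  -- then does the terminal value vanish.
  by_cases htop : ∑' k, ENNReal.ofReal (S.stageCost P x u ut k) = ⊤
  · rw [htop]; exact le_top
  have hs : Summable (S.stageCost P x u ut) := by
    have := ENNReal.summable_toReal htop
    simpa only [ENNReal.toReal_ofReal (hst _)] using this
  rw [← ENNReal.ofReal_tsum_of_nonneg hst hs]
  refine ENNReal.ofReal_le_ofReal ?_
  have hV := hA.tendsto_value h hp1 hPW.posSemidef hPP
    (hA.tendsto_qform_state h hQhalf hQhalf_sq hobs hRW hRP hs)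
  have l1 := hs.hasSum.tendsto_sum_nat.add hV
  have l2 := (tendsto_const_nhds (x := S.value PW PP P mean cov x0 v β x 0)).add
    hsum.hasSum.tendsto_sum_nat
  rw [add_zero] at l1
  refine le_of_tendsto_of_tendsto' l2 l1 fun N => ?_
  rw [hA.sum_stageCost h hp1 hRW hRP hric hPW hΔ (transpose_eq hPP.1)]
  have := Finset.sum_nonneg fun k (_ : k ∈ Finset.range N) =>
    excess_nonneg (P := P) (mean := mean) (cov := cov) (x0 := x0) (v := v) (β := β) (x := x) (u := u)
      (ut := ut) hRW hRP hPW hΔ k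
  linarith

/-- Without excess the partial sums of the stage cost are bounded, because the terminal value is
nonnegative. Finiteness of the cost is thus a conclusion, and stability follows from it by
observability. -/
theorem cost_eq (hp0 : 0 ≤ S.p) (hp1 : S.p < 1) (hRW : S.RW.PosDef) (hRP : S.RP.PosDef)
    {Qhalf : Matrix (Fin n) (Fin n) ℝ} (hQhalf : Qhalf.PosSemidef)
    (hQhalf_sq : Qhalf * Qhalf = S.Q) (hobs : IsObservablePair S.A Qhalf)
    (hdet : IsDetectablePair S.A S.H) (hQ : S.Q.PosSemidef)
    (hric : S.IsRiccatiSolution PW PP) (hPW : PW.PosDef) (hΔ : (S.Delta PW PP).PosDef)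
    (hexc : ∀ k, S.excess PW PP P mean cov x0 v β x u ut k = 0) :
    S.cost P x u ut = ENNReal.ofReal (S.value PW PP P mean cov x0 v β x 0 +
      ∑' k, S.estCost PW PP P mean cov x0 v β k) ∧
    Tendsto (fun k => qform P 1 (x k)) atTop (𝓝 0) := by
  have hPP := hric.posSemidef hΔ hRP hQ
  have hsum := h.summable_estCost hp0 hp1 hdet hQ hPW.posSemidef hPP
  have hst := stageCost_nonneg (P := P) (x := x) (u := u) (ut := ut) hQ hRW hRP
  have hid := hA.sum_stageCost h hp1 hRW hRP hric hPW hΔ (transpose_eq hPP.1)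
  simp only [hexc, Finset.sum_const_zero, add_zero] at hid
  have hs : Summable (S.stageCost P x u ut) := by
    refine summable_of_sum_range_le hst (c := S.value PW PP P mean cov x0 v β x 0 +
      ∑' k, S.estCost PW PP P mean cov x0 v β k) fun N => ?_
    have h1 := hsum.sum_le_tsum (Finset.range N)
      fun k _ => IsInput.estCost_nonneg hp1 hQ hPW.posSemidef hPP k
    have h2 : 0 ≤ S.value PW PP P mean cov x0 v β x N :=
      add_nonneg (qform_nonneg hPW.posSemidef _) (qform_nonneg hPP _)
    have := hid N
    linarith
  have hx := hA.tendsto_qform_state h hQhalf hQhalf_sq hobs hRW hRP hs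
  refine ⟨?_, hx⟩
  have hV := hA.tendsto_value h hp1 hPW.posSemidef hPP hx
  have l1 := hs.hasSum.tendsto_sum_nat.add hV
  have l2 := (tendsto_const_nhds (x := S.value PW PP P mean cov x0 v β x 0)).add
    hsum.hasSum.tendsto_sum_nat
  rw [add_zero] at l1
  simp only [hid] at l1
  rw [hA.cost_eq_tsum h hQ hRW hRP, ← ENNReal.ofReal_tsum_of_nonneg hst hs,
    tendsto_nhds_unique l1 l2]

theorem meanSquareConverges (hx : Tendsto (fun k => qform P 1 (x k)) atTop (𝓝 0)) :
    MeanSquareConverges P x := by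
  have h1 : Tendsto (fun k => ENNReal.ofReal (qform P 1 (x k))) atTop (𝓝 (ENNReal.ofReal 0)) :=
    (ENNReal.continuous_ofReal.tendsto 0).comp hx
  rw [ENNReal.ofReal_zero] at h1
  refine h1.congr fun k => ?_
  rw [qform_one, ofReal_integral_eq_lintegral_ofReal
    (integrable_dot (hA.memLp_x h k) (hA.memLp_x h k)) (ae_of_all _ fun ω => dot_self_nonneg _)]

end IsAdmissible

omit h hA [IsProbabilityMeasure P] in
-- The initial value depends on the initial state only, so it is common to all controls being
-- compared.
theorem value_zero_congr {x' : ℕ → Ω → Fin n → ℝ} (hx : x 0 = x' 0) :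
    S.value PW PP P mean cov x0 v β x 0 = S.value PW PP P mean cov x0 v β x' 0 := by
  have e1 : infoA β x 0 = infoA β x' 0 := by simp [infoA, infoW, hx]
  have e2 : estA P β x 0 = estA P β x' 0 := by rw [estA, estA, e1, hx]
  have e3 : S.gap P mean cov x0 v β x 0 = S.gap P mean cov x0 v β x' 0 := by
    funext ω; rw [gap, gap, e2, hx]
  rw [value, value, e2, e3]

end Cost
end NCS
end

/-! ### The closed loop before the first reception. -/

noncomputable section

open LQ

namespace LQ

/-- A real Gaussian law with an atom is a point mass. If X vanishes with positive probability, every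
coordinate has an atom at 0 and is therefore almost surely 0. -/
theorem ae_eq_zero_of_hasGaussianLaw {Ω : Type} [MeasurableSpace Ω] {P : Measure Ω}
    [IsProbabilityMeasure P] {r : ℕ} {X : Ω → Fin r → ℝ} (hX : HasGaussianLaw X P)
    (h0 : ¬ ∀ᵐ ω ∂P, X ω ≠ 0) : X =ᵐ[P] 0 := by
  have hi : ∀ i, ∀ᵐ ω ∂P, X ω i = 0 := by
    intro i
    have hg : HasGaussianLaw (fun ω => X ω i) P :=
      hX.map_fun (ContinuousLinearMap.proj (R := ℝ) (φ := fun _ : Fin r => ℝ) i)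
    have hm := hg.aemeasurable
    have hlaw := hg.map_eq_gaussianReal
    set μ := ∫ ω, X ω i ∂P
    set V := Var[fun ω => X ω i; P].toNNReal
    have hs : MeasurableSet {y : ℝ | y ≠ 0} := (measurableSet_singleton (0 : ℝ)).compl
    have hne : ¬ ∀ᵐ y ∂(P.map fun ω => X ω i), y ≠ 0 := by
      rw [ae_map_iff hm hs]
      exact fun hc => h0 (hc.mono fun ω hω hz => hω (by rw [hz]; rfl))
    rw [hlaw] at hne
    have hV : V = 0 := by
      by_contra hV
      have := nullSingletonClass_gaussianReal (μ := μ) hV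
      exact hne (Measure.ae_ne _ 0)
    have hd : (P.map fun ω => X ω i) = Measure.dirac μ := by
      rw [hlaw, hV, gaussianReal_zero_var]
    rw [hV, gaussianReal_zero_var, ae_dirac_iff hs] at hne
    have hμ : μ = 0 := not_not.1 hne
    have h1 : ∀ᵐ y ∂(P.map fun ω => X ω i), y = 0 := by
      rw [hd]; exact (ae_dirac_iff (measurableSet_singleton (0 : ℝ))).2 hμ
    exact ae_of_ae_map hm h1
  filter_upwards [ae_all_iff.2 hi] with ω hω
  exact funext hω

/-- A vector that is orthogonal to the information and also known from it is orthogonal to itself.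
-/
theorem Orth.ae_eq_zero {Ω : Type} {m m0 : MeasurableSpace Ω} {P : Measure Ω}
    [IsProbabilityMeasure P] (hm : m ≤ m0) {r : ℕ} {X Y : Ω → Fin r → ℝ} (h : Orth P m X)
    (hX : MemLp X 2 P) (hY : Measurable[m] Y) (hXY : X =ᵐ[P] Y) : X =ᵐ[P] 0 := by
  have hY2 : MemLp Y 2 P := hX.ae_eq hXY
  have h1 := h.integral_quad hm hX hY2 hY.stronglyMeasurable.aestronglyMeasurable
    (1 : Matrix (Fin r) (Fin r) ℝ)
  have h2 : ∫ ω, X ω ⬝ᵥ X ω ∂P = 0 := by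
    rw [← h1]
    exact integral_congr_ae (hXY.mono fun ω hω => by simp only [one_mulVec]; rw [← hω])
  rw [integral_eq_zero_iff_of_nonneg (fun ω => dot_self_nonneg _) (integrable_dot hX hX)] at h2
  exact h2.mono fun ω hω => dotProduct_self_eq_zero.1 hω

end LQ

namespace NCS

variable {n m a b : ℕ} {S : NCS n m a b} {Ω : Type} {mean : Fin n → ℝ}
  {cov : Matrix (Fin n) (Fin n) ℝ} {x0 : Ω → Fin n → ℝ}
  {v : ℕ → Ω → Fin m → ℝ} {β : ℕ → Ω → ℝ}
  {x : ℕ → Ω → Fin n → ℝ} {u : ℕ → Ω → (Fin a ⊕ Fin b) → ℝ} {ut : ℕ → Ω → Fin b → ℝ}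
  {LW : Matrix (Fin a ⊕ Fin b) (Fin n) ℝ} {LP : Matrix (Fin b) (Fin n) ℝ}

/-- The mean of the closed-loop state as long as no packet is received. -/
def lossMean (S : NCS n m a b) (LW : Matrix (Fin a ⊕ Fin b) (Fin n) ℝ) (mean : Fin n → ℝ) (k : ℕ) :
    Fin n → ℝ := ((S.A + S.B * LW) ^ k) *ᵥ mean

/-- The closed-loop state as long as no packet is received. -/
def lossState (S : NCS n m a b) (LW : Matrix (Fin a ⊕ Fin b) (Fin n) ℝ)
    (LP : Matrix (Fin b) (Fin n) ℝ) (mean : Fin n → ℝ)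
    (cov : Matrix (Fin n) (Fin n) ℝ) (x0 : Ω → Fin n → ℝ) (v : ℕ → Ω → Fin m → ℝ) :
    ℕ → Ω → Fin n → ℝ
  | 0 => x0
  | k + 1 => fun ω => S.A *ᵥ lossState S LW LP mean cov x0 v k ω +
      S.B *ᵥ (LW *ᵥ S.lossMean LW mean k) +
      S.BP *ᵥ (LP *ᵥ (lossState S LW LP mean cov x0 v k ω - S.filtErr mean cov x0 v k ω -
        S.lossMean LW mean k))

theorem lossMean_succ (k : ℕ) : S.lossMean LW mean (k + 1) =
    S.A *ᵥ S.lossMean LW mean k + S.B *ᵥ (LW *ᵥ S.lossMean LW mean k) := by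
  simp only [lossMean, mulVec_mulVec, pow_succ', ← add_mulVec, Matrix.add_mul, Matrix.mul_assoc]

theorem isAffine_lossState {k K : ℕ} (hk : k ≤ K) :
    IsAffine x0 v K (S.lossState LW LP mean cov x0 v k) := by
  induction k with
  | zero => exact IsAffine.initial
  | succ k ih =>
    have h1 := ih (by omega)
    have h2 : IsAffine x0 v K (S.filtErr mean cov x0 v k) := IsAffine.filtErr (by omega)
    exact ((h1.mulVec _).add (IsAffine.const _)).add
      ((((h1.sub h2).sub (IsAffine.const _)).mulVec _).mulVec _)

/-- The loss-only state differs from the uncontrolled one by a function of the measurements, and the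
filtering error differs from the uncontrolled state by the filter. -/
theorem measurable_lossState_sub (k : ℕ) : Measurable[S.infoF x0 v k]
    (fun ω => S.lossState LW LP mean cov x0 v k ω - S.filtErr mean cov x0 v k ω) := by
  have key : ∀ k, Measurable[S.infoF x0 v k]
      (fun ω => S.lossState LW LP mean cov x0 v k ω - (S.A ^ k) *ᵥ x0 ω) := by
    intro k
    induction k with
    | zero =>
      have : (fun ω => S.lossState LW LP mean cov x0 v 0 ω - (S.A ^ 0) *ᵥ x0 ω) = fun _ => 0 := by
        funext ω; simp [lossState]
      rw [this]; exact measurable_const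
    | succ k ih =>
      have e : (fun ω => S.lossState LW LP mean cov x0 v (k + 1) ω - (S.A ^ (k + 1)) *ᵥ x0 ω) =
          fun ω => S.A *ᵥ (S.lossState LW LP mean cov x0 v k ω - (S.A ^ k) *ᵥ x0 ω) +
            S.B *ᵥ (LW *ᵥ S.lossMean LW mean k) + S.BP *ᵥ (LP *ᵥ
            ((S.lossState LW LP mean cov x0 v k ω - (S.A ^ k) *ᵥ x0 ω) +
              S.freeFilt mean cov x0 v k ω - S.lossMean LW mean k)) := by
        funext ω
        have : S.lossState LW LP mean cov x0 v k ω - S.filtErr mean cov x0 v k ω =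
          (S.lossState LW LP mean cov x0 v k ω - (S.A ^ k) *ᵥ x0 ω) +
              S.freeFilt mean cov x0 v k ω := by simp only [filtErr]; abel
        simp only [lossState]
        rw [this, mulVec_sub S.A, mulVec_mulVec (x0 ω), pow_succ']
        abel
      rw [e]
      have hf : Measurable fun q : (Fin n → ℝ) × (Fin n → ℝ) => S.A *ᵥ q.1 +
            S.B *ᵥ (LW *ᵥ S.lossMean LW mean k) + S.BP *ᵥ (LP *ᵥ (q.1 + q.2 - S.lossMean LW mean k)) := by
        fun_prop
      exact (hf.comp (ih.prodMk (measurable_infoF_freePred k).2)).mono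
        (infoF_mono (Nat.le_succ k)) le_rfl
  have e : (fun ω => S.lossState LW LP mean cov x0 v k ω - S.filtErr mean cov x0 v k ω) =
      fun ω => (S.lossState LW LP mean cov x0 v k ω - (S.A ^ k) *ᵥ x0 ω) +
        S.freeFilt mean cov x0 v k ω := by
    funext ω; simp only [filtErr]; abel
  rw [e]
  have hf : Measurable fun q : (Fin n → ℝ) × (Fin n → ℝ) => q.1 + q.2 := by fun_prop
  exact hf.comp ((key k).prodMk (measurable_infoF_freePred k).2)

variable [m0 : MeasurableSpace Ω] {P : Measure Ω} [IsProbabilityMeasure P]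

namespace IsInput

variable (h : S.IsInput P mean cov x0 v β)
include h

theorem hasGaussianLaw_lossState (k : ℕ) :
    HasGaussianLaw (S.lossState LW LP mean cov x0 v k) P := by
  obtain ⟨l, c, hl⟩ := isAffine_lossState (S := S) (LW := LW) (LP := LP) (mean := mean) (cov := cov)
    (x0 := x0) (v := v) (le_refl k)
  have h1 := (h.hasGaussianLaw_joint k).map_fun l
  have e : S.lossState LW LP mean cov x0 v k =
      fun ω => l (x0 ω, fun j : Fin (k + 1) => v j ω) + c := funext hl
  rw [e]
  refine ⟨?_⟩
  have := h1.isGaussian_map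
  rw [← Function.comp_def (fun y : Fin n → ℝ => y + c),
    ← AEMeasurable.map_map_of_aemeasurable (by fun_prop) h1.aemeasurable]
  infer_instance

theorem memLp_lossState (k : ℕ) : MemLp (S.lossState LW LP mean cov x0 v k) 2 P :=
  (h.hasGaussianLaw_lossState k).memLp_two

theorem integral_lossState (k : ℕ) :
    ∫ ω, S.lossState LW LP mean cov x0 v k ω ∂P = S.lossMean LW mean k := by
  induction k with
  | zero =>
    ext i
    rw [eval_integral fun j => (((h.memLp_lossState 0).integrable one_le_two).eval j)]
    simpa [lossState, lossMean] using h.gaussian_x0.integral_apply i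
  | succ k ih =>
    have i1 := (h.memLp_lossState (LW := LW) (LP := LP) k).integrable one_le_two
    have i2 := (h.memLp_filtErr k).integrable one_le_two
    have i3 : Integrable (fun ω => S.A *ᵥ S.lossState LW LP mean cov x0 v k ω) P :=
      (memLp_mulVec (h.memLp_lossState k) _).integrable one_le_two
    have i4 : Integrable (fun ω => S.A *ᵥ S.lossState LW LP mean cov x0 v k ω +
      S.B *ᵥ (LW *ᵥ S.lossMean LW mean k)) P := i3.add (integrable_const _)
    have i5 : Integrable (fun ω => S.lossState LW LP mean cov x0 v k ω -
      S.filtErr mean cov x0 v k ω) P := i1.sub i2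
    have i6 : MemLp (fun ω => S.lossState LW LP mean cov x0 v k ω -
      S.filtErr mean cov x0 v k ω - S.lossMean LW mean k) 2 P :=
      ((h.memLp_lossState k).sub (h.memLp_filtErr k)).sub (memLp_const _)
    have i7 : MemLp (fun ω => LP *ᵥ (S.lossState LW LP mean cov x0 v k ω -
      S.filtErr mean cov x0 v k ω - S.lossMean LW mean k)) 2 P := memLp_mulVec i6 _
    have hz : ∫ ω, S.filtErr mean cov x0 v k ω ∂P = 0 :=
      h.integral_filtErr_of_predErr (h.integral_predErr k)
    simp only [lossState]
    rw [integral_add i4 ((memLp_mulVec i7 _).integrable one_le_two),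
      integral_add i3 (integrable_const _), integral_mulVec i1,
      integral_mulVec (i7.integrable one_le_two), integral_mulVec (i6.integrable one_le_two),
      integral_sub i5 (integrable_const _), integral_sub i1 i2, ih, hz, lossMean_succ]
    simp

/-- If the state vanishes, the error is minus the known part of the state; being also orthogonal to
the measurements, it is zero. -/
theorem filtErr_ae_eq_zero {k : ℕ} (hk : S.lossState LW LP mean cov x0 v k =ᵐ[P] 0) :
    S.filtErr mean cov x0 v k =ᵐ[P] 0 := by
  have hm : Measurable[S.infoF x0 v k]
      (fun ω => -(S.lossState LW LP mean cov x0 v k ω - S.filtErr mean cov x0 v k ω)) := by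
    have hf : Measurable fun q : Fin n → ℝ => -q := by fun_prop
    exact hf.comp (measurable_lossState_sub k)
  refine (h.orth_infoF_filtErr k).ae_eq_zero (h.infoF_le k) (h.memLp_filtErr k) hm ?_
  filter_upwards [hk] with ω hω
  rw [hω]; simp

theorem lossMean_eq_zero {k : ℕ} (hk : S.lossState LW LP mean cov x0 v k =ᵐ[P] 0) :
    S.lossMean LW mean k = 0 := by
  rw [← h.integral_lossState (LP := LP) k, integral_congr_ae hk]; simp

/-- With state, error and mean all zero, every term of the recursion vanishes. -/
theorem lossState_ae_eq_zero {j k : ℕ} (hjk : j ≤ k)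
    (hj : S.lossState LW LP mean cov x0 v j =ᵐ[P] 0) :
    S.lossState LW LP mean cov x0 v k =ᵐ[P] 0 := by
  induction k, hjk using Nat.le_induction with
  | base => exact hj
  | succ k _ ih =>
    filter_upwards [ih, h.filtErr_ae_eq_zero ih] with ω h1 h2
    simp [lossState, h1, h2, h.lossMean_eq_zero ih]

/-- If the state can vanish before a reception, it has vanished for good, and the embedded
controller knows it. -/
theorem ae_of_lossState_eq_zero (LW : Matrix (Fin a ⊕ Fin b) (Fin n) ℝ)
    (LP : Matrix (Fin b) (Fin n) ℝ) : ∀ᵐ ω ∂P, ∀ j, S.lossState LW LP mean cov x0 v j ω = 0 →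
      S.lossMean LW mean j = 0 ∧ ∀ k, j ≤ k → S.filtErr mean cov x0 v k ω = 0 := by
  refine ae_all_iff.2 fun j => ?_
  by_cases h0 : ∀ᵐ ω ∂P, S.lossState LW LP mean cov x0 v j ω ≠ 0
  · exact h0.mono fun ω hω hz => absurd hz hω
  · have hz := ae_eq_zero_of_hasGaussianLaw (h.hasGaussianLaw_lossState j) h0
    have hall : ∀ k, ∀ᵐ ω ∂P, j ≤ k → S.filtErr mean cov x0 v k ω = 0 := by
      intro k
      by_cases hjk : j ≤ k
      · exact (h.filtErr_ae_eq_zero (h.lossState_ae_eq_zero hjk hz)).mono fun ω hω _ => hω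
      · exact ae_of_all _ fun ω hc => absurd hc hjk
    filter_upwards [ae_all_iff.2 hall] with ω hω _
    exact ⟨h.lossMean_eq_zero hz, hω⟩

end IsInput
end NCS
end

/-! ### Existence and admissibility of the feedback loop. -/

noncomputable section

open LQ

namespace NCS

variable {n m a b : ℕ} {S : NCS n m a b} {Ω : Type} {mean : Fin n → ℝ}
  {cov : Matrix (Fin n) (Fin n) ℝ} {x0 : Ω → Fin n → ℝ}
  {v : ℕ → Ω → Fin m → ℝ} {β : ℕ → Ω → ℝ}
  {x : ℕ → Ω → Fin n → ℝ} {u : ℕ → Ω → (Fin a ⊕ Fin b) → ℝ} {ut : ℕ → Ω → Fin b → ℝ}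
  {LW : Matrix (Fin a ⊕ Fin b) (Fin n) ℝ} {LP : Matrix (Fin b) (Fin n) ℝ}

theorem exists_first_reception (hβ : ∀ k ω, β k ω = 0 ∨ β k ω = 1) {k : ℕ} {ω : Ω}
    (h : tau β k ω = 0) : ∃ j < k, tau β j ω = 1 ∧ β j ω = 1 := by
  induction k with
  | zero => simp [tau_zero] at h
  | succ k ih =>
    by_cases h0 : tau β k ω = 0
    · obtain ⟨j, hj, h'⟩ := ih h0
      exact ⟨j, by omega, h'⟩
    · refine ⟨k, Nat.lt_succ_self k, ?_, ?_⟩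
      · rw [tau]
        refine Finset.prod_eq_one fun j hj => ?_
        rcases hβ j ω with hz | hz
        · rw [hz, sub_zero]
        · exact absurd (Finset.prod_eq_zero hj (by rw [hz, sub_self])) h0
      · rcases hβ k ω with hz | hz
        · rw [tau_succ, hz] at h
          exact absurd (by simpa using h) h0
        · exact hz

theorem infoW_congr {x' : ℕ → Ω → Fin n → ℝ} {k : ℕ} (hx : ∀ j ≤ k, x j = x' j) :
    infoW β x k = infoW β x' k :=
  iSup_congr fun j => iSup_congr fun hj => by rw [hx j hj]

theorem infoP_congr {x' : ℕ → Ω → Fin n → ℝ} {k : ℕ} (hx : ∀ j ≤ k, x j = x' j) :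
    S.infoP v β x k = S.infoP v β x' k := by
  have : (⨆ j ≤ k, MeasurableSpace.comap (fun ω => S.H *ᵥ x j ω + v j ω) inferInstance) =
      ⨆ j ≤ k, MeasurableSpace.comap (fun ω => S.H *ᵥ x' j ω + v j ω) inferInstance :=
    iSup_congr fun j => iSup_congr fun hj => by rw [hx j hj]
  rw [infoP, infoP, infoW_congr hx, this]

variable [m0 : MeasurableSpace Ω] {P : Measure Ω}

theorem estW_congr {x' : ℕ → Ω → Fin n → ℝ} {k : ℕ} (hx : ∀ j ≤ k, x j = x' j) :
    estW P β x k = estW P β x' k := by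
  rw [estW, estW, infoW_congr hx, hx k le_rfl]

theorem estP_congr {x' : ℕ → Ω → Fin n → ℝ} {k : ℕ} (hx : ∀ j ≤ k, x j = x' j) :
    S.estP P v β x k = S.estP P v β x' k := by
  rw [estP, estP, infoP_congr hx, hx k le_rfl]

/-- The closed-loop state up to time `k`, as a sequence. -/
def loopUpTo (S : NCS n m a b) (P : Measure Ω) (LW : Matrix (Fin a ⊕ Fin b) (Fin n) ℝ)
    (LP : Matrix (Fin b) (Fin n) ℝ) (x0 : Ω → Fin n → ℝ) (v : ℕ → Ω → Fin m → ℝ)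
    (β : ℕ → Ω → ℝ) : ℕ → ℕ → Ω → Fin n → ℝ
  | 0 => fun _ => x0
  | k + 1 => Function.update (loopUpTo S P LW LP x0 v β k) (k + 1) fun ω =>
      S.A *ᵥ loopUpTo S P LW LP x0 v β k k ω +
      S.B *ᵥ (LW *ᵥ estW P β (loopUpTo S P LW LP x0 v β k) k ω) +
      S.BP *ᵥ (LP *ᵥ (S.estP P v β (loopUpTo S P LW LP x0 v β k) k ω -
        estW P β (loopUpTo S P LW LP x0 v β k) k ω))

theorem loopUpTo_of_le {j k : ℕ} (hj : j ≤ k) :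
    S.loopUpTo P LW LP x0 v β k j = S.loopUpTo P LW LP x0 v β j j := by
  induction k, hj using Nat.le_induction with
  | base => rfl
  | succ k hj ih => rw [loopUpTo, Function.update_of_ne (by omega), ih]

/-- The estimates at time `k` depend on the whole trajectory up to `k`, so the recursion runs over
trajectories (`loopUpTo`) and the diagonal is taken; the estimates ignore what comes after time `k`.
-/
theorem exists_isFeedbackLoop (S : NCS n m a b) (P : Measure Ω)
    (LW : Matrix (Fin a ⊕ Fin b) (Fin n) ℝ) (LP : Matrix (Fin b) (Fin n) ℝ)
    (x0 : Ω → Fin n → ℝ) (v : ℕ → Ω → Fin m → ℝ) (β : ℕ → Ω → ℝ) :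
    ∃ x u ut, S.IsFeedbackLoop P LW LP x0 v β x u ut := by
  set x : ℕ → Ω → Fin n → ℝ := fun k => S.loopUpTo P LW LP x0 v β k k with hx
  refine ⟨x, fun k ω => LW *ᵥ estW P β x k ω,
    fun k ω => LP *ᵥ (S.estP P v β x k ω - estW P β x k ω), ⟨rfl, fun k ω => ?_⟩,
    fun _ _ => rfl, fun _ _ => rfl⟩
  have hc : ∀ j ≤ k, S.loopUpTo P LW LP x0 v β k j = x j := fun j hj => loopUpTo_of_le hj
  have h1 : x (k + 1) = fun ω => S.A *ᵥ S.loopUpTo P LW LP x0 v β k k ω +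
      S.B *ᵥ (LW *ᵥ estW P β (S.loopUpTo P LW LP x0 v β k) k ω) +
      S.BP *ᵥ (LP *ᵥ (S.estP P v β (S.loopUpTo P LW LP x0 v β k) k ω -
        estW P β (S.loopUpTo P LW LP x0 v β k) k ω)) := Function.update_self ..
  rw [h1, estW_congr hc, estP_congr hc]

variable [IsProbabilityMeasure P]

theorem IsFeedbackLoop.memLp (h : S.IsInput P mean cov x0 v β)
    (hL : S.IsFeedbackLoop P LW LP x0 v β x u ut) (k : ℕ) :
    MemLp (x k) 2 P ∧ MemLp (u k) 2 P ∧ MemLp (ut k) 2 P := by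
  have key : ∀ k, MemLp (x k) 2 P → MemLp (u k) 2 P ∧ MemLp (ut k) 2 P := by
    intro k hx
    have h1 : MemLp (estW P β x k) 2 P := hx.condExp one_le_two
    have h2 : MemLp (S.estP P v β x k) 2 P := hx.condExp one_le_two
    rw [funext (hL.2.1 k), funext (hL.2.2 k)]
    have h3 : MemLp (fun ω => S.estP P v β x k ω - estW P β x k ω) 2 P := h2.sub h1
    exact ⟨memLp_mulVec h1 _, memLp_mulVec h3 _⟩
  induction k with
  | zero =>
    have h0 : MemLp (x 0) 2 P := by rw [hL.1.1]; exact h.memLp_x0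
    exact ⟨h0, key 0 h0⟩
  | succ k ih =>
    obtain ⟨i1, i2, i3⟩ := ih
    have h1 : MemLp (x (k + 1)) 2 P := by
      rw [funext (hL.1.2 k)]
      have h2 : MemLp (fun ω => S.A *ᵥ x k ω) 2 P := memLp_mulVec i1 _
      have h3 : MemLp (fun ω => S.B *ᵥ u k ω) 2 P := memLp_mulVec i2 _
      have h4 : MemLp (fun ω => S.A *ᵥ x k ω + S.B *ᵥ u k ω) 2 P := h2.add h3
      have h5 : MemLp (fun ω => S.BP *ᵥ ut k ω) 2 P := memLp_mulVec i3 _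
      exact h4.add h5
    exact ⟨h1, key _ h1⟩

theorem IsFeedbackLoop.measurable (hL : S.IsFeedbackLoop P LW LP x0 v β x u ut) (k : ℕ) :
    Measurable[infoW β x k] (u k) ∧ Measurable[S.infoP v β x k] (ut k) := by
  have h1 : Measurable[infoW β x k] (estW P β x k) := stronglyMeasurable_condExp.measurable
  have h2 : Measurable[S.infoP v β x k] (S.estP P v β x k) := stronglyMeasurable_condExp.measurable
  have f1 : Measurable fun y : Fin n → ℝ => LW *ᵥ y := by fun_prop
  have f2 : Measurable fun q : (Fin n → ℝ) × (Fin n → ℝ) => LP *ᵥ (q.1 - q.2) := by fun_prop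
  rw [funext (hL.2.1 k), funext (hL.2.2 k)]
  exact ⟨f1.comp h1, f2.comp (h2.prodMk (h1.mono le_sup_left le_rfl))⟩

theorem IsInput.infoP_le_of_trajectory (h : S.IsInput P mean cov x0 v β)
    (hm : ∀ j, Measurable (x j)) (k : ℕ) : S.infoP v β x k ≤ m0 := by
  refine sup_le (iSup₂_le fun j _ => ?_) (iSup₂_le fun j _ => ?_)
  · exact ((h.measurable_β j).smul (hm j)).comap_le
  · have hf : Measurable fun q : (Fin n → ℝ) × (Fin m → ℝ) => S.H *ᵥ q.1 + q.2 := by fun_prop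
    exact (hf.comp ((hm j).prodMk (h.measurable_v j))).comap_le

/-- Linear feedback of the estimates is admissible. -/
theorem IsFeedbackLoop.isAdmissible (h : S.IsInput P mean cov x0 v β)
    (hL : S.IsFeedbackLoop P LW LP x0 v β x u ut) : S.IsAdmissible P x0 v β x u ut := by
  have hm : ∀ k, ∀ j ≤ k, Measurable (x j) := by
    have hle : ∀ k, (∀ j ≤ k, Measurable (x j)) → S.infoP v β x k ≤ m0 := by
      intro k hk
      -- Measurability is known only up to time `k`; freezing the trajectory there leaves the
      -- information of time `k` unchanged.
      have := h.infoP_le_of_trajectory (x := fun j => x (min j k)) (fun j => hk _ (min_le_right _ _)) k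
      rwa [infoP_congr (x' := x) (fun j hj => by simp only [min_eq_left hj])] at this
    intro k
    induction k with
    | zero =>
      intro j hj
      obtain rfl : j = 0 := by omega
      rw [hL.1.1]; exact h.measurable_x0
    | succ k ih =>
      intro j hj
      rcases Nat.lt_or_ge k j with hkj | hjk
      · obtain rfl : j = k + 1 := by omega
        have h1 := (hL.measurable k).1.mono (le_sup_left.trans (hle k ih)) le_rfl
        have h2 := (hL.measurable k).2.mono (hle k ih) le_rfl
        rw [funext (hL.1.2 k)]
        have hf : Measurable fun q : (Fin n → ℝ) × ((Fin a ⊕ Fin b) → ℝ) × (Fin b → ℝ) =>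
          S.A *ᵥ q.1 + S.B *ᵥ q.2.1 + S.BP *ᵥ q.2.2 := by fun_prop
        exact hf.comp ((ih k le_rfl).prodMk (h1.prodMk h2))
      · exact ih j hjk
  have hleP : ∀ k, S.infoP v β x k ≤ m0 :=
    h.infoP_le_of_trajectory fun j => hm j j le_rfl
  refine ⟨hL.1, fun k => (hL.measurable k).1, fun k => (hL.measurable k).2,
    fun k => (hL.memLp h k).2.1, fun k => (hL.memLp h k).2.2, fun k => ?_⟩
  have hx := (hL.memLp h k).1.integrable one_le_two
  have hWP : infoW β x k ≤ S.infoP v β x k := le_sup_left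
  have o1 := orth_sub_condExp (m := infoW β x k) (hWP.trans (hleP k)) hx
  have o2 := (orth_sub_condExp (m := S.infoP v β x k) (hleP k) hx).mono hWP
  have o3 := o1.sub o2 (hx.sub integrable_condExp) (hx.sub integrable_condExp)
  have o4 : Orth P (infoW β x k) (fun ω => S.estP P v β x k ω - estW P β x k ω) :=
    o3.congr (ae_of_all _ fun ω => by simp only [Pi.sub_apply, estP, estW]; abel)
  have i4 : Integrable (fun ω => S.estP P v β x k ω - estW P β x k ω) P :=
    integrable_condExp.sub integrable_condExp
  have o5 := o4.mulVec i4 LP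
  rw [funext (hL.2.2 k)]
  refine o5.condExp_eq_zero (hWP.trans (hleP k)) ?_
  exact (LinearMap.toContinuousLinearMap LP.mulVecLin).integrable_comp i4

section Known

/-- The embedded controller can reconstruct the measurements of the uncontrolled state. -/
theorem IsAdmissible.measurable_infoP_dev (hA : S.IsAdmissible P x0 v β x u ut) (k : ℕ) :
    Measurable[S.infoP v β x k] fun ω => x k ω - (S.A ^ k) *ᵥ x0 ω := by
  induction k with
  | zero =>
    have : (fun ω => x 0 ω - (S.A ^ 0) *ᵥ x0 ω) = fun _ => 0 := by
      ext1 ω; simp [hA.traj.1]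
    rw [this]; exact measurable_const
  | succ k ih =>
    have e : (fun ω => x (k + 1) ω - (S.A ^ (k + 1)) *ᵥ x0 ω) = fun ω =>
        S.A *ᵥ (x k ω - (S.A ^ k) *ᵥ x0 ω) + S.B *ᵥ u k ω + S.BP *ᵥ ut k ω := by
      ext1 ω
      rw [hA.traj.2, mulVec_sub, mulVec_mulVec, pow_succ']
      abel
    rw [e]
    have hf : Measurable fun q : (Fin n → ℝ) × ((Fin a ⊕ Fin b) → ℝ) × (Fin b → ℝ) =>
      S.A *ᵥ q.1 + S.B *ᵥ q.2.1 + S.BP *ᵥ q.2.2 := by fun_prop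
    exact (hf.comp (ih.prodMk (((hA.meas_u k).mono le_sup_left le_rfl).prodMk
      (hA.meas_ut k)))).mono (infoP_mono (Nat.le_succ k)) le_rfl

theorem IsAdmissible.infoF_le_infoP (hA : S.IsAdmissible P x0 v β x u ut) (k : ℕ) :
    S.infoF x0 v k ≤ S.infoP v β x k := by
  have h1 : ∀ j ≤ k, Measurable[S.infoP v β x k] (S.freeMeas x0 v j) := by
    intro j hj
    have e : S.freeMeas x0 v j = fun ω => (S.H *ᵥ x j ω + v j ω) -
        S.H *ᵥ (x j ω - (S.A ^ j) *ᵥ x0 ω) := by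
      ext1 ω; simp only [freeMeas, mulVec_sub]; abel
    rw [e]
    have hf : Measurable fun q : (Fin m → ℝ) × (Fin n → ℝ) => q.1 - S.H *ᵥ q.2 := by fun_prop
    exact hf.comp ((measurable_infoP_meas hj).prodMk
      ((hA.measurable_infoP_dev j).mono (infoP_mono hj) le_rfl))
  have h : Measurable[S.infoP v β x k]
      fun ω (q : Fin (k + 1) × Fin m) => S.freeMeas x0 v q.1 ω q.2 := by
    let _ : MeasurableSpace Ω := S.infoP v β x k
    refine measurable_pi_iff.2 fun q => ?_
    exact (measurable_pi_apply q.2).comp (h1 q.1 (by omega))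
  exact h.comap_le

theorem IsAdmissible.measurable_sub_filtErr (hA : S.IsAdmissible P x0 v β x u ut) (k : ℕ) :
    Measurable[S.infoP v β x k] fun ω => x k ω - S.filtErr mean cov x0 v k ω := by
  have e : (fun ω => x k ω - S.filtErr mean cov x0 v k ω) = fun ω =>
      (x k ω - (S.A ^ k) *ᵥ x0 ω) + S.freeFilt mean cov x0 v k ω := by
    funext ω; simp only [filtErr]; abel
  rw [e]
  have hf : Measurable fun q : (Fin n → ℝ) × (Fin n → ℝ) => q.1 + q.2 := by fun_prop
  exact hf.comp ((hA.measurable_infoP_dev k).prodMk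
    ((measurable_infoF_freePred k).2.mono (hA.infoF_le_infoP k) le_rfl))

end Known

end NCS
end

/-! ### In the closed loop the estimators detect the receptions. -/

noncomputable section

open LQ

namespace NCS

variable {n m a b : ℕ} {S : NCS n m a b} {Ω : Type} {mean : Fin n → ℝ}
  {cov : Matrix (Fin n) (Fin n) ℝ} {x0 : Ω → Fin n → ℝ}
  {v : ℕ → Ω → Fin m → ℝ} {β : ℕ → Ω → ℝ}
  {x : ℕ → Ω → Fin n → ℝ} {u : ℕ → Ω → (Fin a ⊕ Fin b) → ℝ} {ut : ℕ → Ω → Fin b → ℝ}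
  {LW : Matrix (Fin a ⊕ Fin b) (Fin n) ℝ} {LP : Matrix (Fin b) (Fin n) ℝ}

theorem infoA_zero_agree {C : Set Ω} (hC : MeasurableSet[infoA β x 0] C) :
    ∃ C', MeasurableSet[⊥] C' ∧ ∀ ω ∈ {ω | β 0 ω = 0}, (ω ∈ C ↔ ω ∈ C') := by
  refine exists_agree (sup_le (iSup₂_le fun j hj => ?_) (iSup₂_le fun j hj => ?_)) hC
  · refine comap_le_trace ?_
    obtain rfl : j = 0 := by omega
    have : (fun ω : {ω | β 0 ω = 0} => β 0 ω • x 0 ω) = fun _ => 0 := by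
      funext ω
      rw [ω.2, zero_smul]
    rw [this]; exact measurable_const
  · refine comap_le_trace ?_
    obtain rfl : j = 0 := by omega
    have : (fun ω : {ω | β 0 ω = 0} => β 0 ω) = fun _ => 0 := funext fun ω => ω.2
    rw [this]; exact measurable_const

variable [m0 : MeasurableSpace Ω] {P : Measure Ω} [IsProbabilityMeasure P]

theorem IsAdmissible.estA_zero (h : S.IsInput P mean cov x0 v β)
    (hA : S.IsAdmissible P x0 v β x u ut) (hp1 : S.p < 1) :
    estA P β x 0 =ᵐ[P] fun ω => β 0 ω • x 0 ω + (1 - β 0 ω) • mean := by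
  symm
  have hx := hA.memLp_x h 0
  have hm : MemLp (fun ω => β 0 ω • x 0 ω + (1 - β 0 ω) • mean) 2 P :=
    (h.memLp_β_smul 0 hx).add (h.memLp_one_sub_β_smul 0 (memLp_const mean))
  have hd : MemLp (fun ω => x0 ω - mean) 2 P := h.memLp_x0.sub (memLp_const mean)
  refine Orth.ae_eq_condExp (hA.infoA_le h 0) ?_ (hx.integrable one_le_two)
    (hm.integrable one_le_two) ?_
  · have o : Orth P (infoA β x 0) fun ω => (1 - β 0 ω) • (x0 ω - mean) := by
      intro C hC i
      obtain ⟨C', hC', hCC⟩ := infoA_zero_agree hC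
      have hi : Integrable (fun ω => (x0 ω - mean) i) P := (hd.integrable one_le_two).eval i
      rw [← integral_indicator (hA.infoA_le h 0 C hC)]
      have e : ∀ ω, C.indicator (fun ω => ((1 - β 0 ω) • (x0 ω - mean)) i) ω =
          (1 - β 0 ω) * C'.indicator (fun ω => (x0 ω - mean) i) ω := by
        intro ω
        rcases h.β_zero_or_one 0 ω with h0 | h1
        · have := hCC ω h0
          by_cases hω : ω ∈ C
          · rw [Set.indicator_of_mem hω, Set.indicator_of_mem (this.1 hω)]; simp
          · rw [Set.indicator_of_notMem hω, Set.indicator_of_notMem (fun h' => hω (this.2 h'))]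
            simp
        · simp [h1, Set.indicator]
      have hz : ∫ ω, (x0 ω - mean) i ∂P = 0 := by
        simp only [Pi.sub_apply]
        rw [integral_sub ((h.memLp_x0.integrable one_le_two).eval i) (integrable_const _),
          h.gaussian_x0.integral_apply i]
        simp
      rw [integral_congr_ae (ae_of_all _ e)]
      rcases MeasurableSpace.measurableSet_bot_iff.1 hC' with rfl | rfl
      · simp
      · simp only [Set.indicator_univ]
        have hf : Measurable fun y : Fin n → ℝ => (y - mean) i := by fun_prop
        rw [h.integral_one_sub_β_mul hp1 (f := fun ω => (x0 ω - mean) i)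
          (hf.comp (measurable_hist_x0 0)) hi, hz, mul_zero]
    refine o.congr (ae_of_all _ fun ω => ?_)
    simp only [Pi.sub_apply]
    rw [hA.traj.1]
    module
  · have hf : Measurable fun q : ℝ × (Fin n → ℝ) => q.2 + (1 - q.1) • mean := by fun_prop
    exact aesm (hf.comp ((measurable_infoA_β le_rfl).prodMk
      ((measurable_infoW_received le_rfl).mono le_sup_left le_rfl)))

/-- What the estimators know in the closed loop before the reception at time `k`. -/
def KnownBefore (S : NCS n m a b) (P : Measure Ω) (LW : Matrix (Fin a ⊕ Fin b) (Fin n) ℝ)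
    (LP : Matrix (Fin b) (Fin n) ℝ) (mean : Fin n → ℝ) (cov : Matrix (Fin n) (Fin n) ℝ)
    (x0 : Ω → Fin n → ℝ) (v : ℕ → Ω → Fin m → ℝ) (β : ℕ → Ω → ℝ) (x : ℕ → Ω → Fin n → ℝ)
    (k : ℕ) : Prop :=
  ∃ Z : Ω → Fin n → ℝ, Measurable[infoW β x k] Z ∧ MemLp Z 2 P ∧
    (estA P β x k =ᵐ[P] fun ω => β k ω • x k ω + (1 - β k ω) • Z ω) ∧
    ∀ᵐ ω ∂P, (tau β k ω = 1 → Z ω = S.lossMean LW mean k ∧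
      x k ω = S.lossState LW LP mean cov x0 v k ω) ∧ (tau β k ω = 0 → x k ω = Z ω)

/-- What the estimators know in the closed loop at time `k`. -/
def KnownAt (S : NCS n m a b) (P : Measure Ω) (LW : Matrix (Fin a ⊕ Fin b) (Fin n) ℝ)
    (LP : Matrix (Fin b) (Fin n) ℝ) (mean : Fin n → ℝ) (cov : Matrix (Fin n) (Fin n) ℝ)
    (x0 : Ω → Fin n → ℝ) (v : ℕ → Ω → Fin m → ℝ) (β : ℕ → Ω → ℝ) (x : ℕ → Ω → Fin n → ℝ)
    (k : ℕ) : Prop :=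
  ∀ᵐ ω ∂P, estW P β x k ω = estA P β x k ω ∧
    S.estP P v β x k ω = x k ω - S.err mean cov x0 v β k ω ∧
    (tau β (k + 1) ω = 1 → estA P β x k ω = S.lossMean LW mean k ∧
      x k ω = S.lossState LW LP mean cov x0 v k ω) ∧
    (tau β (k + 1) ω = 0 → estA P β x k ω = x k ω)

section Loop

variable (h : S.IsInput P mean cov x0 v β) (hA : S.IsAdmissible P x0 v β x u ut)
include h hA

/-- The estimate that knows the receptions is almost surely a function of β_j x_j, j ≤ k. The only
ambiguous case is a received zero: after an earlier reception the prediction is exact and equals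
that zero, and before one the Gaussian dichotomy makes the prediction zero as well. -/
theorem KnownBefore.estW_ae_eq {k : ℕ} (hK : S.KnownBefore P LW LP mean cov x0 v β x k) :
    estW P β x k =ᵐ[P] estA P β x k := by
  classical
  obtain ⟨Z, hZm, hZ2, hZ, hae⟩ := hK
  have hx := (hA.memLp_x h k).integrable one_le_two
  have hle : infoW β x k ≤ m0 := le_sup_left.trans (hA.infoA_le h k)
  -- Candidate: treat a zero observation as a loss and use the prediction `Z`.
  set c : Ω → Fin n → ℝ := fun ω => if β k ω • x k ω = 0 then Z ω else β k ω • x k ω with hc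
  have hcA : c =ᵐ[P] estA P β x k := by
    filter_upwards [hae, hZ, h.ae_of_lossState_eq_zero LW LP] with ω h1 h2 h3
    rw [h2]
    simp only [hc]
    rcases h.β_zero_or_one k ω with hb | hb
    · simp [hb]
    · simp only [hb, one_smul, sub_self, zero_smul, add_zero]
      split_ifs with h0
      · rcases h.tau_zero_or_one k ω with ht | ht
        · exact (h1.2 ht).symm
        · obtain ⟨e1, e2⟩ := h1.1 ht
          rw [e1, (h3 k (by rw [← e2, h0])).1, h0]
      · rfl
  have hcm : Measurable[infoW β x k] c := by
    have hy := measurable_infoW_received (β := β) (x := x) (le_refl k)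
    exact Measurable.ite (hy (measurableSet_singleton 0)) hZm hy
  have hc2 : MemLp c 2 P := (hA.memLp_estA h k).ae_eq hcA.symm
  have o := ((orth_sub_condExp (hA.infoA_le h k) hx).mono (m' := infoW β x k) le_sup_left)
  have o2 : Orth P (infoW β x k) (x k - c) := o.congr (by
    filter_upwards [hcA] with ω hω
    simp only [Pi.sub_apply, hω]; rfl)
  exact (o2.ae_eq_condExp hle hx (hc2.integrable one_le_two) (aesm hcm)).symm.trans hcA

/-- For the embedded estimator a candidate is built from the observations alone; it coincides almost
surely with x - `err`, whose error is already orthogonal to the larger `infoG`. -/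
theorem KnownBefore.knownAt (hp1 : S.p < 1) {k : ℕ}
    (hall : ∀ j ≤ k, S.KnownBefore P LW LP mean cov x0 v β x j) :
    S.KnownAt P LW LP mean cov x0 v β x k := by
  classical
  have hWA := (hall k le_rfl).estW_ae_eq h hA
  obtain ⟨Z, hZm, hZ2, hZ, hae⟩ := hall k le_rfl
  have hxall : ∀ᵐ ω ∂P, ∀ j ≤ k, tau β j ω = 1 →
      x j ω = S.lossState LW LP mean cov x0 v j ω := by
    refine ae_all_iff.2 fun j => ?_
    by_cases hj : j ≤ k
    · obtain ⟨_, _, _, _, hj'⟩ := hall j hj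
      exact hj'.mono fun ω hω _ ht => (hω.1 ht).2
    · exact ae_of_all _ fun ω hc => absurd hc hj
  have htau : ∀ ω, tau β (k + 1) ω = 1 → β k ω = 0 ∧ tau β k ω = 1 := by
    intro ω hω
    have h0 := tau_succ_eq_one h.β_zero_or_one (by rw [hω]; exact one_ne_zero) (le_refl k)
    refine ⟨h0, ?_⟩
    rwa [tau_succ, h0, sub_zero, mul_one] at hω
  have hmid : ∀ᵐ ω ∂P, (tau β (k + 1) ω = 1 → estA P β x k ω = S.lossMean LW mean k ∧
      x k ω = S.lossState LW LP mean cov x0 v k ω) ∧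
      (tau β (k + 1) ω = 0 → estA P β x k ω = x k ω) := by
    filter_upwards [hae, hZ] with ω h1 h2
    refine ⟨fun ht => ?_, fun ht => ?_⟩
    · obtain ⟨hb, ht'⟩ := htau ω ht
      obtain ⟨e1, e2⟩ := h1.1 ht'
      rw [h2, hb, e1]
      exact ⟨by simp, e2⟩
    · rw [h2]
      rcases h.β_zero_or_one k ω with hb | hb
      · rw [tau_succ, hb, sub_zero, mul_one] at ht
        rw [hb, ← h1.2 ht]; simp
      · rw [hb]; simp
  have hPerr : S.estP P v β x k =ᵐ[P] fun ω => x k ω - S.err mean cov x0 v β k ω := by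
    have hle : S.infoP v β x k ≤ m0 := (hA.infoP_le_infoG k).trans (h.infoG_le k)
    have hx := (hA.memLp_x h k).integrable one_le_two
    -- Observable substitute for the event that nothing has been received up to time `k`.
    set E : Set Ω := ⋂ j ∈ Finset.range (k + 1), {ω | β j ω • x j ω = 0} with hE
    have hEm : MeasurableSet[S.infoP v β x k] E := by
      refine Finset.measurableSet_biInter _ fun j hj => ?_
      have hy := (measurable_infoW_received (β := β) (x := x)
        (Nat.lt_succ_iff.1 (Finset.mem_range.1 hj))).mono
          (le_sup_left : _ ≤ S.infoP v β x k) le_rfl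
      exact hy (measurableSet_singleton 0)
    set c : Ω → Fin n → ℝ := fun ω => if ω ∈ E then x k ω - S.filtErr mean cov x0 v k ω
      else estW P β x k ω with hc
    have hcm : Measurable[S.infoP v β x k] c := by
      have h1 : Measurable[infoW β x k] (estW P β x k) := stronglyMeasurable_condExp.measurable
      exact Measurable.ite hEm (hA.measurable_sub_filtErr k) (h1.mono le_sup_left le_rfl)
    have hce : c =ᵐ[P] fun ω => x k ω - S.err mean cov x0 v β k ω := by
      filter_upwards [hWA, hmid, hxall, h.ae_of_lossState_eq_zero LW LP] with ω h1 h2 h3 h4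
      simp only [hc]
      rcases h.tau_zero_or_one (k + 1) ω with ht | ht
      · have herr : S.err mean cov x0 v β k ω = 0 := by rw [err, ht, zero_smul]
        rw [herr, sub_zero]
        split_ifs with hω
        -- A reception occurred although all observations are zero: the state was zero at the first
        -- reception, hence the Kalman error is zero from then on and both branches of `c` are
        -- right.
        · obtain ⟨j, hj, ht1, hb1⟩ := exists_first_reception h.β_zero_or_one ht
          have hz : β j ω • x j ω = 0 := by
            have := Set.mem_iInter₂.1 hω j (Finset.mem_range.2 hj)
            exact this
          rw [hb1, one_smul, h3 j (by omega) ht1] at hz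
          rw [(h4 j hz).2 k (by omega), sub_zero]
        · rw [h1, h2.2 ht]
      · have hω : ω ∈ E := by
          refine Set.mem_iInter₂.2 fun j hj => ?_
          have h0 := tau_succ_eq_one h.β_zero_or_one (by rw [ht]; exact one_ne_zero)
            (Nat.lt_succ_iff.1 (Finset.mem_range.1 hj))
          change β j ω • x j ω = 0
          rw [h0, zero_smul]
        rw [if_pos hω, err, ht, one_smul]
    have hm2 : MemLp (fun ω => x k ω - S.err mean cov x0 v β k ω) 2 P :=
      (hA.memLp_x h k).sub (h.memLp_err k)
    have hc2 : MemLp c 2 P := hm2.ae_eq hce.symm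
    have o : Orth P (S.infoP v β x k) (x k - c) :=
      ((h.orth_infoG_err hp1 k).mono (hA.infoP_le_infoG k)).congr (by
        filter_upwards [hce] with ω hω
        simp only [Pi.sub_apply, hω, sub_sub_cancel])
    exact (o.ae_eq_condExp hle hx (hc2.integrable one_le_two) (aesm hcm)).symm.trans hce
  filter_upwards [hWA, hPerr, hmid] with ω h1 h2 h3
  exact ⟨h1, h2, h3.1, h3.2⟩

omit hA in
-- The embedded control is almost surely `LP` times the gap, and the gap is orthogonal to `infoA`;
-- in the closed loop nothing of it is predictable.
theorem KnownAt.utPred_ae_eq_zero (hL : S.IsFeedbackLoop P LW LP x0 v β x u ut) (hp1 : S.p < 1)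
    {k : ℕ} (hK : S.KnownAt P LW LP mean cov x0 v β x k) :
    utPred P β x ut k =ᵐ[P] 0 ∧
      ut k =ᵐ[P] fun ω => LP *ᵥ S.gap P mean cov x0 v β x k ω := by
  have hA := hL.isAdmissible h
  have e : ut k =ᵐ[P] fun ω => LP *ᵥ S.gap P mean cov x0 v β x k ω := by
    filter_upwards [hK] with ω hω
    rw [hL.2.2, hω.1, hω.2.1, gap]
  have hg := hA.memLp_gap (mean := mean) (cov := cov) h k
  have o := (hA.orth_gap h hp1 k).mulVec (hg.integrable one_le_two) LP
  have o2 : Orth P (infoA β x k) (ut k) := o.congr e.symm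
  exact ⟨o2.condExp_eq_zero (hA.infoA_le h k) ((hA.memLp_ut k).integrable one_le_two), e⟩

omit hA in
-- The predictor `Z` of the next state is A + B `LW` applied to the remote estimate, which is
-- measurable for the remote information.
theorem KnownAt.knownBefore_succ (hL : S.IsFeedbackLoop P LW LP x0 v β x u ut) (hp1 : S.p < 1)
    {k : ℕ} (hK : S.KnownAt P LW LP mean cov x0 v β x k) :
    S.KnownBefore P LW LP mean cov x0 v β x (k + 1) := by
  have hA := hL.isAdmissible h
  obtain ⟨hu0, hutg⟩ := hK.utPred_ae_eq_zero h hL hp1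
  have hW2 : MemLp (estW P β x k) 2 P := (hA.memLp_x h k).condExp one_le_two
  have hWm : Measurable[infoW β x k] (estW P β x k) := stronglyMeasurable_condExp.measurable
  have hf : Measurable fun y : Fin n → ℝ => S.A *ᵥ y + S.B *ᵥ (LW *ᵥ y) := by fun_prop
  have h1 : MemLp (fun ω => S.A *ᵥ estW P β x k ω) 2 P := memLp_mulVec hW2 _
  have h2 : MemLp (fun ω => S.B *ᵥ (LW *ᵥ estW P β x k ω)) 2 P :=
    memLp_mulVec (memLp_mulVec hW2 _) _
  refine ⟨fun ω => S.A *ᵥ estW P β x k ω + S.B *ᵥ (LW *ᵥ estW P β x k ω),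
    (hf.comp hWm).mono (infoW_mono (Nat.le_succ k)) le_rfl, h1.add h2, ?_, ?_⟩
  · filter_upwards [hA.estA_succ h hp1 k, hK, hu0] with ω e1 e2 e3
    rw [e1, predA, uBar, e3, hL.2.1, e2.1]
    simp
  · filter_upwards [hK, hutg] with ω e1 e2
    obtain ⟨eW, eP, eT, eR⟩ := e1
    refine ⟨fun ht => ?_, fun ht => ?_⟩
    · obtain ⟨e3, e4⟩ := eT ht
      refine ⟨by rw [eW, e3, lossMean_succ], ?_⟩
      rw [hL.1.2, hL.2.1, hL.2.2, eP, eW, err, ht, one_smul, e3, e4]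
      rfl
    · have e3 := eR ht
      rw [hL.1.2, hL.2.1, hL.2.2, eP, eW, err, ht, zero_smul, e3]
      simp

omit hA in
theorem IsFeedbackLoop.knownBefore (hL : S.IsFeedbackLoop P LW LP x0 v β x u ut) (hp1 : S.p < 1)
    (k : ℕ) : ∀ j ≤ k, S.KnownBefore P LW LP mean cov x0 v β x j := by
  have hA := hL.isAdmissible h
  induction k with
  | zero =>
    intro j hj
    obtain rfl : j = 0 := by omega
    refine ⟨fun _ => mean, measurable_const, memLp_const _, hA.estA_zero h hp1,
      ae_of_all _ fun ω => ⟨fun _ => ⟨by simp [lossMean], by rw [hL.1.1]; rfl⟩, fun ht => ?_⟩⟩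
    simp [tau_zero] at ht
  | succ k ih =>
    intro j hj
    rcases Nat.lt_or_ge k j with hkj | hjk
    · obtain rfl : j = k + 1 := by omega
      exact (KnownBefore.knownAt h hA hp1 ih).knownBefore_succ h hL hp1
    · exact ih j hjk

omit hA in
/-- In the closed loop the estimators know the receptions almost surely. -/
theorem IsFeedbackLoop.knownAt (hL : S.IsFeedbackLoop P LW LP x0 v β x u ut) (hp1 : S.p < 1)
    (k : ℕ) : S.KnownAt P LW LP mean cov x0 v β x k :=
  KnownBefore.knownAt h (hL.isAdmissible h) hp1 (hL.knownBefore h hp1 k)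

end Loop

/-- The feedback uses `estW` and `estP`, the excess is written with `estA` and `gap`; they agree
almost surely by `IsFeedbackLoop.knownAt`. -/
theorem IsFeedbackLoop.excess_eq_zero {PW PP : Matrix (Fin n) (Fin n) ℝ}
    (h : S.IsInput P mean cov x0 v β)
    (hL : S.IsFeedbackLoop P (-((S.Gam PW)⁻¹ * S.M PW)) (-((S.Om PW PP)⁻¹ * S.L PW PP))
      x0 v β x u ut) (hp1 : S.p < 1) (k : ℕ) :
    S.excess PW PP P mean cov x0 v β x u ut k = 0 := by
  have hK := hL.knownAt h hp1 k
  obtain ⟨hu0, hutg⟩ := hK.utPred_ae_eq_zero h hL hp1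
  have e1 : (fun ω => uBar P β x u ut k ω + ((S.Gam PW)⁻¹ * S.M PW) *ᵥ estA P β x k ω) =ᵐ[P]
      fun _ => 0 := by
    filter_upwards [hK, hu0] with ω h1 h2
    rw [uBar, h2, hL.2.1, h1.1, neg_mulVec]
    simp
  have e2 : (fun ω => utBar P β x ut k ω + ((S.Om PW PP)⁻¹ * S.L PW PP) *ᵥ
      S.gap P mean cov x0 v β x k ω) =ᵐ[P] fun _ => 0 := by
    filter_upwards [hutg, hu0] with ω h1 h2
    rw [utBar, h2, h1, neg_mulVec]
    simp
  rw [excess, qform_congr _ e1, qform_congr _ e2]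
  simp [qform]

end NCS
end

/-! ### The optimal value in terms of the Kalman covariances. -/

noncomputable section

open LQ

namespace NCS

variable {n m a b : ℕ} {S : NCS n m a b} {Ω : Type} {mean : Fin n → ℝ}
  {cov : Matrix (Fin n) (Fin n) ℝ} {x0 : Ω → Fin n → ℝ}
  {v : ℕ → Ω → Fin m → ℝ} {β : ℕ → Ω → ℝ}
  {x : ℕ → Ω → Fin n → ℝ} {u : ℕ → Ω → (Fin a ⊕ Fin b) → ℝ} {ut : ℕ → Ω → Fin b → ℝ}
  {LW : Matrix (Fin a ⊕ Fin b) (Fin n) ℝ} {LP : Matrix (Fin b) (Fin n) ℝ}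
  {PW PP : Matrix (Fin n) (Fin n) ℝ}

theorem updCov_eq_updWith (Sg : Matrix (Fin n) (Fin n) ℝ) :
    S.updCov Sg = S.updWith (S.kalmanGain Sg) Sg := rfl

theorem kalmanGain_zero : S.kalmanGain 0 = 0 := by simp [kalmanGain]

theorem updCov_zero : S.updCov 0 = 0 := by simp [updCov, kalmanGain_zero]

theorem gainAt_eq_kalmanGain (hQv : S.Qv.PosSemidef) (hc : cov.PosSemidef) {k : ℕ}
    (hU : IsUnit (S.innovCov (S.errCov cov k))) :
    S.gainAt cov k = S.kalmanGain (S.errCov cov k) := by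
  rw [kalmanGain, ← gainAt_mul_innovCov hQv hc k, Matrix.mul_assoc,
    mul_nonsing_inv _ ((isUnit_iff_isUnit_det _).1 hU), Matrix.mul_one]

/-- An invertible innovation covariance determines the solution of the normal equations, so the
chosen gain is the Kalman gain. -/
theorem predCov_eq_errCov (hQv : S.Qv.PosSemidef) (hc : cov.PosSemidef)
    (hU : ∀ k, IsUnit (S.innovCov (S.predCov cov (fun _ => 0) k))) (k : ℕ) :
    S.predCov cov (fun _ => 0) k = S.errCov cov k := by
  induction k with
  | zero => rfl
  | succ k ih =>
    have h1 := hU k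
    rw [ih] at h1
    have h2 := gainAt_eq_kalmanGain hQv hc h1
    rw [predCov, ih, sub_zero, one_smul, updCov_eq_updWith, ← h2]
    rfl

theorem predCov_congr {r r' : ℕ → ℝ} {k : ℕ} (hr : ∀ j < k, r j = r' j) :
    S.predCov cov r k = S.predCov cov r' k := by
  induction k with
  | zero => rfl
  | succ k ih => rw [predCov, predCov, ih fun j hj => hr j (by omega), hr k (Nat.lt_succ_self k)]

theorem predCov_of_received (hβ : ∀ k ω, β k ω = 0 ∨ β k ω = 1) {k : ℕ} {ω : Ω}
    (ht : tau β k ω = 0) : S.predCov cov (fun j => β j ω) k = 0 := by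
  induction k with
  | zero => simp [tau_zero] at ht
  | succ k ih =>
    rw [predCov]
    rcases hβ k ω with hb | hb
    · rw [tau_succ, hb, sub_zero, mul_one] at ht
      rw [ih ht, updCov_zero]; simp
    · simp [hb]

theorem filtCov_of_received (hβ : ∀ k ω, β k ω = 0 ∨ β k ω = 1) {k : ℕ} {ω : Ω}
    (ht : tau β (k + 1) ω = 0) : S.filtCov cov (fun j => β j ω) k = 0 := by
  rw [filtCov]
  rcases hβ k ω with hb | hb
  · rw [tau_succ, hb, sub_zero, mul_one] at ht
    rw [predCov_of_received hβ ht, updCov_zero, smul_zero]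
  · simp [hb]

/-- After a reception covariance and gain stay zero; before it the recursion is the deterministic
one without receptions. Term `i` depends on β_0, …, β_i only. -/
theorem valueTerm_eq_tau_mul (hβ : ∀ k ω, β k ω = 0 ∨ β k ω = 1) (i : ℕ) (ω : Ω) :
    S.valueTerm PW PP cov (fun k => β k ω) i =
      tau β (i + 1) ω * S.valueTerm PW PP cov (fun _ => 0) i := by
  by_cases ht : tau β (i + 1) ω = 0
  · rw [ht, zero_mul, valueTerm, filtCov_of_received hβ ht, predCov_of_received hβ ht,
      kalmanGain_zero]
    simp
  · have h0 : ∀ j < i + 1, β j ω = 0 := fun j hj =>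
      tau_succ_eq_one hβ ht (Nat.lt_succ_iff.1 hj)
    have h1 : tau β (i + 1) ω = 1 :=
      Finset.prod_eq_one fun j hj => by rw [h0 j (Finset.mem_range.1 hj), sub_zero]
    rw [h1, one_mul, valueTerm, valueTerm, filtCov, filtCov, predCov_congr (r' := fun _ => 0) h0,
      predCov_congr (k := i) (r' := fun _ => 0) fun j hj => h0 j (by omega), h0 i (by omega)]

variable [m0 : MeasurableSpace Ω] {P : Measure Ω} [IsProbabilityMeasure P]

section

variable (h : S.IsInput P mean cov x0 v β)
include h

namespace IsInput

theorem qform_filtErr (k : ℕ) (T : Matrix (Fin n) (Fin n) ℝ) :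
    qform P T (S.filtErr mean cov x0 v k) = Matrix.trace (T * S.postCov cov k) := by
  rw [qform, integral_quad_eq_trace (h.memLp_filtErr k) (h.memLp_filtErr k), h.cross_filtErr_self]

/-- The second moment of the update of the Kalman filter. -/
theorem qform_filter_update (k : ℕ) (T : Matrix (Fin n) (Fin n) ℝ) :
    qform P T (fun ω => S.A *ᵥ S.filtErr mean cov x0 v k ω - S.filtErr mean cov x0 v (k + 1) ω) =
      Matrix.trace (S.Aᵀ * T * S.A * S.postCov cov k) - Matrix.trace (T * S.postCov cov (k + 1)) := by
  have hd : MemLp (fun ω => S.A *ᵥ S.filtErr mean cov x0 v k ω -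
      S.filtErr mean cov x0 v (k + 1) ω) 2 P := (memLp_mulVec (h.memLp_filtErr k) _).sub
        (h.memLp_filtErr (k + 1))
  have e : (fun ω => S.A *ᵥ S.filtErr mean cov x0 v k ω - S.filtErr mean cov x0 v (k + 1) ω) =
      fun ω => S.freeFilt mean cov x0 v (k + 1) ω - S.freePred mean cov x0 v (k + 1) ω := by
    ext1 ω
    rw [← predErr_succ, predErr, filtErr]; abel
  have hm : Measurable[S.infoF x0 v (k + 1)] (fun ω => S.A *ᵥ S.filtErr mean cov x0 v k ω -
      S.filtErr mean cov x0 v (k + 1) ω) := by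
    rw [e]
    have hf : Measurable fun q : (Fin n → ℝ) × (Fin n → ℝ) => q.1 - q.2 := by fun_prop
    exact hf.comp ((measurable_infoF_freePred (k + 1)).2.prodMk
      ((measurable_infoF_freePred k).1.mono (infoF_mono (Nat.le_succ k)) le_rfl))
  -- The prediction error is the filter update plus the new error; the update is a function of the
  -- measurements, so the second moments add.
  have h1 := (h.orth_infoF_filtErr (k + 1)).qform_add (h.infoF_le (k + 1)) hd
    (h.memLp_filtErr (k + 1)) hm T
  simp only [sub_add_cancel] at h1
  rw [qform_mulVec, h.qform_filtErr, h.qform_filtErr] at h1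
  linarith

/-- The propagated error contributes (1-p)A'P^W A and the innovation p A'P^P A, together A'ΔA; the
innovation also subtracts p times the trace of P^P against the next filtering covariance, which is
expanded by the update formula. -/
theorem estCost_eq (hp1 : S.p < 1)
    (hU : ∀ k, IsUnit (S.innovCov (S.predCov cov (fun _ => 0) k))) (i : ℕ) :
    S.estCost PW PP P mean cov x0 v β i =
      S.p ^ (i + 1) * S.valueTerm PW PP cov (fun _ => 0) i := by
  have hQv := h.posSemidef_Qv
  have hc := h.posSemidef_cov
  have hpred := predCov_eq_errCov hQv hc hU
  have hgain : ∀ k, S.kalmanGain (S.predCov cov (fun _ => 0) k) = S.gainAt cov k := by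
    intro k
    have := hU k
    rw [hpred] at this ⊢
    exact (gainAt_eq_kalmanGain hQv hc this).symm
  have hfilt : S.filtCov cov (fun _ => 0) i = S.postCov cov i := by
    rw [filtCov, sub_zero, one_smul, updCov_eq_updWith, hgain, hpred]; rfl
  have e1 : qform P PW (fun ω => S.A *ᵥ S.err mean cov x0 v β i ω) =
      S.p ^ (i + 1) * Matrix.trace (S.Aᵀ * PW * S.A * S.postCov cov i) := by
    rw [qform_mulVec, h.qform_err hp1, h.qform_filtErr]
  have e2 : qform P S.Q (S.err mean cov x0 v β i) =
      S.p ^ (i + 1) * Matrix.trace (S.Q * S.postCov cov i) := by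
    rw [h.qform_err hp1, h.qform_filtErr]
  have hd : MemLp (fun ω => S.A *ᵥ S.filtErr mean cov x0 v i ω -
      S.filtErr mean cov x0 v (i + 1) ω) 2 P := (memLp_mulVec (h.memLp_filtErr i) _).sub
        (h.memLp_filtErr (i + 1))
  have e3 : S.errIncr mean cov x0 v β i = fun ω => tau β (i + 1 + 1) ω •
      (S.A *ᵥ S.filtErr mean cov x0 v i ω - S.filtErr mean cov x0 v (i + 1) ω) := by
    ext1 ω
    rw [errIncr, err, err, tau_succ (i + 1), mulVec_smul]
    module
  have e4 : qform P PP (S.errIncr mean cov x0 v β i) = S.p ^ (i + 1 + 1) *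
      (Matrix.trace (S.Aᵀ * PP * S.A * S.postCov cov i) -
        Matrix.trace (PP * S.postCov cov (i + 1))) := by
    have hf : Measurable fun q : (Fin n → ℝ) × (Fin n → ℝ) => S.A *ᵥ q.1 - q.2 := by fun_prop
    rw [e3, h.qform_tau_smul hp1 _ hd, h.qform_filter_update]
    exact hf.comp ((measurable_hist_filtErr i).prodMk (measurable_hist_filtErr (i + 1)))
  set G := S.gainAt cov (i + 1) with hG
  set Sg := S.postCov cov i with hSg
  have e5 : S.postCov cov (i + 1) = (S.A - G * S.H * S.A) * Sg * (S.A - G * S.H * S.A)ᵀ +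
      G * S.Qv * Gᵀ := by
    have : S.errCov cov (i + 1) = S.A * Sg * S.Aᵀ := rfl
    rw [postCov, ← hG, updWith, this]
    congr 1
    have : S.A - G * S.H * S.A = (1 - G * S.H) * S.A := by rw [Matrix.sub_mul, Matrix.one_mul]
    rw [this, transpose_mul]
    simp only [Matrix.mul_assoc]
  have e6 : Matrix.trace (PP * S.postCov cov (i + 1)) =
      Matrix.trace (Sg * ((S.A - G * S.H * S.A)ᵀ * PP * (S.A - G * S.H * S.A))) +
        Matrix.trace (S.Qv * Gᵀ * PP * G) := by
    rw [e5, Matrix.mul_add, trace_add]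
    congr 1
    · rw [← Matrix.mul_assoc, trace_mul_comm, ← Matrix.mul_assoc, ← Matrix.mul_assoc,
        trace_mul_comm]
    · rw [← Matrix.mul_assoc, ← Matrix.mul_assoc, Matrix.mul_assoc (PP * G), trace_mul_comm,
        ← Matrix.mul_assoc]
  have e7 : ∀ X : Matrix (Fin n) (Fin n) ℝ, Matrix.trace (X * Sg) = Matrix.trace (Sg * X) :=
    fun X => trace_mul_comm _ _
  rw [estCost, e1, e2, e4, e6, valueTerm, hfilt, hgain, ← hG, Delta]
  simp only [Matrix.mul_sub, Matrix.mul_add, trace_add, trace_sub, Matrix.mul_smul, Matrix.smul_mul,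
    Matrix.add_mul, trace_smul, smul_eq_mul, e7]
  ring

theorem integral_valueTerm (hp1 : S.p < 1)
    (hU : ∀ k, IsUnit (S.innovCov (S.predCov cov (fun _ => 0) k))) (i : ℕ) :
    Integrable (fun ω => S.valueTerm PW PP cov (fun k => β k ω) i) P ∧
    ∫ ω, S.valueTerm PW PP cov (fun k => β k ω) i ∂P = S.estCost PW PP P mean cov x0 v β i := by
  simp only [valueTerm_eq_tau_mul h.β_zero_or_one]
  refine ⟨h.integrable_tau_mul (i + 1) (integrable_const _), ?_⟩
  rw [h.integral_tau_mul hp1 (i + 1) measurable_const (integrable_const _), h.estCost_eq hp1 hU]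
  simp

end IsInput

/-- Decompose the left factor x_0 into estimate, gap and error: by orthogonality only the estimate
survives against the estimate and only the gap against the gap. -/
theorem IsFeedbackLoop.value_zero (hL : S.IsFeedbackLoop P LW LP x0 v β x u ut) (hp1 : S.p < 1) :
    Integrable (fun ω => x 0 ω ⬝ᵥ (PW *ᵥ estW P β x 0 ω)
      + x 0 ω ⬝ᵥ (PP *ᵥ (S.estP P v β x 0 ω - estW P β x 0 ω))) P ∧
    ∫ ω, (x 0 ω ⬝ᵥ (PW *ᵥ estW P β x 0 ω)
      + x 0 ω ⬝ᵥ (PP *ᵥ (S.estP P v β x 0 ω - estW P β x 0 ω))) ∂P =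
        S.value PW PP P mean cov x0 v β x 0 := by
  have hA := hL.isAdmissible h
  have hx := hA.memLp_x h 0
  have hW := hA.memLp_estA h 0
  have hg := hA.memLp_gap (mean := mean) (cov := cov) h 0
  have he := h.memLp_err 0
  have i1 := integrable_quad hx hW PW
  have i2 := integrable_quad hx hg PP
  have ae : (fun ω => x 0 ω ⬝ᵥ (PW *ᵥ estW P β x 0 ω)
      + x 0 ω ⬝ᵥ (PP *ᵥ (S.estP P v β x 0 ω - estW P β x 0 ω))) =ᵐ[P]
      fun ω => x 0 ω ⬝ᵥ (PW *ᵥ estA P β x 0 ω) +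
        x 0 ω ⬝ᵥ (PP *ᵥ S.gap P mean cov x0 v β x 0 ω) := by
    filter_upwards [hL.knownAt h hp1 0] with ω hω
    rw [hω.1, hω.2.1, gap]
  refine ⟨(i1.add i2).congr ae.symm, ?_⟩
  rw [integral_congr_ae ae, integral_add i1 i2, value]
  have hgm := hA.measurable_gap (mean := mean) (cov := cov) 0
  have hWm := measurable_estA (P := P) (β := β) (x := x) 0
  have hWG := hWm.mono (hA.infoA_le_infoG 0) le_rfl
  have og := hA.orth_gap (mean := mean) (cov := cov) h hp1 0
  have oe := h.orth_infoG_err hp1 0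
  have split : ∀ ω (y : Fin n → ℝ), x 0 ω ⬝ᵥ y = estA P β x 0 ω ⬝ᵥ y +
      S.gap P mean cov x0 v β x 0 ω ⬝ᵥ y + S.err mean cov x0 v β 0 ω ⬝ᵥ y := by
    intro ω y
    rw [← add_dotProduct, ← add_dotProduct]
    congr 1
    simp only [gap]; abel
  have key : ∀ (T : Matrix (Fin n) (Fin n) ℝ) {Y : Ω → Fin n → ℝ} (hY : MemLp Y 2 P),
      ∫ ω, x 0 ω ⬝ᵥ (T *ᵥ Y ω) ∂P = ∫ ω, estA P β x 0 ω ⬝ᵥ (T *ᵥ Y ω) ∂P +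
        ∫ ω, S.gap P mean cov x0 v β x 0 ω ⬝ᵥ (T *ᵥ Y ω) ∂P +
        ∫ ω, S.err mean cov x0 v β 0 ω ⬝ᵥ (T *ᵥ Y ω) ∂P := by
    intro T Y hY
    have j1 := integrable_quad hW hY T
    have j2 := integrable_quad hg hY T
    have j3 := integrable_quad he hY T
    have j4 : Integrable (fun ω => estA P β x 0 ω ⬝ᵥ (T *ᵥ Y ω) +
      S.gap P mean cov x0 v β x 0 ω ⬝ᵥ (T *ᵥ Y ω)) P := j1.add j2
    rw [← integral_add j1 j2, ← integral_add j4 j3]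
    exact integral_congr_ae (ae_of_all _ fun ω => split ω _)
  rw [key PW hW, key PP hg, og.integral_quad (hA.infoA_le h 0) hg hW (aesm hWm),
    oe.integral_quad (h.infoG_le 0) he hW (aesm hWG), oe.integral_quad (h.infoG_le 0) he hg (aesm hgm),
    og.integral_quad' (hA.infoA_le h 0) hg hW (aesm hWm)]
  simp [qform]

end

end NCS
end

/-! ### Realization of Gaussian inputs on a product space. -/

noncomputable section

open LQ

namespace LQ

theorem exists_gaussian {r : ℕ} (mean : Fin r → ℝ) {cov : Matrix (Fin r) (Fin r) ℝ}
    (hc : cov.PosSemidef) : ∃ μ : Measure (Fin r → ℝ), IsProbabilityMeasure μ ∧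
      ∀ c : Fin r → ℝ, μ.map (fun y => c ⬝ᵥ y) =
        gaussianReal (c ⬝ᵥ mean) (c ⬝ᵥ (cov *ᵥ c)).toNNReal := by
  set M := multivariateGaussian (WithLp.toLp 2 mean) cov
  have hof : Measurable (WithLp.ofLp : EuclideanSpace ℝ (Fin r) → Fin r → ℝ) := by fun_prop
  refine ⟨M.map WithLp.ofLp, Measure.isProbabilityMeasure_map hof.aemeasurable, fun c => ?_⟩
  have hd : Measurable fun y : Fin r → ℝ => c ⬝ᵥ y := by fun_prop
  rw [Measure.map_map hd hof]
  have e : (fun y : Fin r → ℝ => c ⬝ᵥ y) ∘ (WithLp.ofLp : EuclideanSpace ℝ (Fin r) → Fin r → ℝ) =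
      innerSL ℝ (WithLp.toLp 2 c) := by
    ext y
    simp [PiLp.inner_apply, dotProduct, mul_comm]
  rw [e, IsGaussian.map_eq_gaussianReal]
  congr 1
  · have h1 := (innerSL ℝ (WithLp.toLp 2 c : EuclideanSpace ℝ (Fin r))).integral_comp_comm
      (IsGaussian.integrable_fun_id (μ := M))
    refine h1.trans ?_
    rw [integral_id_multivariateGaussian, ← e]
    rfl
  · congr 1
    rw [← covariance_self (by fun_prop)]
    have h2 := covarianceBilin_multivariateGaussian (μ := WithLp.toLp 2 mean) hc
      (WithLp.toLp 2 c) (WithLp.toLp 2 c)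
    rw [covarianceBilin_apply_eq_cov IsGaussian.memLp_two_id] at h2
    exact h2

end LQ

namespace NCS

variable {n m a b : ℕ} {S : NCS n m a b}

/-- Every Gaussian initial state is realized by some input. -/
theorem exists_isInput (hp0 : 0 ≤ S.p) (hp1 : S.p < 1) (hQv : S.Qv.PosSemidef)
    (mean : Fin n → ℝ) {cov : Matrix (Fin n) (Fin n) ℝ} (hc : cov.PosSemidef) :
    ∃ (Ω : Type) (_ : MeasurableSpace Ω) (P : Measure Ω) (_ : IsProbabilityMeasure P)
      (x0 : Ω → Fin n → ℝ) (v : ℕ → Ω → Fin m → ℝ) (β : ℕ → Ω → ℝ),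
      S.IsInput P mean cov x0 v β := by
  obtain ⟨μ, hμ, hμl⟩ := exists_gaussian mean hc
  obtain ⟨ν, hν, hνl⟩ := exists_gaussian (0 : Fin m → ℝ) hQv
  set ρ : Measure Bool := ENNReal.ofReal (1 - S.p) • Measure.dirac true +
    ENNReal.ofReal S.p • Measure.dirac false with hρ
  have hρ1 : IsProbabilityMeasure ρ := by
    refine ⟨?_⟩
    simp only [hρ, Measure.add_apply, Measure.smul_apply, measure_univ, smul_eq_mul, mul_one]
    rw [← ENNReal.ofReal_add (by linarith) hp0]
    simp
  set N : Measure (ℕ → Fin m → ℝ) := Measure.infinitePi fun _ => ν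
  set R : Measure (ℕ → Bool) := Measure.infinitePi fun _ => ρ
  set P : Measure ((Fin n → ℝ) × ((ℕ → Fin m → ℝ) × (ℕ → Bool))) := μ.prod (N.prod R)
  set f : Bool → ℝ := fun t => if t then 1 else 0 with hf
  have hfm : Measurable f := measurable_of_countable f
  have hN : P.map (fun ω => ω.2.1) = N := by
    have : (fun ω : (Fin n → ℝ) × ((ℕ → Fin m → ℝ) × (ℕ → Bool)) => ω.2.1) =
      Prod.fst ∘ Prod.snd := rfl
    rw [this, ← Measure.map_map measurable_fst measurable_snd, Measure.map_snd_prod,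
      measure_univ, one_smul, Measure.map_fst_prod, measure_univ, one_smul]
  have hR : P.map (fun ω => ω.2.2) = R := by
    have : (fun ω : (Fin n → ℝ) × ((ℕ → Fin m → ℝ) × (ℕ → Bool)) => ω.2.2) =
      Prod.snd ∘ Prod.snd := rfl
    rw [this, ← Measure.map_map measurable_snd measurable_snd, Measure.map_snd_prod,
      measure_univ, one_smul, Measure.map_snd_prod, measure_univ, one_smul]
  have hv : ∀ k, P.map (fun ω => ω.2.1 k) = ν := by
    intro k
    have : (fun ω : (Fin n → ℝ) × ((ℕ → Fin m → ℝ) × (ℕ → Bool)) => ω.2.1 k) =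
      Function.eval k ∘ fun ω : (Fin n → ℝ) × ((ℕ → Fin m → ℝ) × (ℕ → Bool)) => ω.2.1 := rfl
    rw [this, ← Measure.map_map (measurable_pi_apply k) (by fun_prop), hN]
    exact Measure.infinitePi_map_eval (fun _ => ν) k
  have hb : ∀ k, P.map (fun ω => ω.2.2 k) = ρ := by
    intro k
    have : (fun ω : (Fin n → ℝ) × ((ℕ → Fin m → ℝ) × (ℕ → Bool)) => ω.2.2 k) =
      Function.eval k ∘ fun ω : (Fin n → ℝ) × ((ℕ → Fin m → ℝ) × (ℕ → Bool)) => ω.2.2 := rfl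
    rw [this, ← Measure.map_map (measurable_pi_apply k) (by fun_prop), hR]
    exact Measure.infinitePi_map_eval (fun _ => ρ) k
  have mβ : ∀ k, Measurable fun ω : (Fin n → ℝ) × ((ℕ → Fin m → ℝ) × (ℕ → Bool)) => f (ω.2.2 k) :=
    fun k => hfm.comp (by fun_prop)
  refine ⟨_, inferInstance, P, inferInstance, fun ω => ω.1, fun k ω => ω.2.1 k,
    fun k ω => f (ω.2.2 k), ⟨measurable_fst, hc, fun c => ?_⟩,
    fun k => ⟨by fun_prop, hQv, fun c => ?_⟩, mβ, fun k ω => ?_, fun k => ?_, ?_, ?_, ?_, ?_⟩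
  · have : (fun ω : (Fin n → ℝ) × ((ℕ → Fin m → ℝ) × (ℕ → Bool)) => c ⬝ᵥ ω.1) =
      (fun y => c ⬝ᵥ y) ∘ Prod.fst := rfl
    rw [this, ← Measure.map_map (by fun_prop) measurable_fst, Measure.map_fst_prod,
      measure_univ, one_smul, hμl]
  · have : (fun ω : (Fin n → ℝ) × ((ℕ → Fin m → ℝ) × (ℕ → Bool)) => c ⬝ᵥ ω.2.1 k) =
      (fun y => c ⬝ᵥ y) ∘ fun ω => ω.2.1 k := rfl
    rw [this, ← Measure.map_map (by fun_prop) (by fun_prop), hv, hνl]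
  · simp only [hf]
    by_cases ht : ω.2.2 k <;> simp [ht]
  · have e : {ω : (Fin n → ℝ) × ((ℕ → Fin m → ℝ) × (ℕ → Bool)) | f (ω.2.2 k) = 1} =
        (fun ω => ω.2.2 k) ⁻¹' {true} := by
      ext ω
      simp only [hf, Set.mem_ofPred_eq, Set.mem_preimage, Set.mem_singleton_iff]
      by_cases ht : ω.2.2 k <;> simp [ht]
    rw [e, ← Measure.map_apply (by fun_prop) (measurableSet_singleton true), hb]
    simp [hρ]
  · rw [iIndepFun_iff_map_fun_eq_infinitePi_map (by fun_prop)]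
    simp only [hv]
    exact hN
  · rw [iIndepFun_iff_map_fun_eq_infinitePi_map mβ]
    have e1 : ∀ k, P.map (fun ω => f (ω.2.2 k)) = ρ.map f := by
      intro k
      rw [← hb k, Measure.map_map hfm (by fun_prop)]; rfl
    simp only [e1]
    have e2 : (fun (ω : (Fin n → ℝ) × ((ℕ → Fin m → ℝ) × (ℕ → Bool))) k => f (ω.2.2 k)) =
      (fun (g : ℕ → Bool) k => f (g k)) ∘ fun ω => ω.2.2 := rfl
    rw [e2, ← Measure.map_map (by fun_prop) (by fun_prop), hR]
    exact Measure.infinitePi_map_pi (μ := fun _ => ρ) (f := fun _ => f) fun _ => hfm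
  · have h1 : IndepFun (fun q : (ℕ → Fin m → ℝ) × (ℕ → Bool) => q.1)
        (fun q => fun k => f (q.2 k)) (N.prod R) :=
      indepFun_prod (X := id) (Y := fun (g : ℕ → Bool) k => f (g k)) measurable_id (by fun_prop)
    rw [indepFun_iff_map_prod_eq_prod_map_map (by fun_prop) (by fun_prop)] at h1 ⊢
    have hs : P.map Prod.snd = N.prod R := by
      rw [Measure.map_snd_prod, measure_univ, one_smul]
    rw [← hs, Measure.map_map (by fun_prop) measurable_snd, Measure.map_map (by fun_prop)
      measurable_snd, Measure.map_map (by fun_prop) measurable_snd] at h1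
    exact h1
  · exact indepFun_prod (X := id)
      (Y := fun (q : (ℕ → Fin m → ℝ) × (ℕ → Bool)) => (q.1, fun k => f (q.2 k)))
      measurable_id (by fun_prop)

end NCS
end

/-! ### Necessity: from stabilizability to Riccati solutions. -/

noncomputable section

open LQ

namespace LQ

/-- Cauchy–Schwarz against a unit vector: the residual of the projection of X on Y has nonnegative
second moment. -/
theorem sq_integral_mul_le {Ω : Type} [MeasurableSpace Ω] {P : Measure Ω} {X Y : Ω → ℝ}
    (hX : MemLp X 2 P) (hY : MemLp Y 2 P) (h1 : ∫ ω, Y ω * Y ω ∂P = 1) :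
    (∫ ω, X ω * Y ω ∂P) ^ 2 ≤ ∫ ω, X ω * X ω ∂P := by
  set c := ∫ ω, X ω * Y ω ∂P with hc
  have i1 : Integrable (fun ω => X ω * X ω) P := hX.integrable_mul hX
  have i2 : Integrable (fun ω => X ω * Y ω) P := hX.integrable_mul hY
  have i3 : Integrable (fun ω => Y ω * Y ω) P := hY.integrable_mul hY
  have i4 : Integrable (fun ω => X ω * X ω - 2 * c * (X ω * Y ω)) P := i1.sub (i2.const_mul _)
  have h0 : 0 ≤ ∫ ω, (X ω - c * Y ω) ^ 2 ∂P := integral_nonneg fun ω => sq_nonneg _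
  have e : ∀ ω, (X ω - c * Y ω) ^ 2 = X ω * X ω - 2 * c * (X ω * Y ω) + c ^ 2 * (Y ω * Y ω) :=
    fun ω => by ring
  simp only [e] at h0
  rw [integral_add i4 (i3.const_mul _), integral_sub i1 (i2.const_mul _), integral_const_mul,
    integral_const_mul, h1, ← hc] at h0
  nlinarith

theorem integral_mul_self_le_qform {Ω : Type} [MeasurableSpace Ω] {P : Measure Ω}
    [IsProbabilityMeasure P] {r : ℕ} {X : Ω → Fin r → ℝ} (hX : MemLp X 2 P) (i : Fin r) :
    ∫ ω, X ω i * X ω i ∂P ≤ qform P 1 X := by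
  rw [qform_one]
  refine integral_mono (integrable_apply_mul hX hX i i) (integrable_dot hX hX) fun ω => ?_
  have := sq_le_dot_self (X ω) i
  simpa [sq] using this

theorem tendsto_matrix_zero {ι κ : Type*} {F : ℕ → Matrix ι κ ℝ} {q : ℕ → ℝ}
    (hq : Tendsto q atTop (𝓝 0)) (h : ∀ k i j, (F k i j) ^ 2 ≤ q k) : Tendsto F atTop (𝓝 0) := by
  refine tendsto_pi_nhds.2 fun i => tendsto_pi_nhds.2 fun j => ?_
  have h1 : Tendsto (fun k => (F k i j) ^ 2) atTop (𝓝 0) :=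
    squeeze_zero (fun k => sq_nonneg _) (fun k => h k i j) hq
  have h2 : Tendsto (fun k => |F k i j|) atTop (𝓝 0) := by
    have := h1.sqrt
    simpa only [Real.sqrt_sq_eq_abs, Real.sqrt_zero] using this
  exact (tendsto_zero_iff_abs_tendsto_zero _).2 h2

end LQ

namespace NCS

variable {n m a b : ℕ} {S : NCS n m a b} {Ω : Type} {mean : Fin n → ℝ}
  {cov : Matrix (Fin n) (Fin n) ℝ} {x0 : Ω → Fin n → ℝ}
  {v : ℕ → Ω → Fin m → ℝ} {β : ℕ → Ω → ℝ}
  {x : ℕ → Ω → Fin n → ℝ} {u : ℕ → Ω → (Fin a ⊕ Fin b) → ℝ} {ut : ℕ → Ω → Fin b → ℝ}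
  {LW : Matrix (Fin a ⊕ Fin b) (Fin n) ℝ} {LP : Matrix (Fin b) (Fin n) ℝ}

section Input

variable [m0 : MeasurableSpace Ω] {P : Measure Ω} [IsProbabilityMeasure P]

theorem MeanSquareConverges.tendsto_qform (h : MeanSquareConverges P x)
    (hx : ∀ k, MemLp (x k) 2 P) : Tendsto (fun k => qform P 1 (x k)) atTop (𝓝 0) := by
  have h1 := (ENNReal.tendsto_toReal ENNReal.zero_ne_top).comp h
  rw [ENNReal.toReal_zero] at h1
  refine h1.congr fun k => ?_
  rw [qform_one, integral_eq_lintegral_of_nonneg_ae (ae_of_all _ fun ω => dot_self_nonneg _)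
    (integrable_dot (hx k) (hx k)).1]
  rfl

/-- Both estimates have the mean of the state, so the embedded control has mean zero and the mean
follows A + B `LW`. -/
theorem IsFeedbackLoop.integral_state (h : S.IsInput P mean cov x0 v β)
    (hL : S.IsFeedbackLoop P LW LP x0 v β x u ut) (k : ℕ) :
    ∫ ω, x k ω ∂P = S.lossMean LW mean k := by
  have hA := hL.isAdmissible h
  induction k with
  | zero =>
    rw [hL.1.1]
    exact h.integral_lossState (LW := LW) (LP := LP) 0
  | succ k ih =>
    have hx := (hA.memLp_x h k).integrable one_le_two
    have hleP : S.infoP v β x k ≤ m0 := (hA.infoP_le_infoG k).trans (h.infoG_le k)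
    have hleW : infoW β x k ≤ m0 := le_sup_left.trans hleP
    have iW : Integrable (estW P β x k) P := integrable_condExp
    have iP : Integrable (S.estP P v β x k) P := integrable_condExp
    have eW : ∫ ω, estW P β x k ω ∂P = S.lossMean LW mean k := (integral_condExp hleW).trans ih
    have eP : ∫ ω, S.estP P v β x k ω ∂P = S.lossMean LW mean k := (integral_condExp hleP).trans ih
    have iu := (hA.memLp_u k).integrable one_le_two
    have it := (hA.memLp_ut k).integrable one_le_two
    have i1 : Integrable (fun ω => S.A *ᵥ x k ω) P :=
      (memLp_mulVec (hA.memLp_x h k) _).integrable one_le_two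
    have i2 : Integrable (fun ω => S.B *ᵥ u k ω) P :=
      (memLp_mulVec (hA.memLp_u k) _).integrable one_le_two
    have i3 : Integrable (fun ω => S.BP *ᵥ ut k ω) P :=
      (memLp_mulVec (hA.memLp_ut k) _).integrable one_le_two
    have i4 : Integrable (fun ω => S.A *ᵥ x k ω + S.B *ᵥ u k ω) P := i1.add i2
    have iPW : Integrable (fun ω => S.estP P v β x k ω - estW P β x k ω) P := iP.sub iW
    have eu : ∫ ω, u k ω ∂P = LW *ᵥ S.lossMean LW mean k := by
      rw [funext (hL.2.1 k), integral_mulVec iW, eW]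
    have et : ∫ ω, ut k ω ∂P = 0 := by
      rw [funext (hL.2.2 k), integral_mulVec iPW, integral_sub iP iW, eW, eP, sub_self,
        mulVec_zero]
    rw [funext (hL.1.2 k), integral_add i4 i3, integral_add i1 i2, integral_mulVec hx,
      integral_mulVec iu, integral_mulVec it, ih, eu, et, lossMean_succ, mulVec_zero, add_zero]

/-- The part of the state without a reception bounds the state in mean square below. -/
theorem IsFeedbackLoop.qform_lossState_le (h : S.IsInput P mean cov x0 v β)
    (hL : S.IsFeedbackLoop P LW LP x0 v β x u ut) (hp1 : S.p < 1) (k : ℕ) :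
    S.p ^ k * qform P 1 (S.lossState LW LP mean cov x0 v k) ≤ qform P 1 (x k) := by
  have hA := hL.isAdmissible h
  have hx := hA.memLp_x h k
  have h0 := h.memLp_lossState (LW := LW) (LP := LP) k
  have hm : Measurable[hist x0 v β 0] (S.lossState LW LP mean cov x0 v k) := by
    have e : S.lossState LW LP mean cov x0 v k = fun ω =>
        (S.lossState LW LP mean cov x0 v k ω - S.filtErr mean cov x0 v k ω) +
          S.filtErr mean cov x0 v k ω := by ext1 ω; abel
    rw [e]
    have hf : Measurable fun q : (Fin n → ℝ) × (Fin n → ℝ) => q.1 + q.2 := by fun_prop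
    exact hf.comp (((measurable_lossState_sub k).mono (infoF_le_hist k) le_rfl).prodMk
      (measurable_hist_filtErr k))
  rw [← h.qform_tau_smul hp1 k h0 hm]
  obtain ⟨_, _, _, _, hae⟩ := hL.knownBefore h hp1 k k le_rfl
  have ht := h.memLp_tau_smul k h0
  refine integral_mono_ae (integrable_quad ht ht 1) (integrable_quad hx hx 1) ?_
  filter_upwards [hae] with ω hω
  simp only [one_mulVec]
  rcases h.tau_zero_or_one k ω with hz | hz
  · rw [hz, zero_smul, zero_dotProduct]; exact dot_self_nonneg _
  · rw [hz, one_smul, (hω.1 hz).2]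

/-- For a centred initial state the correlation with x_0 obeys a controlled linear recursion with
input matrix B^P; the filter error only alters the input, which is arbitrary in `exists_ric_eq`. -/
theorem cross_lossState_succ (h : S.IsInput P 0 1 x0 v β) (k : ℕ) :
    cross P (S.lossState LW LP 0 1 x0 v (k + 1)) x0 =
      S.A * cross P (S.lossState LW LP 0 1 x0 v k) x0 +
        S.BP * (LP * (cross P (S.lossState LW LP 0 1 x0 v k) x0 -
          cross P (S.filtErr 0 1 x0 v k) x0)) := by
  have h0 := h.memLp_lossState (LW := LW) (LP := LP) k
  have h1 := h.memLp_filtErr k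
  have h2 : MemLp (fun ω => S.lossState LW LP 0 1 x0 v k ω - S.filtErr 0 1 x0 v k ω) 2 P :=
    h0.sub h1
  have hz : S.lossMean LW 0 k = 0 := by simp [lossMean]
  have e : S.lossState LW LP 0 1 x0 v (k + 1) = fun ω => S.A *ᵥ S.lossState LW LP 0 1 x0 v k ω +
      S.BP *ᵥ (LP *ᵥ (S.lossState LW LP 0 1 x0 v k ω - S.filtErr 0 1 x0 v k ω)) := by
    ext1 ω
    simp only [lossState, hz, mulVec_zero, add_zero, sub_zero]
  have h3 := memLp_mulVec h2 LP
  rw [e, cross_add_left (memLp_mulVec h0 _) (memLp_mulVec h3 _) h.memLp_x0,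
    cross_mulVec_left h0 h.memLp_x0, cross_mulVec_left h3 h.memLp_x0,
    cross_mulVec_left h2 h.memLp_x0, cross_sub_left h0 h1 h.memLp_x0]

theorem cross_initial (h : S.IsInput P 0 1 x0 v β) : cross P x0 x0 = 1 := by
  ext i j
  simpa [cross] using h.gaussian_x0.integral_mul i j

end Input

/-- Mean-square stabilizability makes the Riccati equation of the remote controller solvable. -/
theorem IsMeanSquareStabilizable.exists_remote (hst : S.IsMeanSquareStabilizable)
    (hp0 : 0 ≤ S.p) (hp1 : S.p < 1) (hRW : S.RW.PosDef) (hRP : S.RP.PosDef)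
    (hQv : S.Qv.PosSemidef) (hQ : S.Q.PosSemidef) {Qhalf : Matrix (Fin n) (Fin n) ℝ}
    (hQhalf : Qhalf.PosSemidef) (hQhalf_sq : Qhalf * Qhalf = S.Q)
    (hobs : IsObservablePair S.A Qhalf) :
    ∃ PW : Matrix (Fin n) (Fin n) ℝ, PW.PosDef ∧ PW = ric S.A S.B S.Q S.R PW := by
  obtain ⟨LW, LP, hs⟩ := hst
  have hR := posDef_R hRW hRP
  set F := S.A + S.B * LW with hF
  have hlim : Tendsto (fun k => F ^ k) atTop (𝓝 0) := by
    refine tendsto_pi_nhds.2 fun i => tendsto_pi_nhds.2 fun j => ?_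
    -- Initial mean e_j: the mean of the state at time `k` is then column j of F^k. The covariance
    -- plays no role.
    obtain ⟨Ω, mΩ, P, hP, x0, v, β, hin⟩ :=
      exists_isInput hp0 hp1 hQv (Pi.single j 1) (PosSemidef.one (n := Fin n) (R := ℝ))
    obtain ⟨x, u, ut, hL, hx⟩ := hs _ _ PosSemidef.one Ω P x0 v β hin
    have hA := hL.isAdmissible hin
    have hq := hx.tendsto_qform fun k => hA.memLp_x hin k
    have hsq : ∀ k, ((F ^ k) i j) ^ 2 ≤ qform P 1 (x k) := by
      intro k
      have hxk := hA.memLp_x hin k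
      have e1 : (F ^ k) i j = ∫ ω, x k ω i * 1 ∂P := by
        simp only [mul_one]
        rw [← eval_integral fun i => (hxk.integrable one_le_two).eval i, hL.integral_state hin]
        simp [lossMean, hF]
      rw [e1]
      refine (sq_integral_mul_le (memLp_pi_iff.1 hxk i) (memLp_const 1) (by simp)).trans ?_
      exact integral_mul_self_le_qform hxk i
    have h1 : Tendsto (fun k => ((F ^ k) i j) ^ 2) atTop (𝓝 0) :=
      squeeze_zero (fun k => sq_nonneg _) hsq hq
    have h2 : Tendsto (fun k => |(F ^ k) i j|) atTop (𝓝 0) := by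
      have := h1.sqrt
      simpa only [Real.sqrt_sq_eq_abs, Real.sqrt_zero] using this
    exact (tendsto_zero_iff_abs_tendsto_zero _).2 h2
  obtain ⟨PW, hPW, hric⟩ := exists_ric_eq (A := S.A) (B := S.B) hQ hR (F := fun k => F ^ k)
    (U := fun k => LW * F ^ k) (pow_zero F)
    (fun k => by rw [pow_succ', hF, Matrix.add_mul, Matrix.mul_assoc]) hlim
  exact ⟨PW, posDef_of_ric_eq hQhalf hR hobs hPW (by rw [hQhalf_sq]; exact hric), hric⟩

/-- Mean-square stabilizability makes the Riccati equation of the embedded controller solvable. -/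
theorem IsMeanSquareStabilizable.exists_embedded (hst : S.IsMeanSquareStabilizable)
    (hp0 : 0 ≤ S.p) (hp1 : S.p < 1) (hRP : S.RP.PosDef) (hQv : S.Qv.PosSemidef)
    (hQ : S.Q.PosSemidef) {PW : Matrix (Fin n) (Fin n) ℝ} (hPW : PW.PosSemidef) :
    ∃ Δ : Matrix (Fin n) (Fin n) ℝ, Δ.PosSemidef ∧
      Δ = (1 - S.p) • PW + S.p • ric S.A S.BP S.Q S.RP Δ := by
  obtain ⟨LW, LP, hs⟩ := hst
  -- Zero mean removes the remote feedback from the loss-only state, and unit covariance makes the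
  -- correlation start at the identity.
  obtain ⟨Ω, mΩ, P, hP, x0, v, β, hin⟩ :=
    exists_isInput hp0 hp1 hQv 0 (PosSemidef.one (n := Fin n) (R := ℝ))
  obtain ⟨x, u, ut, hL, hx⟩ := hs _ _ PosSemidef.one Ω P x0 v β hin
  have hA := hL.isAdmissible hin
  have hq := hx.tendsto_qform fun k => hA.memLp_x hin k
  -- Scaling `A` by √p absorbs the factor p into the quadratic terms of the Riccati operator; p^k
  -- from the probability of no earlier reception becomes the square of s^k.
  set s := Real.sqrt S.p with hsdef
  have hss : s * s = S.p := Real.mul_self_sqrt hp0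
  set C : ℕ → Matrix (Fin n) (Fin n) ℝ := fun k => cross P (S.lossState LW LP 0 1 x0 v k) x0
  have hlim : Tendsto (fun k => s ^ k • C k) atTop (𝓝 0) := by
    refine tendsto_matrix_zero hq fun k i j => ?_
    have h0 := hin.memLp_lossState (LW := LW) (LP := LP) k
    have h1 := sq_integral_mul_le (memLp_pi_iff.1 h0 i) (memLp_pi_iff.1 hin.memLp_x0 j)
      (by
        have := congrFun (congrFun (cross_initial hin) j) j
        simpa [cross] using this)
    have h2 := integral_mul_self_le_qform h0 i
    have h3 := hL.qform_lossState_le hin hp1 k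
    calc ((s ^ k • C k) i j) ^ 2 = S.p ^ k *
          (∫ ω, S.lossState LW LP 0 1 x0 v k ω i * x0 ω j ∂P) ^ 2 := by
          rw [Matrix.smul_apply, smul_eq_mul, mul_pow, ← pow_mul, mul_comm k 2, pow_mul, sq s, hss]
          rfl
      _ ≤ S.p ^ k * qform P 1 (S.lossState LW LP 0 1 x0 v k) :=
          mul_le_mul_of_nonneg_left (h1.trans h2) (pow_nonneg hp0 k)
      _ ≤ qform P 1 (x k) := h3
  have hQ' : (S.p • S.Q + (1 - S.p) • PW).PosSemidef :=
    (hQ.smul hp0).add (hPW.smul (by linarith))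
  -- With √p A and state weight pQ + (1-p)P^W the Riccati equation is precisely the fixed-point
  -- equation for Δ.
  obtain ⟨Δ, hΔ, hric⟩ := exists_ric_eq (A := s • S.A) (B := S.BP) hQ' hRP
    (F := fun k => s ^ k • C k)
    (U := fun k => s ^ (k + 1) • (LP * (C k - cross P (S.filtErr 0 1 x0 v k) x0)))
    (by rw [pow_zero, one_smul]; exact cross_initial hin)
    (fun k => by
      have e : C (k + 1) = _ := cross_lossState_succ hin k
      rw [e, smul_add, pow_succ]
      simp only [Matrix.smul_mul, Matrix.mul_smul, smul_smul]
      rw [mul_comm (s ^ k) s]) hlim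
  refine ⟨Δ, hΔ, ?_⟩
  conv_lhs => rw [hric]
  simp only [ric, transpose_smul, Matrix.smul_mul, Matrix.mul_smul, smul_smul, hss, smul_add,
    smul_sub]
  abel

theorem IsMeanSquareStabilizable.exists_riccati (hst : S.IsMeanSquareStabilizable)
    (hp0 : 0 ≤ S.p) (hp1 : S.p < 1) (hRW : S.RW.PosDef) (hRP : S.RP.PosDef)
    (hQv : S.Qv.PosSemidef) (hQ : S.Q.PosSemidef) {Qhalf : Matrix (Fin n) (Fin n) ℝ}
    (hQhalf : Qhalf.PosSemidef) (hQhalf_sq : Qhalf * Qhalf = S.Q)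
    (hobs : IsObservablePair S.A Qhalf) :
    ∃ PW PP : Matrix (Fin n) (Fin n) ℝ,
        S.IsRiccatiSolution PW PP ∧ PW.PosDef ∧ (S.Delta PW PP).PosDef := by
  obtain ⟨PW, hPW, hricW⟩ := hst.exists_remote hp0 hp1 hRW hRP hQv hQ hQhalf hQhalf_sq hobs
  obtain ⟨Δ, hΔ, hricΔ⟩ := hst.exists_embedded hp0 hp1 hRP hQv hQ hPW.posSemidef
  have hD : S.Delta PW (ric S.A S.BP S.Q S.RP Δ) = Δ := hricΔ.symm
  refine ⟨PW, ric S.A S.BP S.Q S.RP Δ, ⟨hricW, ?_⟩, hPW, ?_⟩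
  · rw [Om, L, hD]; rfl
  -- Since p < 1, the summand (1-p)P^W is already positive definite.
  · rw [Delta]
    exact (hPW.smul (by linarith)).add_posSemidef ((posSemidef_ric hΔ hRP hQ).smul hp0)

end NCS
end

theorem theorem3 {n m a b d : ℕ} (S : NCS n m a b)
    (D : Matrix (Fin d) (Fin n) ℝ) (Qhalf : Matrix (Fin n) (Fin n) ℝ)
    (hp0 : 0 ≤ S.p) (hp1 : S.p < 1)
    (hRW : S.RW.PosDef) (hRP : S.RP.PosDef) (hQv : S.Qv.PosSemidef)
    (hQ : S.Q = Dᵀ * D)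
    (hQhalf : Qhalf.PosSemidef) (hQhalf_sq : Qhalf * Qhalf = S.Q)
    (hobs : IsObservablePair S.A Qhalf) (hdet : IsDetectablePair S.A S.H) :
    (S.IsMeanSquareStabilizable ↔
      ∃ PW PP : Matrix (Fin n) (Fin n) ℝ,
        S.IsRiccatiSolution PW PP ∧ PW.PosDef ∧ (S.Delta PW PP).PosDef) ∧
    (∀ PW PP : Matrix (Fin n) (Fin n) ℝ,
      S.IsRiccatiSolution PW PP → PW.PosDef → (S.Delta PW PP).PosDef →
      S.IsStabilizedBy (-((S.Gam PW)⁻¹ * S.M PW)) (-((S.Om PW PP)⁻¹ * S.L PW PP)) ∧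
      ∀ (mean : Fin n → ℝ) (cov : Matrix (Fin n) (Fin n) ℝ), cov.PosSemidef →
      ∀ (Ω : Type) [MeasurableSpace Ω] (P : Measure Ω) [IsProbabilityMeasure P]
        (x0 : Ω → Fin n → ℝ) (v : ℕ → Ω → Fin m → ℝ) (β : ℕ → Ω → ℝ),
        S.IsInput P mean cov x0 v β →
        ∃ (x : ℕ → Ω → Fin n → ℝ) (u : ℕ → Ω → (Fin a ⊕ Fin b) → ℝ) (ut : ℕ → Ω → Fin b → ℝ),
          S.IsFeedbackLoop P (-((S.Gam PW)⁻¹ * S.M PW)) (-((S.Om PW PP)⁻¹ * S.L PW PP))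
            x0 v β x u ut ∧
          S.IsAdmissible P x0 v β x u ut ∧
          (∀ x' u' ut', S.IsAdmissible P x0 v β x' u' ut' →
            S.cost P x u ut ≤ S.cost P x' u' ut') ∧
          S.cost P x u ut ≠ ⊤ ∧
          ((∀ k, IsUnit (S.innovCov (S.predCov cov (fun _ => 0) k))) →
            (∀ i, Integrable (fun ω => S.valueTerm PW PP cov (fun k => β k ω) i) P) ∧
            ∃ s : ℝ,
              HasSum (fun i => ∫ ω, S.valueTerm PW PP cov (fun k => β k ω) i ∂P) s ∧
              Integrable (fun ω => x 0 ω ⬝ᵥ (PW *ᵥ NCS.estW P β x 0 ω)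
                + x 0 ω ⬝ᵥ (PP *ᵥ (S.estP P v β x 0 ω - NCS.estW P β x 0 ω))) P ∧
              (S.cost P x u ut).toReal =
                (∫ ω, (x 0 ω ⬝ᵥ (PW *ᵥ NCS.estW P β x 0 ω)
                  + x 0 ω ⬝ᵥ (PP *ᵥ (S.estP P v β x 0 ω - NCS.estW P β x 0 ω))) ∂P) + s)) := by
  have hQpsd : S.Q.PosSemidef := by
    rw [hQ]
    simpa [Matrix.conjTranspose_eq_transpose_of_trivial] using
      Matrix.posSemidef_conjTranspose_mul_self D
  have hloop : ∀ PW PP : Matrix (Fin n) (Fin n) ℝ,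
      S.IsRiccatiSolution PW PP → PW.PosDef → (S.Delta PW PP).PosDef →
      S.IsStabilizedBy (-((S.Gam PW)⁻¹ * S.M PW)) (-((S.Om PW PP)⁻¹ * S.L PW PP)) := by
    intro PW PP hric hPW hΔ mean cov _ Ω _ P _ x0 v β h
    obtain ⟨x, u, ut, hL⟩ := NCS.exists_isFeedbackLoop S P (-((S.Gam PW)⁻¹ * S.M PW))
      (-((S.Om PW PP)⁻¹ * S.L PW PP)) x0 v β
    have hA := hL.isAdmissible h
    exact ⟨x, u, ut, hL, hA.meanSquareConverges h (hA.cost_eq h hp0 hp1 hRW hRP hQhalf hQhalf_sq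
      hobs hdet hQpsd hric hPW hΔ (hL.excess_eq_zero h hp1)).2⟩
  refine ⟨⟨fun hst => hst.exists_riccati hp0 hp1 hRW hRP hQv hQpsd hQhalf hQhalf_sq hobs, ?_⟩,
    fun PW PP hric hPW hΔ => ⟨hloop PW PP hric hPW hΔ, ?_⟩⟩
  · rintro ⟨PW, PP, hric, hPW, hΔ⟩
    exact ⟨_, _, hloop PW PP hric hPW hΔ⟩
  intro mean cov _ Ω _ P _ x0 v β h
  obtain ⟨x, u, ut, hL⟩ := NCS.exists_isFeedbackLoop S P (-((S.Gam PW)⁻¹ * S.M PW))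
    (-((S.Om PW PP)⁻¹ * S.L PW PP)) x0 v β
  have hA := hL.isAdmissible h
  have hPP := hric.posSemidef hΔ hRP hQpsd
  have hcost := (hA.cost_eq h hp0 hp1 hRW hRP hQhalf hQhalf_sq hobs hdet hQpsd hric hPW hΔ
    (hL.excess_eq_zero h hp1)).1
  refine ⟨x, u, ut, hL, hA, fun x' u' ut' hA' => ?_, ?_, fun hU => ⟨fun i =>
    (h.integral_valueTerm hp1 hU i).1,
      ∑' k, S.estCost PW PP P mean cov x0 v β k, ?_, (hL.value_zero h hp1).1, ?_⟩⟩
  -- Optimality: the competitor starts from the same initial state, so its lower bound is the very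
  -- number attained by the feedback.
  · rw [hcost, NCS.value_zero_congr (hA.traj.1.trans hA'.traj.1.symm)]
    exact hA'.le_cost h hp0 hp1 hRW hRP hQhalf hQhalf_sq hobs hdet hQpsd hric hPW hΔ
  · rw [hcost]; exact ENNReal.ofReal_ne_top
  · simp only [(h.integral_valueTerm hp1 hU _).2]
    exact (h.summable_estCost hp0 hp1 hdet hQpsd hPW.posSemidef hPP).hasSum
  · rw [hcost, (hL.value_zero h hp1).2, ENNReal.toReal_ofReal]
    exact add_nonneg (add_nonneg (LQ.qform_nonneg hPW.posSemidef _) (LQ.qform_nonneg hPP _))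
      (tsum_nonneg fun k => NCS.IsInput.estCost_nonneg hp1 hQpsd hPW.posSemidef hPP k)
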